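/- Fix a set $\mathcal P$ of processes and a linearly ordered set $\mathcal V$ of values. A queue operation consists of a unique identifier, a process in $\mathcal P$, one of the abstract operations $\mathrm{enq}(v)$, $\mathrm{deq}(v)$, $\mathrm{peek}(v)$ (with $v\in\mathcal V$) or $\mathrm{empty}$, and invocation and response times $t_{\rm inv}<t_{\rm res}$ in $\mathbb Q_{\ge 0}$. A queue history $H$ is a finite set of operations with distinct identifiers such that any two distinct operations $o,o'$ of the same process satisfy $t_{\rm res}(o)<t_{\rm inv}(o')$ or $t_{\rm res}(o')<t_{\rm inv}(o)$. It is unambiguous if every value that occurs in it is enqueued by exactly one operation and dequeued by at most one operation (the numbers of peek and empty operations are not restricted). It is linearizable if there is an injective map $\ell:H\to\mathbb Q_{\ge0}$ with $t_{\rm inv}(o)<\ell(o)<t_{\rm res}(o)$ for all $o\in H$ such that the abstract operations of $H$, listed by increasing $\ell$, form a legal sequential behaviour of a FIFO queue that is initially empty: $\mathrm{enq}(v)$ inserts $v$; $\mathrm{deq}(v)$ is possible only if $v$ is the oldest element, and removes it; $\mathrm{peek}(v)$ is possible only if $v$ is the oldest element, and changes nothing; $\mathrm{empty}$ is possible only if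 the queue is empty, and changes nothing. The model of computation is the unit-cost random access machine, given by structured programs over registers and arrays of natural numbers with addition, truncated subtraction and comparison. The input is an array of the $n$ operations of a history, in arbitrary order. It is accessed only by reading $n$, testing the method of an operation, comparing the invocation or response times of two operations, and comparing the values of two operations, each at unit cost. **Theorem.** Linearizability of unambiguous queue histories is decidable in $O(n\log n)$ time, where $n$ is the number of operations of the history: there are a single program, independent of $\mathcal P$ and $\mathcal V$, and a function $T:\mathbb N\to\mathbb N$ with $T(n)=O(n\log n)$ as $n\to\infty$, such that on every input array of an unambiguous queue history with $n$ operations the program terminates after at most $T(n)$ steps and answers correctly whether the history is linearizable. -/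

import Mathlib

open Filter Asymptotics

universe u v

namespace QueueMonitoring

/-! ### Queue histories -/

/-- The methods of the queue data type. -/
inductive Method where
  | enq
  | deq
  | peek
  | empty

/-- Abstract operations `m(v)` of the queue data type over the values `V`. The operation `empty`
carries no value of `V`. -/
inductive AbsOp (V : Type v) where
  | enq (x : V)
  | deq (x : V)
  | peek (x : V)
  | empty

/-- The method of an abstract operation. -/
def AbsOp.method {V : Type v} : AbsOp V → Method
  | .enq _ => .enq
  | .deq _ => .deq
  | .peek _ => .peek
  | .empty => .empty

/-- The value of an abstract operation; `none` is the dedicated symbol `⊚` of `empty`. -/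
def AbsOp.val {V : Type v} : AbsOp V → Option V
  | .enq x => some x
  | .deq x => some x
  | .peek x => some x
  | .empty => none

/-- An operation: a unique identifier, the executing process, the method with its value, and the
(nonnegative rational) invocation and response times. -/
structure Operation (P : Type u) (V : Type v) where
  id : ℕ
  proc : P
  abs : AbsOp V
  inv : NNRat
  res : NNRat
  inv_lt_res : inv < res

/-- A (concurrent, well-formed) queue history: a finite set of operations with distinct
identifiers, in which the operations of each process do not overlap in time. -/
structure History (P : Type u) (V : Type v) where
  ops : Finset (Operation P V)
  id_inj : ∀ o ∈ ops, ∀ o' ∈ ops, o.id = o'.id → o = o'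
  wellFormed : ∀ o ∈ ops, ∀ o' ∈ ops, o ≠ o' → o.proc = o'.proc →
    o.res < o'.inv ∨ o'.res < o.inv

/-- The number of operations of a history. -/
def History.size {P : Type u} {V : Type v} (H : History P V) : ℕ := H.ops.card

/-- Unambiguity: every value that occurs is enqueued by exactly one operation and is dequeued by
at most one operation. There is no restriction on the number of `peek` and `empty` operations. -/
def History.Unambiguous {P : Type u} {V : Type v} (H : History P V) : Prop :=
  ∀ x : V, (∃ o ∈ H.ops, o.abs.val = some x) →
    (∃! o, o ∈ H.ops ∧ o.abs = .enq x) ∧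
    (∀ o ∈ H.ops, ∀ o' ∈ H.ops, o.abs = .deq x → o'.abs = .deq x → o = o')

/-! ### The sequential specification and linearizability -/

/-- The transitions of the queue: states are words over `V`, `enq` adds in front, `peek` and `deq`
act at the back, `empty` is possible in the empty state only. -/
inductive Step {V : Type v} : List V → AbsOp V → List V → Prop
  | enq (s : List V) (x : V) : Step s (.enq x) (x :: s)
  | peek (s : List V) (x : V) : Step (s ++ [x]) (.peek x) (s ++ [x])
  | deq (s : List V) (x : V) : Step (s ++ [x]) (.deq x) s
  | empty : Step [] .empty []

/-- `Run s τ s'`: there is a sequence of transitions from `s` to `s'` labelled by `τ`. -/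
inductive Run {V : Type v} : List V → List (AbsOp V) → List V → Prop
  | nil (s : List V) : Run s [] s
  | cons {s s' s'' : List V} {a : AbsOp V} {τ : List (AbsOp V)} :
      Step s a s' → Run s' τ s'' → Run s (a :: τ) s''

/-- The sequential specification of the queue: the labellings of the runs from the empty queue. -/
def queueSpec (V : Type v) : Set (List (AbsOp V)) := {τ | ∃ s, Run [] τ s}

/-- A linearization: distinct nonnegative rational timestamps, strictly inside the intervals. -/
structure IsLinearization {P : Type u} {V : Type v} (H : History P V) (l : H.ops → NNRat) :
    Prop where
  injective : Function.Injective l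
  inv_lt : ∀ o : H.ops, o.1.inv < l o
  lt_res : ∀ o : H.ops, l o < o.1.res

/-- `τ` is the abstract sequential history induced by the timestamps `l`: the abstract operations
of all operations of `H`, listed by increasing timestamp. -/
def Induces {P : Type u} {V : Type v} (H : History P V) (l : H.ops → NNRat)
    (τ : List (AbsOp V)) : Prop :=
  ∃ L : List H.ops, (∀ o, o ∈ L) ∧ L.Pairwise (fun o o' => l o < l o') ∧
    τ = L.map (fun o => o.1.abs)

/-- A history is linearizable if it has a linearization whose induced abstract sequential history
belongs to the sequential specification of the queue. -/
def History.Linearizable {P : Type u} {V : Type v} (H : History P V) : Prop :=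
  ∃ l : H.ops → NNRat, IsLinearization H l ∧ ∃ τ, Induces H l τ ∧ τ ∈ queueSpec V

/-! ### A random access machine with unit costs

A program works on registers and arrays of natural numbers (all initially `0`), with addition and
truncated subtraction. The input is an array of `n` operations. The program can read `n`, test the
method of the operation at a given index, and compare the times, or the values, of the operations
at two given indices; it has no other access to the input. -/

/-- The two endpoints of the time interval of an operation. -/
inductive Endpoint where
  | inv
  | res

/-- The invocation or the response time of an operation. -/
def Operation.time {P : Type u} {V : Type v} (o : Operation P V) : Endpoint → NNRat
  | .inv => o.inv
  | .res => o.res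

/-- Expressions: literals, the size of the input, registers, array cells, sums, differences. -/
inductive Expr where
  | const (k : ℕ)
  | numOps
  | reg (r : ℕ)
  | cell (a : ℕ) (i : Expr)
  | add (e f : Expr)
  | sub (e f : Expr)

/-- Tests: comparison of numbers, of times of two operations, and of values of two operations;
the method of an operation; negation and conjunction. -/
inductive Test where
  | lt (e f : Expr)
  | timeLt (p : Endpoint) (e : Expr) (q : Endpoint) (f : Expr)
  | valLt (e f : Expr)
  | hasMethod (m : Method) (e : Expr)
  | neg (b : Test)
  | conj (b c : Test)

/-- Programs. -/
inductive Prog where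
  | skip
  | setReg (r : ℕ) (e : Expr)
  | setCell (a : ℕ) (i e : Expr)
  | seq (c d : Prog)
  | ite (b : Test) (c d : Prog)
  | loop (b : Test) (c : Prog)

/-- The memory: the registers, and the cells of the arrays. -/
structure Store where
  reg : ℕ → ℕ
  cell : ℕ → ℕ → ℕ

/-- The initial memory. -/
def Store.init : Store := ⟨fun _ => 0, fun _ _ => 0⟩

/-- Assignment to a register. -/
def Store.setReg (σ : Store) (r k : ℕ) : Store :=
  ⟨Function.update σ.reg r k, σ.cell⟩

/-- Assignment to the cell `i` of the array `a`. -/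
def Store.setCell (σ : Store) (a i k : ℕ) : Store :=
  ⟨σ.reg, Function.update σ.cell a (Function.update (σ.cell a) i k)⟩

/-- The value of an expression on an input of size `n`. -/
def Expr.eval (n : ℕ) (σ : Store) : Expr → ℕ
  | .const k => k
  | .numOps => n
  | .reg r => σ.reg r
  | .cell a i => σ.cell a (i.eval n σ)
  | .add e f => e.eval n σ + f.eval n σ
  | .sub e f => e.eval n σ - f.eval n σ

/-- The time to evaluate an expression: one unit for each node. -/
def Expr.cost : Expr → ℕ
  | .const _ => 1
  | .numOps => 1
  | .reg _ => 1
  | .cell _ i => i.cost + 1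
  | .add e f => e.cost + f.cost + 1
  | .sub e f => e.cost + f.cost + 1

/-- The truth of a test. Tests of operations at an index outside of the input, and comparisons of
values that involve an operation without a value, are false. -/
def Test.Holds {P : Type u} {V : Type v} [LinearOrder V] {n : ℕ} (x : Fin n → Operation P V)
    (σ : Store) : Test → Prop
  | .lt e f => e.eval n σ < f.eval n σ
  | .timeLt p e q f => ∃ i j : Fin n, (i : ℕ) = e.eval n σ ∧ (j : ℕ) = f.eval n σ ∧
      (x i).time p < (x j).time q
  | .valLt e f => ∃ i j : Fin n, (i : ℕ) = e.eval n σ ∧ (j : ℕ) = f.eval n σ ∧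
      ∃ y z : V, (x i).abs.val = some y ∧ (x j).abs.val = some z ∧ y < z
  | .hasMethod m e => ∃ i : Fin n, (i : ℕ) = e.eval n σ ∧ (x i).abs.method = m
  | .neg b => ¬ b.Holds x σ
  | .conj b c => b.Holds x σ ∧ c.Holds x σ

/-- The time to evaluate a test: one unit for each node. -/
def Test.cost : Test → ℕ
  | .lt e f => e.cost + f.cost + 1
  | .timeLt _ e _ f => e.cost + f.cost + 1
  | .valLt e f => e.cost + f.cost + 1
  | .hasMethod _ e => e.cost + 1
  | .neg b => b.cost + 1
  | .conj b c => b.cost + c.cost + 1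

/-- `Exec x c σ σ' t`: on the input `x`, the program `c` started in the memory `σ` terminates in
the memory `σ'` after exactly `t` units of time. -/
inductive Exec {P : Type u} {V : Type v} [LinearOrder V] {n : ℕ} (x : Fin n → Operation P V) :
    Prog → Store → Store → ℕ → Prop
  | skip (σ : Store) : Exec x .skip σ σ 1
  | setReg (r : ℕ) (e : Expr) (σ : Store) :
      Exec x (.setReg r e) σ (σ.setReg r (e.eval n σ)) (e.cost + 1)
  | setCell (a : ℕ) (i e : Expr) (σ : Store) :
      Exec x (.setCell a i e) σ (σ.setCell a (i.eval n σ) (e.eval n σ)) (i.cost + e.cost + 1)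
  | seq {c d : Prog} {σ₁ σ₂ σ₃ : Store} {s t : ℕ} :
      Exec x c σ₁ σ₂ s → Exec x d σ₂ σ₃ t → Exec x (.seq c d) σ₁ σ₃ (s + t)
  | iteTrue {b : Test} {c d : Prog} {σ₁ σ₂ : Store} {t : ℕ} :
      b.Holds x σ₁ → Exec x c σ₁ σ₂ t → Exec x (.ite b c d) σ₁ σ₂ (b.cost + t + 1)
  | iteFalse {b : Test} {c d : Prog} {σ₁ σ₂ : Store} {t : ℕ} :
      ¬ b.Holds x σ₁ → Exec x d σ₁ σ₂ t → Exec x (.ite b c d) σ₁ σ₂ (b.cost + t + 1)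
  | loopTrue {b : Test} {c : Prog} {σ₁ σ₂ σ₃ : Store} {s t : ℕ} :
      b.Holds x σ₁ → Exec x c σ₁ σ₂ s → Exec x (.loop b c) σ₂ σ₃ t →
      Exec x (.loop b c) σ₁ σ₃ (b.cost + s + t + 1)
  | loopFalse {b : Test} {c : Prog} {σ : Store} :
      ¬ b.Holds x σ → Exec x (.loop b c) σ σ (b.cost + 1)

/-- Execution is deterministic, in its result and in its running time. -/
theorem Exec.deterministic {P : Type u} {V : Type v} [LinearOrder V] {n : ℕ}
    {x : Fin n → Operation P V} {c : Prog} {σ σ₁ σ₂ : Store} {t₁ t₂ : ℕ}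
    (h₁ : Exec x c σ σ₁ t₁) (h₂ : Exec x c σ σ₂ t₂) : σ₁ = σ₂ ∧ t₁ = t₂ := by
  induction h₁ generalizing σ₂ t₂ with
  | skip | setReg | setCell => cases h₂; exact ⟨rfl, rfl⟩
  | seq _ _ ih ih' =>
    cases h₂ with
    | seq k k' =>
      obtain ⟨rfl, rfl⟩ := ih k
      obtain ⟨rfl, rfl⟩ := ih' k'
      exact ⟨rfl, rfl⟩
  | iteTrue hb _ ih =>
    cases h₂ with
    | iteTrue _ k => obtain ⟨rfl, rfl⟩ := ih k; exact ⟨rfl, rfl⟩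
    | iteFalse hb' _ => exact absurd hb hb'
  | iteFalse hb _ ih =>
    cases h₂ with
    | iteTrue hb' _ => exact absurd hb' hb
    | iteFalse _ k => obtain ⟨rfl, rfl⟩ := ih k; exact ⟨rfl, rfl⟩
  | loopTrue hb _ _ ih ih' =>
    cases h₂ with
    | loopTrue _ k k' =>
      obtain ⟨rfl, rfl⟩ := ih k
      obtain ⟨rfl, rfl⟩ := ih' k'
      exact ⟨rfl, rfl⟩
    | loopFalse hb' => exact absurd hb hb'
  | loopFalse hb =>
    cases h₂ with
    | loopTrue hb' _ _ => exact absurd hb' hb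
    | loopFalse _ => exact ⟨rfl, rfl⟩

/-- On the input `x` and within time `T`, the program `c` terminates with the answer to the
question `Q` in the register `0`: the answer is `1` if `Q` is true, and `0` if `Q` is false. -/
def AnswersWithin {P : Type u} {V : Type v} [LinearOrder V] {n : ℕ} (c : Prog)
    (x : Fin n → Operation P V) (T : ℕ) (Q : Prop) : Prop :=
  ∃ (σ : Store) (t : ℕ), Exec x c Store.init σ t ∧ t ≤ T ∧
    (Q → σ.reg 0 = 1) ∧ (¬ Q → σ.reg 0 = 0)

end QueueMonitoring

/-! For a value v let a(v) be the invocation of its enq, b(v) the first response of an operation of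
v, c(v) the first response of a deq or peek of v (infinite if there is none), and d(v) the last
invocation of an operation of v (infinite if v is never dequeued). Two situations force v to be
enqueued before w: b(v) < a(w), and c(v) < d(w). In the second, if w were enqueued first, its deq
would precede every deq and peek of v, although an operation of w is invoked after one of these has
responded. An operation empty needs a cut inside its interval such that every value with b before
the cut also has d before it.

`Criterion` forbids only the shortest contradictions: two opposite c-d precedences, and a b-a
precedence closed up by one or two c-d precedences; further, an enq invoked after a response of its
value, a peek invoked after the response of the deq, and an empty without a cut. `Summary.criterion`
is necessity. The heart of sufficiency is `Criterion.exists_first`: without these short cycles,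
every nonempty set of values has a member that no other member is forced to precede, so longer
cycles cannot occur. `Summary.exists_order` makes the resulting order of values compatible with the
cuts, and `Summary.exists_fifoOrder` schedules every operation as early as that order permits; the
criterion keeps each one inside its interval.

Legality is expressed by `FifoOrder`, conditions on an order of the operations. Since values are
enqueued once and dequeued at most once, these hold exactly for legal behaviours
(`History.Unambiguous.fifoOrder`, `FifoOrder.mem_queueSpec`), and `exists_timestamps` turns an order
back into rational timestamps.

The program sorts the 2n endpoints and the n values by merge sort (`RunsTo.sort`); this is the only
superlinear part. Afterwards times are positions and values are group numbers. Everything else is a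
maximum over the operations sent to a common index, or a prefix maximum of such an array, each
obtained in one linear loop (`RunsTo.scatterLoop`, `RunsTo.prefixLoop`). Minima are maxima of 2n
minus the position. A condition on pairs or triples of values becomes, for each single value, a
lookup in a prefix maximum (`IsIndexing.criterion_iff`). -/

namespace QueueMonitoring

/-! ### Running times of programs -/

/-- A bound for the running time of a program without nested loops, per iteration of its loops. -/
def Prog.weight : Prog → ℕ
  | .skip => 1
  | .setReg _ e => e.cost + 1
  | .setCell _ i e => i.cost + e.cost + 1
  | .seq c d => c.weight + d.weight
  | .ite b c d => b.cost + c.weight + d.weight + 1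
  | .loop b c => 4 * (b.cost + c.weight + 1)

/-- Execution within a given time. -/
def RunsTo {P : Type u} {V : Type v} [LinearOrder V] {n : ℕ} (x : Fin n → Operation P V)
    (c : Prog) (σ σ' : Store) (T : ℕ) : Prop :=
  ∃ t ≤ T, Exec x c σ σ' t

section Execution

variable {P : Type u} {V : Type v} [LinearOrder V] {n : ℕ} {x : Fin n → Operation P V}

theorem RunsTo.mono {c : Prog} {σ σ' : Store} {S T : ℕ} (h : RunsTo x c σ σ' S) (hST : S ≤ T) :
    RunsTo x c σ σ' T := by
  obtain ⟨t, ht, e⟩ := h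
  exact ⟨t, ht.trans hST, e⟩

theorem RunsTo.seq {c d : Prog} {σ₁ σ₂ σ₃ : Store} {S T : ℕ} (h : RunsTo x c σ₁ σ₂ S)
    (h' : RunsTo x d σ₂ σ₃ T) : RunsTo x (.seq c d) σ₁ σ₃ (S + T) := by
  obtain ⟨s, hs, e⟩ := h
  obtain ⟨t, ht, e'⟩ := h'
  exact ⟨s + t, by omega, e.seq e'⟩

theorem RunsTo.seq_weight {c d : Prog} {σ₁ σ₂ σ₃ : Store} {B : ℕ}
    (h : RunsTo x c σ₁ σ₂ (c.weight * B)) (h' : RunsTo x d σ₂ σ₃ (d.weight * B)) :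
    RunsTo x (.seq c d) σ₁ σ₃ ((Prog.seq c d).weight * B) :=
  (h.seq h').mono (by simp only [Prog.weight, add_mul]; rfl)

theorem RunsTo.scale {c : Prog} {σ σ' : Store} (h : RunsTo x c σ σ' c.weight) {B : ℕ}
    (hB : 0 < B) : RunsTo x c σ σ' (c.weight * B) :=
  h.mono (Nat.le_mul_of_pos_right _ hB)

theorem RunsTo.skip (σ : Store) : RunsTo x .skip σ σ 1 := ⟨1, le_rfl, .skip σ⟩

theorem RunsTo.setReg {r : ℕ} {e : Expr} {σ : Store} {k : ℕ} (h : e.eval n σ = k) :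
    RunsTo x (.setReg r e) σ (σ.setReg r k) (e.cost + 1) :=
  ⟨_, le_rfl, h ▸ .setReg r e σ⟩

theorem RunsTo.setCell {a : ℕ} {i e : Expr} {σ : Store} {j k : ℕ} (hi : i.eval n σ = j)
    (h : e.eval n σ = k) :
    RunsTo x (.setCell a i e) σ (σ.setCell a j k) (i.cost + e.cost + 1) :=
  ⟨_, le_rfl, h ▸ hi ▸ .setCell a i e σ⟩

theorem RunsTo.iteTrue {b : Test} {c d : Prog} {σ σ' : Store} (hb : b.Holds x σ)
    (h : RunsTo x c σ σ' c.weight) :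
    RunsTo x (.ite b c d) σ σ' (Prog.ite b c d).weight := by
  obtain ⟨t, ht, e⟩ := h
  exact ⟨_, by simp only [Prog.weight]; omega, .iteTrue hb e⟩

theorem RunsTo.iteFalse {b : Test} {c d : Prog} {σ σ' : Store} (hb : ¬ b.Holds x σ)
    (h : RunsTo x d σ σ' d.weight) :
    RunsTo x (.ite b c d) σ σ' (Prog.ite b c d).weight := by
  obtain ⟨t, ht, e⟩ := h
  exact ⟨_, by simp only [Prog.weight]; omega, .iteFalse hb e⟩

/-- A loop whose number of remaining iterations is tracked by an invariant. -/
theorem RunsTo.loop {b : Test} {c : Prog} {τ : ℕ} (Inv : ℕ → Store → Prop)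
    (halt : ∀ σ, Inv 0 σ → ¬ b.Holds x σ)
    (step : ∀ m σ, Inv (m + 1) σ → b.Holds x σ ∧ ∃ σ', RunsTo x c σ σ' τ ∧ Inv m σ') :
    ∀ m σ, Inv m σ →
      ∃ σ', RunsTo x (.loop b c) σ σ' ((m + 1) * (b.cost + τ + 1)) ∧ Inv 0 σ' := by
  intro m
  induction m with
  | zero => exact fun σ h => ⟨σ, ⟨_, by omega, .loopFalse (halt σ h)⟩, h⟩
  | succ m ih =>
    intro σ h
    obtain ⟨hb, σ₁, ⟨s, hs, e⟩, h₁⟩ := step m σ h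
    obtain ⟨σ₂, ⟨t, ht, e'⟩, h₂⟩ := ih σ₁ h₁
    refine ⟨σ₂, ⟨_, ?_, .loopTrue hb e e'⟩, h₂⟩
    rw [add_mul (m + 1)]
    omega

/-- The loop over all values of the register `1` below `N`. -/
def countLoop (N : Expr) (c : Prog) : Prog :=
  .seq (.setReg 1 (.const 0))
    (.loop (.lt (.reg 1) N) (.seq c (.setReg 1 (.add (.reg 1) (.const 1)))))

/-- The bound on `K` covers loops over operations, over endpoints, and over the 2n + 1 cells that
are indexed by a position or by infinity. -/
theorem RunsTo.countLoop {N : Expr} {c : Prog} {K : ℕ} (hK : K ≤ 2 * n + 2)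
    (Inv : ℕ → Store → Prop) {σ : Store}
    (size : ∀ k σ, Inv k σ → N.eval n σ = K)
    (counter : ∀ k σ, Inv k σ → σ.reg 1 = k)
    (start : Inv 0 (σ.setReg 1 0))
    (step : ∀ k < K, ∀ σ, Inv k σ →
      ∃ σ', RunsTo x c σ σ' c.weight ∧ σ'.reg 1 = k ∧ Inv (k + 1) (σ'.setReg 1 (k + 1))) :
    ∃ σ', RunsTo x (countLoop N c) σ σ' ((QueueMonitoring.countLoop N c).weight * (n + 1)) ∧
      Inv K σ' := by
  obtain ⟨σ', h, h'⟩ := RunsTo.loop (x := x) (b := .lt (.reg 1) N)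
    (c := .seq c (.setReg 1 (.add (.reg 1) (.const 1)))) (τ := c.weight + 4)
    -- The loop rule counts the iterations left, the invariant counts those done.
    (fun m σ => m ≤ K ∧ Inv (K - m) σ)
    (by
      rintro σ ⟨-, h⟩
      simp only [Test.Holds, Expr.eval, size _ _ h, counter _ _ h]
      omega)
    (by
      rintro m σ ⟨hm, h⟩
      refine ⟨?_, ?_⟩
      · simp only [Test.Holds, Expr.eval, size _ _ h, counter _ _ h]
        omega
      · obtain ⟨σ', e, hr, h'⟩ := step _ (by omega) σ h
        refine ⟨_, e.seq (RunsTo.setReg (k := K - m) ?_), by omega, ?_⟩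
        · simp only [Expr.eval, hr]
          omega
        · convert h' using 2 <;> omega)
    K (σ.setReg 1 0) ⟨le_rfl, by simpa using start⟩
  refine ⟨σ', (RunsTo.seq (RunsTo.setReg rfl) h).mono ?_, by simpa using h'.2⟩
  simp only [QueueMonitoring.countLoop, Prog.weight, Expr.cost]
  generalize (Test.lt (.reg 1) N).cost = s
  generalize c.weight = w
  -- The test is evaluated at most 2n + 3 ≤ 4(n + 1) times, whence the factor 4 in the weight of a
  -- loop.
  calc _ ≤ 1 + 1 + (2 * n + 3) * (s + (w + 4) + 1) := by
        exact Nat.add_le_add_left (Nat.mul_le_mul_right _ (by omega)) _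
    _ ≤ _ := by nlinarith

/-- A loop that only changes its counter and one array. -/
theorem RunsTo.fill {N : Expr} {c : Prog} {K : ℕ} (hK : K ≤ 2 * n + 2) {σ : Store} {A : ℕ}
    (F : ℕ → ℕ → ℕ) (h0 : F 0 = σ.cell A)
    (size : ∀ k f, N.eval n ⟨Function.update σ.reg 1 k, Function.update σ.cell A f⟩ = K)
    (step : ∀ k < K, RunsTo x c
      ⟨Function.update σ.reg 1 k, Function.update σ.cell A (F k)⟩
      ⟨Function.update σ.reg 1 k, Function.update σ.cell A (F (k + 1))⟩ c.weight) :
    RunsTo x (QueueMonitoring.countLoop N c) σ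
      ⟨Function.update σ.reg 1 K, Function.update σ.cell A (F K)⟩
      ((QueueMonitoring.countLoop N c).weight * (n + 1)) := by
  obtain ⟨σ', h, rfl⟩ := RunsTo.countLoop (x := x) (N := N) (c := c) hK (σ := σ)
    (fun k τ => τ = ⟨Function.update σ.reg 1 k, Function.update σ.cell A (F k)⟩)
    (by rintro k _ rfl; exact size _ _) (by rintro k _ rfl; simp)
    (by simp [Store.setReg, h0])
    (by
      rintro k hk _ rfl
      exact ⟨_, step k hk, by simp, by simp [Store.setReg]⟩)
  exact h

/-! ### Loops that compute maxima -/

open Classical in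
/-- The maximum of the values `w k` of the keys `k < N` that satisfy `G` and are sent to `j`. -/
noncomputable def scatterMax (N : ℕ) (G : ℕ → Prop) (ix w : ℕ → ℕ) (j : ℕ) : ℕ :=
  ((Finset.range N).filter fun k => G k ∧ ix k = j).sup w

theorem lt_scatterMax {N : ℕ} {G : ℕ → Prop} {ix w : ℕ → ℕ} {j m : ℕ} :
    m < scatterMax N G ix w j ↔ ∃ k < N, G k ∧ ix k = j ∧ m < w k := by
  simp [scatterMax, Finset.lt_sup_iff, and_assoc]

theorem scatterMax_le {N : ℕ} {G : ℕ → Prop} {ix w : ℕ → ℕ} {j m : ℕ}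
    (h : ∀ k < N, G k → ix k = j → w k ≤ m) : scatterMax N G ix w j ≤ m := by
  by_contra! hm
  obtain ⟨k, hk, hG, hi, hw⟩ := lt_scatterMax.1 hm
  exact absurd (h k hk hG hi) (by omega)

theorem le_scatterMax {N : ℕ} {G : ℕ → Prop} {ix w : ℕ → ℕ} {k : ℕ} (hk : k < N) (hG : G k) :
    w k ≤ scatterMax N G ix w (ix k) := by
  by_contra! hm
  exact lt_irrefl _ (lt_scatterMax.2 ⟨k, hk, hG, rfl, hm⟩)

/-- The maximum of the first `q` values of `f`, for `q ≤ N`. -/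
def prefixMax (N : ℕ) (f : ℕ → ℕ) (q : ℕ) : ℕ :=
  if q ≤ N then (Finset.range q).sup f else 0

theorem lt_prefixMax {N : ℕ} {f : ℕ → ℕ} {q m : ℕ} (hq : q ≤ N) :
    m < prefixMax N f q ↔ ∃ j < q, m < f j := by
  simp [prefixMax, hq, Finset.lt_sup_iff]

/-- The maximum of two expressions. -/
def Expr.max (e f : Expr) : Expr := .add e (.sub f e)

theorem Expr.eval_max {σ : Store} {e f : Expr} :
    (Expr.max e f).eval n σ = Max.max (e.eval n σ) (f.eval n σ) := by
  simp only [Expr.max, Expr.eval]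
  omega

/-- For all `k < N` that pass the test `G`, the cell `ix` of the array `A` is raised to `w`. -/
def scatterLoop (A : ℕ) (N : Expr) (G : Test) (ix w : Expr) : Prog :=
  countLoop N (.ite G (.setCell A ix (.max (.cell A ix) w)) .skip)

/-- This is the effect of one iteration. The previous contents `f` are kept, so that a second loop
may raise the same array further. -/
theorem scatterMax_succ {N : ℕ} {G : ℕ → Prop} {ix w : ℕ → ℕ} (f : ℕ → ℕ) (hG : G N) :
    f ⊔ scatterMax (N + 1) G ix w =
      Function.update (f ⊔ scatterMax N G ix w) (ix N)
        (max ((f ⊔ scatterMax N G ix w) (ix N)) (w N)) := by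
  classical
  ext j
  rcases eq_or_ne j (ix N) with rfl | hj
  · simp only [Pi.sup_apply, Function.update_self, scatterMax, Finset.range_add_one,
      Finset.filter_insert, hG, true_and, if_true, Finset.sup_insert]
    simp only [max_assoc]
    congr 1
    exact max_comm _ _
  · simp [scatterMax, Finset.range_add_one, Finset.filter_insert, hG, hj, hj.symm]

theorem scatterMax_succ_of_not {N : ℕ} {G : ℕ → Prop} {ix w : ℕ → ℕ} (hG : ¬ G N) :
    scatterMax (N + 1) G ix w = scatterMax N G ix w := by
  classical
  ext j
  simp [scatterMax, Finset.range_add_one, Finset.filter_insert, hG]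

theorem RunsTo.scatterLoop {A K : ℕ} {N ix w : Expr} {G : Test} {G' : ℕ → Prop}
    {ix' w' : ℕ → ℕ} {σ : Store} (hK : K ≤ 2 * n + 2)
    (hN : ∀ k f, N.eval n ⟨Function.update σ.reg 1 k, Function.update σ.cell A f⟩ = K)
    (hG : ∀ k < K, ∀ f,
      G.Holds x ⟨Function.update σ.reg 1 k, Function.update σ.cell A f⟩ ↔ G' k)
    (hix : ∀ k < K, G' k → ∀ f,
      ix.eval n ⟨Function.update σ.reg 1 k, Function.update σ.cell A f⟩ = ix' k)
    (hw : ∀ k < K, G' k → ∀ f,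
      w.eval n ⟨Function.update σ.reg 1 k, Function.update σ.cell A f⟩ = w' k) :
    RunsTo x (QueueMonitoring.scatterLoop A N G ix w) σ
      ⟨Function.update σ.reg 1 K, Function.update σ.cell A (σ.cell A ⊔ scatterMax K G' ix' w')⟩
      ((QueueMonitoring.scatterLoop A N G ix w).weight * (n + 1)) := by
  refine RunsTo.fill hK (fun k => σ.cell A ⊔ scatterMax k G' ix' w') ?_ hN ?_
  · ext j
    simp [scatterMax]
  · intro k hk
    by_cases h : G' k
    · refine .iteTrue ((hG k hk _).2 h) ?_
      convert RunsTo.setCell (x := x) (hix k hk h _) rfl using 1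
      · rw [Expr.eval_max, hw k hk h]
        simp only [Expr.eval, hix k hk h, scatterMax_succ _ h]
        simp only [Store.setCell, Function.update_self, Function.update_idem]
      · rfl
    · simp only [scatterMax_succ_of_not h]
      exact .iteFalse (by rwa [hG k hk]) (.skip _)

/-- The maxima of the initial segments of the array `B` are written to the array `A`. -/
def prefixLoop (A B : ℕ) (N : Expr) : Prog :=
  countLoop N (.setCell A (.add (.reg 1) (.const 1)) (.max (.cell A (.reg 1)) (.cell B (.reg 1))))

/-- Only the cells 1, ..., K of the zero array `A` are written; this is why `prefixMax` vanishes
beyond its bound. -/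
theorem RunsTo.prefixLoop {A B K : ℕ} {N : Expr} {σ : Store} (hK : K ≤ 2 * n + 2) (hAB : B ≠ A)
    (hN : ∀ k f, N.eval n ⟨Function.update σ.reg 1 k, Function.update σ.cell A f⟩ = K)
    (h0 : σ.cell A = 0) :
    RunsTo x (QueueMonitoring.prefixLoop A B N) σ
      ⟨Function.update σ.reg 1 K, Function.update σ.cell A (prefixMax K (σ.cell B))⟩
      ((QueueMonitoring.prefixLoop A B N).weight * (n + 1)) := by
  refine RunsTo.fill hK (fun k => prefixMax k (σ.cell B)) ?_ hN ?_
  · ext j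
    simp +contextual [prefixMax, h0]
  · intro k hk
    have := RunsTo.setCell (x := x) (a := A) (i := .add (.reg 1) (.const 1))
      (e := .max (.cell A (.reg 1)) (.cell B (.reg 1)))
      (σ := ⟨Function.update σ.reg 1 k, Function.update σ.cell A (prefixMax k (σ.cell B))⟩)
      rfl rfl
    convert this using 1
    · simp only [Store.setCell, Expr.eval_max, Expr.eval, Function.update_self,
        Function.update_idem, Function.update_of_ne hAB]
      congr 2
      ext j
      rcases eq_or_ne j (k + 1) with rfl | hj
      · simp [prefixMax, Finset.range_add_one, max_comm]
      · simp only [prefixMax, Function.update_of_ne hj]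
        congr 1
        simp only [eq_iff_iff]
        omega
    · rfl

/-! ### Memory as a list of arrays -/

/-- The array `B` of a program; the array `0` of the machine is reserved for sorting. -/
def Expr.arr (B : ℕ) (e : Expr) : Expr := .cell (B + 1) e

/-- The contents of the array `B`. -/
def Store.arr (σ : Store) (B : ℕ) : ℕ → ℕ := σ.cell (B + 1)

@[simp]
theorem Expr.eval_arr {σ : Store} {B : ℕ} {e : Expr} :
    (Expr.arr B e).eval n σ = σ.arr B (e.eval n σ) := rfl

/-- The arrays are given by the list `l`, and further arrays are zero. -/
def Store.Stores (σ : Store) (l : List (ℕ → ℕ)) : Prop := ∀ B, σ.arr B = l.getD B 0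

/-- The initial arrays are given by the list `l`, and the value of the counter is `k`. -/
def Store.Shows (σ : Store) (l : List (ℕ → ℕ)) (k : ℕ) : Prop :=
  σ.reg 1 = k ∧ ∀ B < l.length, σ.arr B = l.getD B 0

/-- While the array behind `l` is being filled, its contents vary; the test, index and weight of the
loop body are evaluated from `l` and the counter alone. -/
theorem Store.Stores.shows {σ : Store} {l l' : List (ℕ → ℕ)} (h : σ.Stores (l ++ l')) (k : ℕ)
    (f : ℕ → ℕ) :
    Store.Shows ⟨Function.update σ.reg 1 k, Function.update σ.cell (l.length + 1) f⟩ l k := by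
  refine ⟨by simp, fun B hB => ?_⟩
  have := h B
  rw [List.getD_append _ _ _ _ hB] at this
  rw [← this]
  exact Function.update_of_ne (by omega) _ _

theorem Store.Stores.append {σ : Store} {l : List (ℕ → ℕ)} {f : ℕ → ℕ}
    (h : σ.Stores (l ++ [f])) (r : ℕ → ℕ) (g : ℕ → ℕ) :
    Store.Stores ⟨r, Function.update σ.cell (l.length + 1) g⟩ (l ++ [g]) := by
  intro B
  have := h B
  rcases lt_trichotomy B l.length with hB | rfl | hB
  · rw [List.getD_append _ _ _ _ hB] at this ⊢
    rw [← this]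
    exact Function.update_of_ne (by omega) _ _
  · simp [Store.arr]
  · rw [List.getD_eq_default _ _ (by simp; omega)] at this ⊢
    rw [← this]
    exact Function.update_of_ne (by omega) _ _

/-- Unused arrays are zero, the neutral element for maxima, so the next one is ready as a target. -/
theorem Store.Stores.append_zero {σ : Store} {l : List (ℕ → ℕ)} (h : σ.Stores l) :
    σ.Stores (l ++ [0]) := by
  intro B
  rw [h B]
  rcases lt_trichotomy B l.length with hB | rfl | hB
  · rw [List.getD_append _ _ _ _ hB]
  · simp
  · rw [List.getD_eq_default _ _ hB.le, List.getD_eq_default _ _ (by simp; omega)]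

/-- The program `c` transforms the arrays `l` into the arrays `l'`, within linear time. -/
def Transforms (x : Fin n → Operation P V) (c : Prog) (l l' : List (ℕ → ℕ)) : Prop :=
  ∀ σ : Store, σ.Stores l → ∃ σ', RunsTo x c σ σ' (c.weight * (n + 1)) ∧ σ'.Stores l'

theorem Transforms.seq {c d : Prog} {l₁ l₂ l₃ : List (ℕ → ℕ)} (h : Transforms x c l₁ l₂)
    (h' : Transforms x d l₂ l₃) : Transforms x (.seq c d) l₁ l₃ := by
  intro σ hσ
  obtain ⟨σ₁, e, hσ₁⟩ := h σ hσ
  obtain ⟨σ₂, e', hσ₂⟩ := h' σ₁ hσ₁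
  exact ⟨σ₂, e.seq_weight e', hσ₂⟩

theorem Transforms.scatter_append {A K : ℕ} {N ix w : Expr} {G : Test} {G' : ℕ → Prop}
    {ix' w' : ℕ → ℕ} {l : List (ℕ → ℕ)} {f : ℕ → ℕ} (hA : A = l.length + 1)
    (hK : K ≤ 2 * n + 2)
    (hN : ∀ σ : Store, N.eval n σ = K)
    (hG : ∀ k < K, ∀ σ : Store, σ.Shows l k → (G.Holds x σ ↔ G' k))
    (hix : ∀ k < K, G' k → ∀ σ : Store, σ.Shows l k → ix.eval n σ = ix' k)
    (hw : ∀ k < K, G' k → ∀ σ : Store, σ.Shows l k → w.eval n σ = w' k) :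
    Transforms x (scatterLoop A N G ix w) (l ++ [f]) (l ++ [f ⊔ scatterMax K G' ix' w']) := by
  subst hA
  intro σ hσ
  refine ⟨_, RunsTo.scatterLoop hK (fun _ _ => hN _)
    (fun k hk f => hG k hk _ (hσ.shows k f))
    (fun k hk h f => hix k hk h _ (hσ.shows k f))
    (fun k hk h f => hw k hk h _ (hσ.shows k f)), ?_⟩
  have : σ.cell (l.length + 1) = f := by
    refine (hσ l.length).trans ?_
    simp
  rw [this]
  exact hσ.append _ _

theorem Transforms.scatter {A K : ℕ} {N ix w : Expr} {G : Test} {G' : ℕ → Prop}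
    {ix' w' : ℕ → ℕ} {l : List (ℕ → ℕ)} (hA : A = l.length + 1)
    (hK : K ≤ 2 * n + 2)
    (hN : ∀ σ : Store, N.eval n σ = K)
    (hG : ∀ k < K, ∀ σ : Store, σ.Shows l k → (G.Holds x σ ↔ G' k))
    (hix : ∀ k < K, G' k → ∀ σ : Store, σ.Shows l k → ix.eval n σ = ix' k)
    (hw : ∀ k < K, G' k → ∀ σ : Store, σ.Shows l k → w.eval n σ = w' k) :
    Transforms x (scatterLoop A N G ix w) l (l ++ [scatterMax K G' ix' w']) := by
  intro σ hσ
  obtain ⟨σ', e, h⟩ := Transforms.scatter_append (f := 0) hA hK hN hG hix hw σ hσ.append_zero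
  refine ⟨σ', e, ?_⟩
  convert h using 3
  ext j
  simp

theorem Transforms.prefix {A B K : ℕ} {N : Expr} {l : List (ℕ → ℕ)} {f : ℕ → ℕ}
    (hA : A = l.length + 1) (hB : B ≤ l.length) (hf : B ≠ 0) (hl : l.getD (B - 1) 0 = f)
    (hK : K ≤ 2 * n + 2) (hN : ∀ σ : Store, N.eval n σ = K) :
    Transforms x (prefixLoop A B N) l (l ++ [prefixMax K f]) := by
  subst hA hl
  intro σ hσ
  obtain ⟨B, rfl⟩ : ∃ C, B = C + 1 := ⟨B - 1, by omega⟩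
  have h0 : σ.cell (l.length + 1) = 0 := (hσ l.length).trans (by simp)
  refine ⟨_, RunsTo.prefixLoop hK (by omega) (fun _ _ => hN _) h0, ?_⟩
  have : σ.cell (B + 1) = l.getD B 0 := hσ B
  rw [this]
  exact hσ.append_zero.append _ _

end Execution


/-! ### Merging sorted blocks -/

section Merging

variable {α : Type*} [LinearOrder α]

/-- The first `N` values of `f` are the numbers below `N`. -/
def IsListing (N : ℕ) (f : ℕ → ℕ) : Prop :=
  (∀ m < N, f m < N) ∧ ∀ v < N, ∃ m < N, f m = v

/-- The consecutive blocks of length `w` of the first `N` values of `f` are sorted. -/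
def BlockSorted (key : ℕ → α) (N w : ℕ) (f : ℕ → ℕ) : Prop :=
  ∀ q m m', q * w ≤ m → m < m' → m' < (q + 1) * w → m' < N → key (f m) ≤ key (f m')

/-- Two neighbouring sorted blocks of `f`, the first of which starts at `lo`, are being merged into
`g`; the next elements of the blocks are `f i` and `f j`, and the next free place is `k`. -/
structure Merging (key : ℕ → α) (N w : ℕ) (f g : ℕ → ℕ) (k lo i j mid hi : ℕ) : Prop where
  block : ∃ q, lo = q * (2 * w)
  mid_eq : mid = min (lo + w) N
  hi_eq : hi = min (lo + w + w) N
  lo_le : lo ≤ i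
  le_mid : i ≤ mid
  mid_le : mid ≤ j
  le_hi : j ≤ hi
  count : k + mid = i + j
  lt : ∀ m < k, g m < N
  sorted : BlockSorted key k (2 * w) g
  rest : ∀ m, lo ≤ m → m < k → ∀ m', (i ≤ m' ∧ m' < mid ∨ j ≤ m' ∧ m' < hi) →
    key (g m) ≤ key (f m')
  onto : ∀ m, (m < i ∨ mid ≤ m ∧ m < j) → ∃ m' < k, g m' = f m

theorem Merging.start (key : ℕ → α) (N w : ℕ) (f g : ℕ → ℕ) :
    Merging key N w f g 0 0 0 (min w N) (min w N) (min (w + w) N) where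
  block := ⟨0, by simp⟩
  mid_eq := by simp
  hi_eq := by simp
  lo_le := le_rfl
  le_mid := Nat.zero_le _
  mid_le := le_rfl
  le_hi := by omega
  count := rfl
  lt := by simp
  sorted := fun _ _ _ _ _ _ h => by omega
  rest := by simp
  onto := fun m h => by omega

variable {key : ℕ → α} {N w : ℕ} {f g g' : ℕ → ℕ} {k lo i j mid hi : ℕ}

/-- The written element is one of those still waiting, and `rest` bounds everything already written
for the current pair by all of these. -/
theorem Merging.sorted_succ (h : Merging key N w f g k lo i j mid hi) (hk : k < hi)
    (hg : ∀ m < k, g' m = g m) {m₀ : ℕ} (h₀ : i ≤ m₀ ∧ m₀ < mid ∨ j ≤ m₀ ∧ m₀ < hi)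
    (hgk : g' k = f m₀) : BlockSorted key (k + 1) (2 * w) g' := by
  intro q m m' h1 h2 h3 h4
  rcases Nat.lt_succ_iff_lt_or_eq.1 h4 with h5 | rfl
  · rw [hg m (by omega), hg m' h5]
    exact h.sorted q m m' h1 h2 h3 h5
  · rw [hg m h2, hgk]
    refine h.rest m ?_ h2 m₀ h₀
    obtain ⟨q', hq'⟩ := h.block
    have := h.hi_eq
    -- The block of the place k cannot lie before the current pair, as lo ≤ k. Hence an earlier
    -- place of the same block is at least lo, as `rest` requires.
    have hqq : q' ≤ q := by
      by_contra! hlt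
      have : (q + 1) * (2 * w) ≤ q' * (2 * w) := Nat.mul_le_mul_right _ hlt
      have := h.count
      have := h.lo_le
      have := h.mid_le
      omega
    have : q' * (2 * w) ≤ q * (2 * w) := Nat.mul_le_mul_right _ hqq
    omega

theorem Merging.lo_le_k (h : Merging key N w f g k lo i j mid hi) : lo ≤ k ∧ k ≤ hi := by
  have := h.count
  have := h.lo_le
  have := h.mid_le
  have := h.le_mid
  have := h.le_hi
  omega

/-- In units of w, the pair that starts at q(2w) consists of the blocks 2q and 2q + 1. -/
theorem Merging.first_le (h : Merging key N w f g k lo i j mid hi) (hf : BlockSorted key N w f)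
    {m m' : ℕ} (h1 : i ≤ m) (h2 : m ≤ m') (h3 : m' < mid) : key (f m) ≤ key (f m') := by
  rcases h2.eq_or_lt with rfl | h2
  · exact le_rfl
  obtain ⟨q, hq⟩ := h.block
  have hmid := h.mid_eq
  have := h.lo_le
  have e1 : 2 * q * w = q * (2 * w) := by ring
  have e2 : (2 * q + 1) * w = q * (2 * w) + w := by ring
  exact hf (2 * q) m m' (by omega) h2 (by omega) (by omega)

theorem Merging.second_le (h : Merging key N w f g k lo i j mid hi) (hf : BlockSorted key N w f)
    {m m' : ℕ} (h1 : j ≤ m) (h2 : m ≤ m') (h3 : m' < hi) : key (f m) ≤ key (f m') := by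
  rcases h2.eq_or_lt with rfl | h2
  · exact le_rfl
  obtain ⟨q, hq⟩ := h.block
  have hmid := h.mid_eq
  have hhi := h.hi_eq
  have := h.mid_le
  have e1 : (2 * q + 1) * w = q * (2 * w) + w := by ring
  have e2 : (2 * q + 1 + 1) * w = q * (2 * w) + w + w := by ring
  exact hf (2 * q + 1) m m' (by omega) h2 (by omega) (by omega)

/-- The new element is below the rest of its own block by sortedness, and below the rest of the
other block through the head of that block, if there is one. -/
theorem Merging.left (h : Merging key N w f g k lo i j mid hi) (hf : BlockSorted key N w f)
    (hfN : IsListing N f) (hi' : i < mid) (hle : j < hi → key (f i) ≤ key (f j))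
    (hg : ∀ m < k, g' m = g m) (hgk : g' k = f i) :
    Merging key N w f g' (k + 1) lo (i + 1) j mid hi where
  block := h.block
  mid_eq := h.mid_eq
  hi_eq := h.hi_eq
  lo_le := h.lo_le.trans (Nat.le_succ _)
  le_mid := hi'
  mid_le := h.mid_le
  le_hi := h.le_hi
  count := by have := h.count; omega
  lt m hm := by
    rcases Nat.lt_succ_iff_lt_or_eq.1 hm with hm | rfl
    · rw [hg m hm]
      exact h.lt m hm
    · rw [hgk]
      have := h.mid_eq
      exact hfN.1 _ (by omega)
  sorted := by
    have := h.count
    have := h.le_hi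
    exact h.sorted_succ (by omega) hg (Or.inl ⟨le_rfl, hi'⟩) hgk
  rest m h1 h2 m' h3 := by
    rcases Nat.lt_succ_iff_lt_or_eq.1 h2 with h2 | rfl
    · rw [hg m h2]
      exact h.rest m h1 h2 m' (by omega)
    · rw [hgk]
      rcases h3 with h3 | h3
      · exact h.first_le hf le_rfl (by omega) h3.2
      · exact (hle (by omega)).trans (h.second_le hf le_rfl h3.1 h3.2)
  onto m hm := by
    by_cases hmi : m = i
    · exact ⟨k, by omega, hmi ▸ hgk⟩
    · obtain ⟨m', h1, h2⟩ := h.onto m (by omega)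
      exact ⟨m', by omega, by rw [hg m' h1, h2]⟩

theorem Merging.right (h : Merging key N w f g k lo i j mid hi) (hf : BlockSorted key N w f)
    (hfN : IsListing N f) (hj : j < hi) (hle : i < mid → key (f j) ≤ key (f i))
    (hg : ∀ m < k, g' m = g m) (hgk : g' k = f j) :
    Merging key N w f g' (k + 1) lo i (j + 1) mid hi where
  block := h.block
  mid_eq := h.mid_eq
  hi_eq := h.hi_eq
  lo_le := h.lo_le
  le_mid := h.le_mid
  mid_le := h.mid_le.trans (Nat.le_succ _)
  le_hi := hj
  count := by have := h.count; omega
  lt m hm := by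
    rcases Nat.lt_succ_iff_lt_or_eq.1 hm with hm | rfl
    · rw [hg m hm]
      exact h.lt m hm
    · rw [hgk]
      have := h.hi_eq
      exact hfN.1 _ (by omega)
  sorted := by
    have := h.count
    have := h.le_mid
    exact h.sorted_succ (by omega) hg (Or.inr ⟨le_rfl, hj⟩) hgk
  rest m h1 h2 m' h3 := by
    rcases Nat.lt_succ_iff_lt_or_eq.1 h2 with h2 | rfl
    · rw [hg m h2]
      exact h.rest m h1 h2 m' (by omega)
    · rw [hgk]
      rcases h3 with h3 | h3
      · exact (hle (by omega)).trans (h.first_le hf le_rfl h3.1 h3.2)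
      · exact h.second_le hf le_rfl (by omega) h3.2
  onto m hm := by
    by_cases hmj : m = j
    · exact ⟨k, by omega, hmj ▸ hgk⟩
    · obtain ⟨m', h1, h2⟩ := h.onto m (by omega)
      exact ⟨m', by omega, by rw [hg m' h1, h2]⟩

/-- When the free place reaches hi, the count forces i = mid and j = hi, so all elements before hi
have been copied. -/
theorem Merging.next (h : Merging key N w f g hi lo i j mid hi) (hN : hi < N) :
    Merging key N w f g hi hi hi (min (hi + w) N) (min (hi + w) N) (min (hi + w + w) N) where
  block := by
    obtain ⟨q, hq⟩ := h.block
    have := h.hi_eq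
    refine ⟨q + 1, ?_⟩
    rw [add_mul]
    omega
  mid_eq := rfl
  hi_eq := rfl
  lo_le := le_rfl
  le_mid := by omega
  mid_le := le_rfl
  le_hi := by omega
  count := rfl
  lt := h.lt
  sorted := h.sorted
  rest m h1 h2 := by omega
  onto m hm := by
    have := h.count
    have := h.le_mid
    have := h.le_hi
    exact h.onto m (by omega)

theorem Merging.finish (h : Merging key N w f g N lo i j mid hi) (hf : IsListing N f) :
    IsListing N g ∧ BlockSorted key N (2 * w) g := by
  refine ⟨⟨h.lt, fun v hv => ?_⟩, h.sorted⟩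
  obtain ⟨m, hm, rfl⟩ := hf.2 v hv
  have := h.count
  have := h.le_mid
  have := h.le_hi
  have := h.hi_eq
  exact h.onto m (by omega)

end Merging

/-! ### The sorting program -/

/-- The minimum of two expressions. -/
def Expr.min (e f : Expr) : Expr := .sub e (.sub e f)

theorem Expr.eval_min {n : ℕ} {σ : Store} {e f : Expr} :
    (Expr.min e f).eval n σ = Min.min (e.eval n σ) (f.eval n σ) := by
  simp only [Expr.min, Expr.eval]
  omega

/-- Start merging the two blocks of length `reg 6` at `e`. -/
def newBlock (N e : Expr) : Prog :=
  .seq (.setReg 4 (.min (.add e (.reg 6)) N))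
    (.seq (.setReg 5 (.min (.add (.add e (.reg 6)) (.reg 6)) N))
      (.seq (.setReg 2 e) (.setReg 3 (.reg 4))))

/-- Write the next element, and start with the next two blocks if necessary. The test `cmp` is to
compare the elements in the registers `10` and `9`. -/
def mergeStep (N : Expr) (cmp : Test) : Prog :=
  .seq (.setReg 9 (.cell 0 (.add (.reg 7) (.reg 2))))
    (.seq (.setReg 10 (.cell 0 (.add (.reg 7) (.reg 3))))
      (.seq
        (.ite (.conj (.lt (.reg 2) (.reg 4)) (.neg (.conj (.lt (.reg 3) (.reg 5)) cmp)))
          (.seq (.setCell 0 (.add (.reg 8) (.reg 1)) (.reg 9))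
            (.setReg 2 (.add (.reg 2) (.const 1))))
          (.seq (.setCell 0 (.add (.reg 8) (.reg 1)) (.reg 10))
            (.setReg 3 (.add (.reg 3) (.const 1)))))
        (.ite (.conj (.neg (.lt (.add (.reg 1) (.const 1)) (.reg 5)))
            (.lt (.add (.reg 1) (.const 1)) N))
          (newBlock N (.add (.reg 1) (.const 1))) .skip)))

/-- Merge all pairs of neighbouring blocks of length `reg 6`, and double `reg 6`. -/
def mergePass (N : Expr) (cmp : Test) : Prog :=
  .seq (.setReg 8 (.add (.reg 7) N))
    (.seq (newBlock N (.const 0))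
      (.seq (countLoop N (mergeStep N cmp))
        (.seq (.setReg 7 (.reg 8)) (.setReg 6 (.add (.reg 6) (.reg 6))))))

/-- Sort the numbers below `N`, and write them to the array `A`. -/
def sortProg (A : ℕ) (N : Expr) (cmp : Test) : Prog :=
  .seq (.seq (countLoop N (.setCell 0 (.reg 1) (.reg 1)))
      (.seq (.setReg 7 (.const 0)) (.setReg 6 (.const 1))))
    (.seq (.loop (.lt (.reg 6) N) (mergePass N cmp))
      (scatterLoop A N (.lt (.const 0) (.const 1)) (.reg 1) (.cell 0 (.add (.reg 7) (.reg 1)))))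

section Sorting

variable {P : Type u} {V : Type v} [LinearOrder V] {n : ℕ} {x : Fin n → Operation P V}
  {N : Expr} {K : ℕ}

theorem RunsTo.newBlock {e : Expr} {σ : Store} {k w : ℕ} (hN : ∀ σ : Store, N.eval n σ = K)
    (he : ∀ σ' : Store, σ'.reg 1 = σ.reg 1 → e.eval n σ' = k) (hw : σ.reg 6 = w) :
    RunsTo x (newBlock N e) σ
      ((((σ.setReg 4 (min (k + w) K)).setReg 5 (min (k + w + w) K)).setReg 2 k).setReg 3
        (min (k + w) K)) (QueueMonitoring.newBlock N e).weight := by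
  refine (RunsTo.setReg ?_).seq ((RunsTo.setReg ?_).seq ((RunsTo.setReg ?_).seq
    (RunsTo.setReg ?_)))
  · simp [Expr.eval_min, Expr.eval, hN, he, hw]
  · rw [Expr.eval_min, hN]
    simp only [Expr.eval]
    rw [he _ (by simp [Store.setReg])]
    simp [Store.setReg, hw]
  · exact he _ (by simp [Store.setReg])
  · simp [Expr.eval, Store.setReg]

/-- The state of the memory while blocks of length `w` of `f` are merged. -/
structure PassState {α : Type*} [LinearOrder α] (key : ℕ → α) (K w s : ℕ) (f : ℕ → ℕ)
    (τ : ℕ → ℕ → ℕ) (k : ℕ) (σ : Store) : Prop where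
  counter : σ.reg 1 = k
  width : σ.reg 6 = w
  source : σ.reg 7 = s
  target : σ.reg 8 = s + K
  get : ∀ m < K, σ.cell 0 (s + m) = f m
  frame : ∀ B ≠ 0, σ.cell B = τ B
  busy : k < σ.reg 5 ∨ k = K
  merging : ∃ lo, Merging key K w f (fun m => σ.cell 0 (s + K + m)) k lo (σ.reg 2) (σ.reg 3)
    (σ.reg 4) (σ.reg 5)

variable {α : Type*} [LinearOrder α] {key : ℕ → α} {cmp : Test}

/-- Both heads are loaded before exhaustion is tested. If a block is exhausted, its register holds
an irrelevant number and the outcome of `cmp` does not matter. Writing at s + K + k leaves the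
source cells s + m with m < K intact. -/
theorem PassState.step_aux {w s : ℕ} {f : ℕ → ℕ} {τ : ℕ → ℕ → ℕ} {k : ℕ} {σ : Store}
    (hcmp : ∀ σ : Store, σ.reg 10 < K → σ.reg 9 < K →
      (cmp.Holds x σ ↔ key (σ.reg 10) < key (σ.reg 9)))
    (h : PassState key K w s f τ k σ) (hk : k < K) (hf : BlockSorted key K w f)
    (hfK : IsListing K f) :
    ∃ σ' : Store, RunsTo x
        (.ite (.conj (.lt (.reg 2) (.reg 4)) (.neg (.conj (.lt (.reg 3) (.reg 5)) cmp)))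
          (.seq (.setCell 0 (.add (.reg 8) (.reg 1)) (.reg 9))
            (.setReg 2 (.add (.reg 2) (.const 1))))
          (.seq (.setCell 0 (.add (.reg 8) (.reg 1)) (.reg 10))
            (.setReg 3 (.add (.reg 3) (.const 1)))))
        ((σ.setReg 9 (σ.cell 0 (s + σ.reg 2))).setReg 10 (σ.cell 0 (s + σ.reg 3)))
        σ' (Prog.ite (.conj (.lt (.reg 2) (.reg 4)) (.neg (.conj (.lt (.reg 3) (.reg 5)) cmp)))
          (.seq (.setCell 0 (.add (.reg 8) (.reg 1)) (.reg 9))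
            (.setReg 2 (.add (.reg 2) (.const 1))))
          (.seq (.setCell 0 (.add (.reg 8) (.reg 1)) (.reg 10))
            (.setReg 3 (.add (.reg 3) (.const 1))))).weight ∧
      σ'.reg 1 = k ∧ σ'.reg 6 = w ∧ σ'.reg 7 = s ∧ σ'.reg 8 = s + K ∧
      (∀ m < K, σ'.cell 0 (s + m) = f m) ∧ (∀ B ≠ 0, σ'.cell B = τ B) ∧
      ∃ lo, Merging key K w f (fun m => σ'.cell 0 (s + K + m)) (k + 1) lo (σ'.reg 2) (σ'.reg 3)
        (σ'.reg 4) (σ'.reg 5) := by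
  obtain ⟨lo, hM⟩ := h.merging
  have hbusy : k < σ.reg 5 := h.busy.resolve_right hk.ne
  have hmidK : σ.reg 4 ≤ K := by have := hM.mid_eq; omega
  have hhiK : σ.reg 5 ≤ K := by have := hM.hi_eq; omega
  set σ₁ := (σ.setReg 9 (σ.cell 0 (s + σ.reg 2))).setReg 10 (σ.cell 0 (s + σ.reg 3)) with hσ₁
  have hne : ∀ {a b : ℕ}, a < K → s + a ≠ s + K + b := fun h => by omega
  by_cases hb : σ.reg 2 < σ.reg 4 ∧ ¬ (σ.reg 3 < σ.reg 5 ∧ cmp.Holds x σ₁)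
  · refine ⟨_, .iteTrue ?_ ((RunsTo.setCell rfl rfl).seq (RunsTo.setReg rfl)), ?_⟩
    · simpa [Test.Holds, Expr.eval, hσ₁, Store.setReg] using hb
    have h2 := h.get _ (hb.1.trans_le hmidK)
    refine ⟨by simp [hσ₁, Store.setReg, Store.setCell, h.counter],
      by simp [hσ₁, Store.setReg, Store.setCell, h.width],
      by simp [hσ₁, Store.setReg, Store.setCell, h.source],
      by simp [hσ₁, Store.setReg, Store.setCell, h.target], ?_, ?_, lo, ?_⟩
    · intro m hm
      simp [hσ₁, Store.setReg, Store.setCell, Expr.eval, h.target, h.get m hm, hne hm]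
    · intro B hB
      simp [hσ₁, Store.setReg, Store.setCell, hB, h.frame B hB]
    · have := hM.left hf hfK hb.1 ?_ (g' := fun m => Function.update (σ.cell 0) (s + K + k)
        (f (σ.reg 2)) (s + K + m)) ?_ ?_
      · simpa [hσ₁, Store.setReg, Store.setCell, Expr.eval, h.target, h.counter, h2] using this
      · intro hj
        have h3 := h.get _ (hj.trans_le hhiK)
        have := hb.2
        rw [hcmp] at this
        · simpa [hj, hσ₁, Store.setReg, h2, h3] using this
        · simpa [hσ₁, Store.setReg, h3] using hfK.1 _ (hj.trans_le hhiK)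
        · simpa [hσ₁, Store.setReg, h2] using hfK.1 _ (hb.1.trans_le hmidK)
      · intro m hm
        simp [hm.ne]
      · simp
  · have hj : σ.reg 3 < σ.reg 5 := by
      by_contra hj
      have := hM.count
      have := hM.le_mid
      have : σ.reg 2 < σ.reg 4 := by omega
      tauto
    have h3 := h.get _ (hj.trans_le hhiK)
    refine ⟨_, .iteFalse ?_ ((RunsTo.setCell rfl rfl).seq (RunsTo.setReg rfl)), ?_⟩
    · simpa [Test.Holds, Expr.eval, hσ₁, Store.setReg] using hb
    refine ⟨by simp [hσ₁, Store.setReg, Store.setCell, h.counter],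
      by simp [hσ₁, Store.setReg, Store.setCell, h.width],
      by simp [hσ₁, Store.setReg, Store.setCell, h.source],
      by simp [hσ₁, Store.setReg, Store.setCell, h.target], ?_, ?_, lo, ?_⟩
    · intro m hm
      simp [hσ₁, Store.setReg, Store.setCell, Expr.eval, h.target, h.get m hm, hne hm]
    · intro B hB
      simp [hσ₁, Store.setReg, Store.setCell, hB, h.frame B hB]
    · have := hM.right hf hfK hj ?_ (g' := fun m => Function.update (σ.cell 0) (s + K + k)
        (f (σ.reg 3)) (s + K + m)) ?_ ?_
      · simpa [hσ₁, Store.setReg, Store.setCell, Expr.eval, h.target, h.counter, h3] using this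
      · intro hi
        have h2 := h.get _ (hi.trans_le hmidK)
        have : cmp.Holds x σ₁ := by tauto
        rw [hcmp] at this
        · simpa [hσ₁, Store.setReg, h2, h3] using this.le
        · simpa [hσ₁, Store.setReg, h3] using hfK.1 _ (hj.trans_le hhiK)
        · simpa [hσ₁, Store.setReg, h2] using hfK.1 _ (hi.trans_le hmidK)
      · intro m hm
        simp [hm.ne]
      · simp

/-- A new pair is opened as soon as the old one is used up and places remain; this restores `busy`,
so the next step always finds an element. -/
theorem PassState.step {w s : ℕ} {f : ℕ → ℕ} {τ : ℕ → ℕ → ℕ} {k : ℕ} {σ : Store} (hw : 0 < w)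
    (hN : ∀ σ : Store, N.eval n σ = K)
    (hcmp : ∀ σ : Store, σ.reg 10 < K → σ.reg 9 < K →
      (cmp.Holds x σ ↔ key (σ.reg 10) < key (σ.reg 9)))
    (h : PassState key K w s f τ k σ) (hk : k < K) (hf : BlockSorted key K w f)
    (hfK : IsListing K f) :
    ∃ σ', RunsTo x (mergeStep N cmp) σ σ' (mergeStep N cmp).weight ∧ σ'.reg 1 = k ∧
      PassState key K w s f τ (k + 1) (σ'.setReg 1 (k + 1)) := by
  obtain ⟨σ', e, h1, h6, h7, h8, hget, hframe, lo, hM⟩ := h.step_aux hcmp hk hf hfK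
  have e1 : RunsTo x (.setReg 9 (.cell 0 (.add (.reg 7) (.reg 2)))) σ _ _ :=
    RunsTo.setReg (k := σ.cell 0 (s + σ.reg 2)) (by simp [Expr.eval, h.source])
  have e2 : RunsTo x (.setReg 10 (.cell 0 (.add (.reg 7) (.reg 3))))
      (σ.setReg 9 (σ.cell 0 (s + σ.reg 2))) _ _ :=
    RunsTo.setReg (k := σ.cell 0 (s + σ.reg 3)) (by simp [Expr.eval, h.source, Store.setReg])
  have hlast := hM.lo_le_k.2
  by_cases hb : k + 1 < σ'.reg 5 ∨ k + 1 = K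
  · refine ⟨σ', e1.seq (e2.seq (e.seq (.iteFalse ?_ (.skip _)))), h1, ?_⟩
    · simp only [Test.Holds, Expr.eval, hN, h1]
      omega
    · exact ⟨by simp [Store.setReg], by simp [Store.setReg, h6], by simp [Store.setReg, h7],
        by simp [Store.setReg, h8], hget, hframe, by simpa [Store.setReg] using hb, lo,
        by simpa [Store.setReg] using hM⟩
  · have hhi : σ'.reg 5 = k + 1 := by omega
    refine ⟨_, e1.seq (e2.seq (e.seq (.iteTrue ?_
      (RunsTo.newBlock (k := k + 1) hN ?_ h6)))), ?_, ?_⟩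
    · simp only [Test.Holds, Expr.eval, hN, h1]
      omega
    · intro σ₂ h2
      simp [Expr.eval, h2, h1]
    · simp [Store.setReg, h1]
    · rw [hhi] at hM
      refine ⟨by simp [Store.setReg], by simp [Store.setReg, h6], by simp [Store.setReg, h7],
        by simp [Store.setReg, h8], hget, hframe, ?_, k + 1, ?_⟩
      · simp [Store.setReg]
        omega
      · simpa [Store.setReg] using hM.next (by omega)

/-- The numbers below `K` are stored in the array `0` from the address `reg 7` on, and their
consecutive blocks of length `reg 6` are sorted. -/
structure SortState (key : ℕ → α) (K w : ℕ) (τ : ℕ → ℕ → ℕ) (σ : Store) : Prop where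
  width : σ.reg 6 = w
  frame : ∀ B ≠ 0, σ.cell B = τ B
  listing : IsListing K (fun m => σ.cell 0 (σ.reg 7 + m))
  sorted : BlockSorted key K w (fun m => σ.cell 0 (σ.reg 7 + m))

/-- Each pass writes directly behind its input and then moves the base address there, so nothing is
copied back. -/
theorem SortState.pass {w : ℕ} {τ : ℕ → ℕ → ℕ} {σ : Store} (hw : 0 < w) (hK : K ≤ 2 * n)
    (hN : ∀ σ : Store, N.eval n σ = K)
    (hcmp : ∀ σ : Store, σ.reg 10 < K → σ.reg 9 < K →
      (cmp.Holds x σ ↔ key (σ.reg 10) < key (σ.reg 9)))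
    (h : SortState key K w τ σ) :
    ∃ σ', RunsTo x (mergePass N cmp) σ σ' ((mergePass N cmp).weight * (n + 1)) ∧
      SortState key K (2 * w) τ σ' := by
  set s := σ.reg 7 with hs
  have e1 : RunsTo x (.setReg 8 (.add (.reg 7) N)) σ (σ.setReg 8 (s + K)) _ :=
    RunsTo.setReg (by simp [Expr.eval, hN, hs])
  have e2 := RunsTo.newBlock (x := x) (σ := σ.setReg 8 (s + K)) (e := .const 0) (k := 0) (w := w)
    hN (fun _ _ => rfl) (by simp [Store.setReg, h.width])
  set σ₁ := (((((σ.setReg 8 (s + K)).setReg 4 (min (0 + w) K)).setReg 5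
    (min (0 + w + w) K)).setReg 2 0).setReg 3 (min (0 + w) K)) with hσ₁
  obtain ⟨σ₂, e3, h2⟩ := RunsTo.countLoop (x := x) (N := N) (c := mergeStep N cmp) (K := K)
    (by omega) (PassState key K w s (fun m => σ.cell 0 (s + m)) τ) (σ := σ₁)
    (fun _ _ _ => hN _) (fun _ _ h => h.counter) (by
      refine ⟨by simp [Store.setReg], by simp [hσ₁, Store.setReg, h.width],
        by simp [hσ₁, Store.setReg, hs], by simp [hσ₁, Store.setReg], fun m _ => rfl, h.frame,
        ?_, 0, ?_⟩
      · simp [hσ₁, Store.setReg]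
        omega
      · simpa [hσ₁, Store.setReg] using Merging.start _ _ _ _ _)
    (fun k hk σ h' => h'.step hw hN hcmp hk h.sorted h.listing)
  have e4 : RunsTo x (.setReg 7 (.reg 8)) σ₂ (σ₂.setReg 7 (s + K)) _ :=
    RunsTo.setReg (by simp [Expr.eval, h2.target])
  have e5 : RunsTo x (.setReg 6 (.add (.reg 6) (.reg 6))) (σ₂.setReg 7 (s + K))
      ((σ₂.setReg 7 (s + K)).setReg 6 (2 * w)) _ :=
    RunsTo.setReg (by simp [Expr.eval, Store.setReg, h2.width, two_mul])
  have hn : 0 < n + 1 := n.succ_pos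
  refine ⟨_, (RunsTo.scale e1 hn).seq_weight ((RunsTo.scale e2 hn).seq_weight
    (e3.seq_weight ((RunsTo.scale e4 hn).seq_weight (RunsTo.scale e5 hn)))), ?_⟩
  obtain ⟨lo, hM⟩ := h2.merging
  have := hM.finish h.listing
  refine ⟨by simp [Store.setReg], h2.frame, ?_, ?_⟩
  · simpa [Store.setReg] using this.1
  · simpa [Store.setReg] using this.2

/-- The factor `n log n` of the running time. -/
def budget (n : ℕ) : ℕ := (n + 1) * (Nat.clog 2 (2 * n) + 1)

theorem RunsTo.sort {A : ℕ} {l : List (ℕ → ℕ)} {σ : Store} (hA : A = l.length + 1)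
    (hσ : σ.Stores l) (hK : K ≤ 2 * n) (hN : ∀ σ : Store, N.eval n σ = K)
    (hcmp : ∀ σ : Store, σ.reg 10 < K → σ.reg 9 < K →
      (cmp.Holds x σ ↔ key (σ.reg 10) < key (σ.reg 9))) :
    ∃ (σ' : Store) (f : ℕ → ℕ), RunsTo x (sortProg A N cmp) σ σ'
      ((sortProg A N cmp).weight * budget n) ∧ σ'.Stores (l ++ [f]) ∧ IsListing K f ∧
      ∀ m m', m < m' → m' < K → key (f m) ≤ key (f m') := by
  have hn : 0 < n + 1 := n.succ_pos
  have e1 := RunsTo.fill (x := x) (N := N) (c := .setCell 0 (.reg 1) (.reg 1)) (K := K)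
    (by omega) (σ := σ) (A := 0) (fun k j => if j < k then j else σ.cell 0 j) (by simp)
    (fun _ _ => hN _) (by
      intro k hk
      convert RunsTo.setCell (x := x) rfl rfl using 1
      · simp only [Store.setCell, Expr.eval, Function.update_self, Function.update_idem]
        congr 2
        ext j
        rcases eq_or_ne j k with rfl | hj
        · simp
        · simp only [Function.update_of_ne hj]
          congr 1
          simp only [eq_iff_iff]
          omega
      · rfl)
  set σ₁ : Store := ⟨Function.update σ.reg 1 K, Function.update σ.cell 0
    (fun j => if j < K then j else σ.cell 0 j)⟩ with hσ₁
  have e2 : RunsTo x (.setReg 7 (.const 0)) σ₁ _ _ := RunsTo.setReg (k := 0) rfl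
  have e3 : RunsTo x (.setReg 6 (.const 1)) (σ₁.setReg 7 0) _ _ := RunsTo.setReg (k := 1) rfl
  have hs : SortState key K (2 ^ 0) σ.cell ((σ₁.setReg 7 0).setReg 6 1) := by
    refine ⟨by simp [Store.setReg], ?_, ⟨?_, ?_⟩, ?_⟩
    · intro B hB
      simp [Store.setReg, hσ₁, hB]
    · intro m hm
      simp [Store.setReg, hσ₁, hm]
    · intro v hv
      exact ⟨v, hv, by simp [Store.setReg, hσ₁, hv]⟩
    · intro q m m' h1 h2 h3
      simp only [pow_zero, mul_one] at h1 h3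
      omega
  obtain ⟨σ₂, e4, e, he, h2⟩ := RunsTo.loop (x := x) (b := .lt (.reg 6) N)
    (c := mergePass N cmp) (τ := (mergePass N cmp).weight * (n + 1))
    -- The width is 2 ^ e, and 2 ^ e < K means e < clog K; so there are exactly clog K passes.
    (fun m σ' => ∃ e, m + e = Nat.clog 2 K ∧ SortState key K (2 ^ e) σ.cell σ')
    (by
      rintro σ' ⟨e, he, h⟩
      simp only [Test.Holds, Expr.eval, h.width, hN, zero_add] at he ⊢
      rw [← Nat.lt_clog_iff_pow_lt (by omega)]
      omega)
    (by
      rintro m σ' ⟨e, he, h⟩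
      refine ⟨?_, ?_⟩
      · simp only [Test.Holds, Expr.eval, h.width, hN]
        rw [← Nat.lt_clog_iff_pow_lt (by omega)]
        omega
      · obtain ⟨σ'', e', h'⟩ := h.pass (by positivity) hK hN hcmp
        exact ⟨σ'', e', e + 1, by omega, by rwa [pow_succ']⟩)
    (Nat.clog 2 K) _ ⟨0, by simp, hs⟩
  have hS : σ₂.Stores l := fun B => (h2.frame (B + 1) (by omega)).trans (hσ B)
  have e5 := RunsTo.scatterLoop (x := x) (A := A) (K := K) (N := N) (σ := σ₂)
    (G := .lt (.const 0) (.const 1)) (ix := .reg 1) (w := .cell 0 (.add (.reg 7) (.reg 1)))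
    (G' := fun _ => True) (ix' := id) (w' := fun m => σ₂.cell 0 (σ₂.reg 7 + m)) (by omega)
    (fun _ _ => hN _) (fun _ _ _ => by simp [Test.Holds, Expr.eval])
    (fun _ _ _ _ => by simp [Expr.eval])
    (fun _ _ _ _ => by simp [Expr.eval, hA])
  subst hA
  have h0 : σ₂.cell (l.length + 1) = 0 := (hS l.length).trans (by simp)
  rw [h0] at e5
  have hval : ∀ m < K, ((0 : ℕ → ℕ) ⊔ scatterMax K (fun _ => True) id
      fun m => σ₂.cell 0 (σ₂.reg 7 + m)) m = σ₂.cell 0 (σ₂.reg 7 + m) := by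
    intro m hm
    simp only [Pi.sup_apply, Pi.zero_apply, zero_le, sup_of_le_right]
    exact le_antisymm (scatterMax_le fun k _ _ hk => by rw [← hk]; rfl)
      (le_scatterMax (G := fun _ => True) (ix := id) (w := fun m => σ₂.cell 0 (σ₂.reg 7 + m))
        hm trivial)
  have hL : Nat.clog 2 K ≤ Nat.clog 2 (2 * n) := Nat.clog_mono_right 2 hK
  have hB : n + 1 ≤ budget n := Nat.le_mul_of_pos_right _ (Nat.succ_pos _)
  have hn' : 0 < budget n := hn.trans_le hB
  refine ⟨_, _, RunsTo.seq_weight (RunsTo.seq_weight (e1.mono (Nat.mul_le_mul_left _ hB))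
    ((RunsTo.scale e2 hn').seq_weight (RunsTo.scale e3 hn')))
    ((e4.mono ?_).seq_weight (e5.mono (Nat.mul_le_mul_left _ hB))),
    hS.append_zero.append _ _, ⟨?_, ?_⟩, ?_⟩
  · simp only [Prog.weight, budget]
    generalize (mergePass N cmp).weight = W
    generalize (Test.lt (.reg 6) N).cost = c
    calc _ ≤ (Nat.clog 2 (2 * n) + 1) * (4 * (c + W + 1) * (n + 1)) := by
          refine Nat.mul_le_mul (by omega) ?_
          nlinarith
      _ = _ := by ring
  · intro m hm
    rw [hval m hm]
    exact h2.listing.1 m hm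
  · intro v hv
    obtain ⟨m, hm, h⟩ := h2.listing.2 v hv
    exact ⟨m, hm, by rw [hval m hm]; exact h⟩
  · intro a b hab hb
    rw [hval a (by omega), hval b hb]
    -- The final width is at least K, so the block 0 is the whole listing.
    refine h2.sorted 0 a b (by simp) hab ?_ hb
    rw [zero_add] at he
    rw [he]
    have := Nat.le_pow_clog one_lt_two K
    omega

end Sorting

/-! ### A criterion for linearizability in terms of the positions of the endpoints -/

/-- The methods that need their value at the front of the queue. -/
def Method.IsFront (m : Method) : Prop := m = .deq ∨ m = .peek

/-- An order of operations that is legal for a queue, for operations with methods `mth` and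
values `g`. -/
structure FifoOrder {O γ α : Type*} [LinearOrder α] (mth : O → Method) (g : O → γ) (t : O → α) :
    Prop where
  injective : Function.Injective t
  enq_lt : ∀ e f, mth e = .enq → (mth f).IsFront → g e = g f → t e < t f
  peek_lt : ∀ p d, mth p = .peek → mth d = .deq → g p = g d → t p < t d
  fifo : ∀ e e' f, mth e = .enq → mth e' = .enq → t e < t e' → (mth f).IsFront → g f = g e' →
    ∃ d, mth d = .deq ∧ g d = g e ∧ t d < t f
  empty : ∀ o e, mth o = .empty → mth e = .enq → t e < t o →
    ∃ d, mth d = .deq ∧ g d = g e ∧ t d < t o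

/-- Only equality of values matters, so group numbers may stand for them. -/
theorem FifoOrder.congr {O γ γ' α : Type*} [LinearOrder α] {mth : O → Method} {g : O → γ}
    {g' : O → γ'} {t : O → α} (h : FifoOrder mth g t)
    (hg : ∀ o o', mth o ≠ .empty → mth o' ≠ .empty → (g o = g o' ↔ g' o = g' o')) :
    FifoOrder mth g' t where
  injective := h.injective
  enq_lt e f he hf hef := h.enq_lt e f he hf
    ((hg _ _ (by simp [he]) (by rcases hf with hf | hf <;> simp [hf])).2 hef)
  peek_lt p d hp hd hpd := h.peek_lt p d hp hd ((hg _ _ (by simp [hp]) (by simp [hd])).2 hpd)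
  fifo e e' f he he' ht hf hfe := by
    obtain ⟨d, hd, h1, h2⟩ := h.fifo e e' f he he' ht hf
      ((hg _ _ (by rcases hf with hf | hf <;> simp [hf]) (by simp [he'])).2 hfe)
    exact ⟨d, hd, (hg _ _ (by simp [hd]) (by simp [he])).1 h1, h2⟩
  empty o e ho he ht := by
    obtain ⟨d, hd, h1, h2⟩ := h.empty o e ho he ht
    exact ⟨d, hd, (hg _ _ (by simp [hd]) (by simp [he])).1 h1, h2⟩

/-- Operations with positions `ip` and `rp` of their endpoints, and for each value `v` the position
`a v` of the invocation of its `enq`, the first response `b v` of an operation of `v`, the first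
response `c v` of a `deq` or `peek`, and the last invocation `d v`; the position `M` stands for
infinity. -/
structure Summary {O γ : Type*} (M : ℕ) (mth : O → Method) (g : O → γ) (ip rp : O → ℕ)
    (a b c d : γ → ℕ) : Prop where
  ip_lt_rp : ∀ o, ip o < rp o
  ne : ∀ o o', rp o ≠ ip o'
  rp_lt : ∀ o, rp o < M
  exists_enq : ∀ o, mth o ≠ .empty → ∃ e, mth e = .enq ∧ g e = g o
  enq_unique : ∀ e e', mth e = .enq → mth e' = .enq → g e = g e' → e = e'
  deq_unique : ∀ e e', mth e = .deq → mth e' = .deq → g e = g e' → e = e'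
  a_eq : ∀ e, mth e = .enq → a (g e) = ip e
  b_le : ∀ o, mth o ≠ .empty → b (g o) ≤ rp o
  exists_b : ∀ e, mth e = .enq → ∃ o, mth o ≠ .empty ∧ g o = g e ∧ rp o = b (g e)
  c_le : ∀ o, (mth o).IsFront → c (g o) ≤ rp o
  exists_c : ∀ e, mth e = .enq → c (g e) = M ∨ ∃ o, (mth o).IsFront ∧ g o = g e ∧ rp o = c (g e)
  le_d : ∀ o, mth o ≠ .empty → ip o ≤ d (g o)
  d_eq : ∀ e, mth e = .enq → (∀ o, mth o = .deq → g o ≠ g e) → d (g e) = M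
  exists_d : ∀ e o, mth e = .enq → mth o = .deq → g o = g e →
    ∃ o', mth o' ≠ .empty ∧ g o' = g e ∧ ip o' = d (g e)

/-- The conditions that characterize linearizability. -/
structure Criterion {O γ : Type*} (mth : O → Method) (g : O → γ) (ip rp : O → ℕ)
    (a b c d : γ → ℕ) : Prop where
  valid : ∀ e, mth e = .enq → a (g e) < b (g e)
  peek : ∀ p o, mth p = .peek → mth o = .deq → g p = g o → ip p < rp o
  front : ∀ e e', mth e = .enq → mth e' = .enq → e ≠ e' →
    ¬ (c (g e) < d (g e') ∧ c (g e') < d (g e))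
  direct : ∀ e e', mth e = .enq → mth e' = .enq → b (g e) < a (g e') → ¬ c (g e') < d (g e)
  indirect : ∀ e e' f, mth e = .enq → mth e' = .enq → mth f = .enq → b (g e) < a (g e') →
    c (g f) < d (g e) → ¬ c (g e') < d (g f)
  gap : ∀ o, mth o = .empty →
    ∃ q, ip o < q ∧ q ≤ rp o ∧ ∀ e, mth e = .enq → b (g e) < q → d (g e) < q

/-! ### Necessity of the criterion -/

namespace Summary

variable {O γ α : Type*} [LinearOrder α] {M : ℕ} {mth : O → Method} {g : O → γ} {ip rp : O → ℕ}
  {a b c d : γ → ℕ} {t : O → α}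

theorem b_le_c (S : Summary M mth g ip rp a b c d) {e : O} (he : mth e = .enq) :
    b (g e) ≤ c (g e) := by
  rcases S.exists_c e he with h | ⟨o, ho, h1, h2⟩
  · rw [h]
    exact (S.b_le e (by simp [he])).trans (S.rp_lt e).le
  · rw [← h2, ← h1]
    exact S.b_le o (by rcases ho with ho | ho <;> simp [ho])

theorem enq_le (h : FifoOrder mth g t) (S : Summary M mth g ip rp a b c d) {e o : O}
    (he : mth e = .enq) (ho : mth o ≠ .empty) (hg : g o = g e) : t e ≤ t o := by
  rcases hm : mth o
  · exact (congrArg t (S.enq_unique e o he hm hg.symm)).le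
  · exact (h.enq_lt e o he (Or.inl hm) hg.symm).le
  · exact (h.enq_lt e o he (Or.inr hm) hg.symm).le
  · exact absurd hm ho

theorem le_deq (h : FifoOrder mth g t) (S : Summary M mth g ip rp a b c d) {e o : O}
    (he : mth e = .deq) (ho : mth o ≠ .empty) (hg : g o = g e) : t o ≤ t e := by
  rcases hm : mth o
  · exact (h.enq_lt o e hm (Or.inl he) hg).le
  · exact (congrArg t (S.deq_unique o e hm he hg)).le
  · exact (h.peek_lt o e hm he hg).le
  · exact absurd hm ho

/-- If e' came first, a deq of its value would precede the operation of e that responds at c. But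
the last invoked operation of e' starts after this response and is not ordered after the deq. The
weak inequality admits e = e', so that such precedences can be chained freely. -/
theorem enq_lt_of_front (h : FifoOrder mth g t) (S : Summary M mth g ip rp a b c d)
    (hb : ∀ o o', rp o < ip o' → t o < t o') (hd : ∀ e, mth e = .enq → d (g e) ≤ M)
    {e e' : O} (he : mth e = .enq) (he' : mth e' = .enq) (hlt : c (g e) < d (g e')) :
    t e ≤ t e' := by
  by_contra! hlt'
  rcases S.exists_c e he with hc | ⟨f, hf, hgf, hcf⟩
  · have := hd e' he'
    omega
  obtain ⟨o, ho, hgo, hto⟩ := h.fifo e' e f he' he hlt' hf hgf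
  obtain ⟨o', ho', hgo', hdo'⟩ := S.exists_d e' o he' ho hgo
  have h1 := hb f o' (by omega)
  have h2 := S.le_deq h ho ho' (hgo'.trans hgo.symm)
  exact absurd (h1.trans_le (h2.trans hto.le)) (lt_irrefl _)

theorem enq_lt_of_enq (h : FifoOrder mth g t) (S : Summary M mth g ip rp a b c d)
    (hb : ∀ o o', rp o < ip o' → t o < t o')
    {e e' : O} (he : mth e = .enq) (he' : mth e' = .enq) (hlt : b (g e) < a (g e')) :
    t e < t e' := by
  obtain ⟨o, ho, hgo, hbo⟩ := S.exists_b e he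
  rw [S.a_eq e' he', ← hbo] at hlt
  exact (S.enq_le h he ho hgo).trans_lt (hb _ _ hlt)

/-- The criterion is necessary. -/
theorem criterion [Fintype O] (h : FifoOrder mth g t) (S : Summary M mth g ip rp a b c d)
    (hb : ∀ o o', rp o < ip o' → t o < t o') (hd : ∀ e, mth e = .enq → d (g e) ≤ M) :
    Criterion mth g ip rp a b c d where
  valid e he := by
    by_contra! hlt
    obtain ⟨o, ho, hgo, hbo⟩ := S.exists_b e he
    rw [S.a_eq e he, ← hbo] at hlt
    exact absurd (hb o e (lt_of_le_of_ne hlt (S.ne _ _))) (S.enq_le h he ho hgo).not_gt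
  peek p o hp ho hpo := by
    by_contra! hlt
    exact absurd (hb o p (lt_of_le_of_ne hlt (S.ne _ _))) (h.peek_lt p o hp ho hpo).not_gt
  front e e' he he' hne := by
    rintro ⟨h1, h2⟩
    exact hne (h.injective (le_antisymm (S.enq_lt_of_front h hb hd he he' h1)
      (S.enq_lt_of_front h hb hd he' he h2)))
  direct e e' he he' h1 h2 :=
    (S.enq_lt_of_enq h hb he he' h1).not_ge (S.enq_lt_of_front h hb hd he' he h2)
  indirect e e' f he he' hf h1 h2 h3 :=
    (S.enq_lt_of_enq h hb he he' h1).not_ge ((S.enq_lt_of_front h hb hd he' hf h3).trans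
      (S.enq_lt_of_front h hb hd hf he h2))
  gap o ho := by
    classical
    -- The cut is made just after the latest invocation among the operations ordered up to o. A
    -- value with a response before the cut is enqueued before o, hence dequeued before o, so all
    -- its operations are ordered before o and invoked before the cut.
    obtain ⟨m, hm, hmax⟩ := (Finset.univ.filter fun o' => t o' ≤ t o).exists_max_image ip
      ⟨o, by simp⟩
    simp only [Finset.mem_filter, Finset.mem_univ, true_and] at hm hmax
    have hmo : ip m < rp o := by
      by_contra! hlt
      exact absurd (hb o m (lt_of_le_of_ne hlt (S.ne _ _))) hm.not_gt
    refine ⟨ip m + 1, Nat.lt_succ_of_le (hmax o le_rfl), hmo, fun e he hbe => ?_⟩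
    obtain ⟨f, hf, hgf, hbf⟩ := S.exists_b e he
    have hfm : rp f < ip m := lt_of_le_of_ne (by omega) (S.ne _ _)
    have hte : t e ≤ t o := (S.enq_le h he hf hgf).trans ((hb f m hfm).le.trans hm)
    have hne : t e ≠ t o := fun heq => by
      rw [h.injective heq, ho] at he
      cases he
    obtain ⟨k, hk, hgk, htk⟩ := h.empty o e ho he (lt_of_le_of_ne hte hne)
    obtain ⟨o', ho', hgo', hdo'⟩ := S.exists_d e k he hk hgk
    rw [← hdo']
    exact Nat.lt_succ_of_le (hmax o' ((S.le_deq h hk ho' (hgo'.trans hgk.symm)).trans htk.le))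

end Summary

/-! ### From forced precedences to an order of the values -/

/-- Under the criterion, every set of values has one that may come first. -/
theorem Criterion.exists_first {O γ : Type*} {mth : O → Method} {g : O → γ} {ip rp : O → ℕ}
    {a b c d : γ → ℕ}
    (C : Criterion mth g ip rp a b c d)
    (X : Finset O) (hX : ∀ e ∈ X, mth e = .enq) (hne : X.Nonempty) :
    ∃ e ∈ X, ∀ e' ∈ X, e' ≠ e → ¬ (b (g e') < a (g e) ∨ c (g e') < d (g e)) := by
  classical
  -- Let Y consist of the members without a c-d predecessor. As c(m) is least, c(m) < d(e) for every
  -- e that has such a predecessor; hence everything outside Y is reached from Y by one or two c-d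
  -- steps, via m.
  obtain ⟨m, hm, hmin⟩ := X.exists_min_image (fun e => c (g e)) hne
  set Y := X.filter fun e => ∀ e' ∈ X, e' ≠ e → ¬ c (g e') < d (g e) with hY
  have hYX : ∀ e ∈ Y, e ∈ X := fun e he => (Finset.mem_filter.1 he).1
  have key : ∀ e ∈ X, e ∉ Y → ∃ e' ∈ Y, c (g e') < d (g e) ∨
      ∃ f ∈ X, c (g e') < d (g f) ∧ c (g f) < d (g e) := by
    by_cases hmY : m ∈ Y
    · intro e he heY
      simp only [hY, Finset.mem_filter, he, true_and] at heY
      push Not at heY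
      obtain ⟨f, hf, -, hfe⟩ := heY
      exact ⟨m, hmY, Or.inl ((hmin f hf).trans_lt hfe)⟩
    · have hmY' := hmY
      simp only [hY, Finset.mem_filter, hm, true_and] at hmY'
      push Not at hmY'
      obtain ⟨z, hz, hzm, hlt⟩ := hmY'
      -- A c-d predecessor of z would give c(m) < d(z), which `front` forbids next to c(z) < d(m).
      have hzY : z ∈ Y := by
        refine Finset.mem_filter.2 ⟨hz, fun e he hez hlt' => ?_⟩
        exact C.front z m (hX z hz) (hX m hm) hzm ⟨hlt, (hmin e he).trans_lt hlt'⟩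
      intro e he heY
      simp only [hY, Finset.mem_filter, he, true_and] at heY
      push Not at heY
      obtain ⟨f, hf, -, hfe⟩ := heY
      exact ⟨z, hzY, Or.inr ⟨m, hm, hlt, (hmin f hf).trans_lt hfe⟩⟩
  have hYne : Y.Nonempty := by
    by_cases hmY : m ∈ Y
    · exact ⟨m, hmY⟩
    · obtain ⟨z, hz, -⟩ := key m hm hmY
      exact ⟨z, hz⟩
  -- The earliest invoked enq in Y works. If b(e') < a(e), then a(e') < a(e) puts e' outside Y, so
  -- some y in Y leads to e' by c-d steps; and b(e') < a(e) ≤ a(y) closes a cycle excluded by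
  -- `direct` or `indirect`.
  obtain ⟨e, he, hmin'⟩ := Y.exists_min_image (fun e => a (g e)) hYne
  refine ⟨e, hYX e he, fun e' he' hne' hlt => ?_⟩
  rcases hlt with hlt | hlt
  · have h1 := C.valid e' (hX e' he')
    have he'Y : e' ∉ Y := fun h => by
      have := hmin' e' h
      omega
    obtain ⟨y, hy, h2⟩ := key e' he' he'Y
    have h3 := hmin' y hy
    have h4 : b (g e') < a (g y) := by omega
    rcases h2 with h2 | ⟨f, hf, h2, h5⟩
    · exact C.direct e' y (hX _ he') (hX _ (hYX _ hy)) h4 h2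
    · exact C.indirect e' y f (hX _ he') (hX _ (hYX _ hy)) (hX _ hf) h4 h5 h2
  · exact (Finset.mem_filter.1 he).2 e' he' hne' hlt


/-- A finite relation is contained in a linear order if every nonempty subset has a source. -/
theorem exists_rank {γ : Type*} (R : γ → γ → Prop) (X : Finset γ)
    (h : ∀ Y ⊆ X, Y.Nonempty → ∃ x ∈ Y, ∀ y ∈ Y, y ≠ x → ¬ R y x) :
    ∃ ρ : γ → ℕ, Set.InjOn ρ X ∧ ∀ x ∈ X, ∀ y ∈ X, x ≠ y → R x y → ρ x < ρ y := by
  classical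
  induction X using Finset.strongInduction with
  | H X ih =>
    rcases X.eq_empty_or_nonempty with rfl | hne
    · exact ⟨fun _ => 0, by simp, by simp⟩
    obtain ⟨x, hx, hsrc⟩ := h X (Finset.Subset.refl X) hne
    obtain ⟨ρ, hinj, hρ⟩ := ih (X.erase x) (Finset.erase_ssubset hx)
      fun Y hY => h Y (hY.trans (Finset.erase_subset _ _))
    refine ⟨fun y => if y = x then 0 else ρ y + 1, ?_, ?_⟩
    · intro y hy z hz hyz
      by_cases h1 : y = x <;> by_cases h2 : z = x <;> simp only [h1, h2, if_true, if_false] at hyz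
      · rw [h1, h2]
      · omega
      · omega
      · exact hinj (by simp_all) (by simp_all) (by omega)
    · intro y hy z hz hyz hR
      by_cases h2 : z = x
      · subst h2
        exact absurd hR (hsrc y hy hyz)
      · by_cases h1 : y = x
        · simp [h1, h2]
        · simpa [h1, h2] using hρ y (by simp_all) z (by simp_all) hyz hR


namespace Summary

variable {O γ : Type*} {M : ℕ} {mth : O → Method} {g : O → γ} {ip rp : O → ℕ}
  {a b c d : γ → ℕ}

/-- Under the criterion, there are gaps `q o` for the operations `empty`, and an order `ρ` of the
values; `lev e` is the last gap that has to precede all operations of the value of `e`. -/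
theorem exists_order [Fintype O] (S : Summary M mth g ip rp a b c d)
    (C : Criterion mth g ip rp a b c d) :
    ∃ q lev ρ : O → ℕ,
      (∀ o, mth o = .empty → ip o < q o ∧ q o ≤ rp o ∧
        ∀ e, mth e = .enq → b (g e) < q o → d (g e) < q o) ∧
      (∀ e o, mth e = .enq → mth o = .empty → q o ≤ b (g e) → q o ≤ lev e) ∧
      (∀ e, mth e = .enq → lev e ≤ b (g e)) ∧
      (∀ e e', mth e = .enq → mth e' = .enq → ρ e = ρ e' → e = e') ∧
      ∀ e e', mth e = .enq → mth e' = .enq → e ≠ e' →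
        (b (g e) < a (g e') ∨ c (g e) < d (g e') ∨ lev e < lev e') → ρ e < ρ e' := by
  classical
  have hq : ∀ o, ∃ q, mth o = .empty → ip o < q ∧ q ≤ rp o ∧
      ∀ e, mth e = .enq → b (g e) < q → d (g e) < q := by
    intro o
    by_cases h : mth o = .empty
    · obtain ⟨q, hq⟩ := C.gap o h
      exact ⟨q, fun _ => hq⟩
    · exact ⟨0, fun h' => absurd h' h⟩
  choose q hq using hq
  -- The supremum of q over Q e is the level of e: the last chosen cut not after b(e).
  set Q : O → Finset O := fun e => Finset.univ.filter fun o => mth o = .empty ∧ q o ≤ b (g e)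
    with hQ
  have lev1 : ∀ e o, mth o = .empty → q o ≤ b (g e) → q o ≤ (Q e).sup q := fun e o ho h =>
    Finset.le_sup (f := q) (by simp [hQ, ho, h])
  have lev2 : ∀ e, (Q e).sup q ≤ b (g e) := fun e =>
    Finset.sup_le fun o ho => by simp only [hQ, Finset.mem_filter] at ho; exact ho.2.2
  -- Forced precedences do not lower the level. Otherwise a cut q has b(e') < q ≤ b(e), so d(e') < q
  -- ≤ b(e) ≤ c(e) and a(e') < b(e') < b(e), and neither precedence can hold.
  have hlev : ∀ e e', mth e = .enq → mth e' = .enq →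
      (b (g e) < a (g e') ∨ c (g e) < d (g e')) → (Q e).sup q ≤ (Q e').sup q := by
    intro e e' he he' h
    refine Finset.sup_le fun o ho => ?_
    simp only [hQ, Finset.mem_filter, Finset.mem_univ, true_and] at ho
    by_contra! hlt
    have h1 : b (g e') < q o := by
      by_contra! h1
      exact absurd (lev1 e' o ho.1 h1) hlt.not_ge
    have h2 := (hq o ho.1).2.2 e' he' h1
    have h3 := C.valid e' he'
    have h4 := S.b_le_c he
    omega
  obtain ⟨ρ, hinj, hρ⟩ := exists_rank
    (fun e e' => b (g e) < a (g e') ∨ c (g e) < d (g e') ∨ (Q e).sup q < (Q e').sup q)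
    (Finset.univ.filter fun e => mth e = .enq) (by
      intro Y hY hne
      have hYe : ∀ e ∈ Y, mth e = .enq := fun e he => by simpa using hY he
      -- It therefore suffices to find a first value within the lowest level.
      obtain ⟨m, hm, hmin⟩ := Y.exists_min_image (fun e => (Q e).sup q) hne
      obtain ⟨e, he, hsrc⟩ := C.exists_first
        (Y.filter fun e => (Q e).sup q = (Q m).sup q)
        (fun e he => hYe e (Finset.mem_filter.1 he).1) ⟨m, by simp [hm]⟩
      rw [Finset.mem_filter] at he
      refine ⟨e, he.1, fun e' he' hne' hR => ?_⟩
      have h1 := hmin e' he'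
      have h2 := he.2
      by_cases h : b (g e') < a (g e) ∨ c (g e') < d (g e)
      · have h3 := hlev e' e (hYe _ he') (hYe _ he.1) h
        exact hsrc e' (Finset.mem_filter.2 ⟨he', by omega⟩) hne' h
      · omega)
  refine ⟨q, fun e => (Q e).sup q, ρ, hq, fun e o _ => lev1 e o, fun e _ => lev2 e, ?_, ?_⟩
  · intro e e' he he' h
    exact hinj (by simpa using he) (by simpa using he') h
  · intro e e' he he' hne h
    exact hρ e (by simpa using he) e' (by simpa using he') hne h

/-! ### The earliest schedule -/

/-- The criterion is sufficient. -/
theorem exists_fifoOrder [Fintype O] [LinearOrder O] (S : Summary M mth g ip rp a b c d)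
    (C : Criterion mth g ip rp a b c d) :
    ∃ t : O → ℕ ×ₗ ℕ ×ₗ ℕ ×ₗ O,
      FifoOrder mth g t ∧ ∀ o o', rp o < ip o' → t o < t o' := by
  classical
  obtain ⟨q, lev, ρ, hq, lev1, lev2, hinj, hρ⟩ := S.exists_order C
  have hrep : ∀ o, ∃ e, mth o ≠ .empty → mth e = .enq ∧ g e = g o := by
    intro o
    by_cases h : mth o = .empty
    · exact ⟨o, fun h' => absurd h h'⟩
    · obtain ⟨e, he⟩ := S.exists_enq o h
      exact ⟨e, fun _ => he⟩
  choose r hr using hrep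
  have hre : ∀ e, mth e = .enq → r e = e := fun e he =>
    S.enq_unique _ _ (hr e (by simp [he])).1 he (hr e (by simp [he])).2
  have hrf : ∀ o, (mth o).IsFront → mth (r o) = .enq ∧ g (r o) = g o := fun o ho =>
    hr o (by rcases ho with ho | ho <;> simp [ho])
  have hreq : ∀ e o, mth e = .enq → (mth o).IsFront → g e = g o → r o = e := fun e o he ho h =>
    S.enq_unique _ _ (hrf o ho).1 he ((hrf o ho).2.trans h.symm)
  -- Positions are doubled, so that the cut q can be placed at the odd time 2q - 1, before the
  -- endpoint at position q. The time al is the earliest for an enq when all enqs follow ρ: not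
  -- before the invocation or the level of any value up to e. The time de is when all values before
  -- e may be gone.
  set A : O → ℕ := fun w => max (2 * a (g w)) (2 * lev w - 1) with hA
  set E : Finset O := Finset.univ.filter fun e => mth e = .enq with hE
  set al : O → ℕ := fun e => (E.filter fun w => ρ w ≤ ρ e).sup A with hal
  set de : O → ℕ := fun e => (E.filter fun w => ρ w < ρ e).sup fun w => 2 * d (g w) with hde
  have hal_le : ∀ e w, mth w = .enq → ρ w ≤ ρ e → A w ≤ al e := fun e w hw h =>
    Finset.le_sup (f := A) (by simp [hE, hw, h])
  have hde_le : ∀ e w, mth w = .enq → ρ w < ρ e → 2 * d (g w) ≤ de e := fun e w hw h =>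
    Finset.le_sup (f := fun w => 2 * d (g w)) (by simp [hE, hw, h])
  have hal_lt : ∀ e m, 0 < m → (∀ w, mth w = .enq → ρ w ≤ ρ e → A w < m) → al e < m := by
    intro e m hm h
    refine (Finset.sup_lt_iff (by simpa using hm)).2 fun w hw => ?_
    simp only [hE, Finset.mem_filter, Finset.mem_univ, true_and] at hw
    exact h w hw.1 hw.2
  have hde_lt : ∀ e m, 0 < m → (∀ w, mth w = .enq → ρ w < ρ e → 2 * d (g w) < m) →
      de e < m := by
    intro e m hm h
    refine (Finset.sup_lt_iff (by simpa using hm)).2 fun w hw => ?_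
    simp only [hE, Finset.mem_filter, Finset.mem_univ, true_and] at hw
    exact h w hw.1 hw.2
  have hal_mono : ∀ e e', ρ e ≤ ρ e' → al e ≤ al e' := fun e e' h =>
    Finset.sup_mono fun w => by
      simp only [Finset.mem_filter]
      exact fun hw => ⟨hw.1, hw.2.trans h⟩
  have hde_mono : ∀ e e', ρ e ≤ ρ e' → de e ≤ de e' := fun e e' h =>
    Finset.sup_mono fun w => by
      simp only [Finset.mem_filter]
      exact fun hw => ⟨hw.1, hw.2.trans_le h⟩
  have hnot : ∀ e e', mth e = .enq → mth e' = .enq → ρ e < ρ e' →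
      ¬ b (g e') < a (g e) ∧ ¬ c (g e') < d (g e) ∧ lev e ≤ lev e' := by
    intro e e' he he' h
    have hne : e' ≠ e := by
      rintro rfl
      exact lt_irrefl _ h
    refine ⟨fun h1 => ?_, fun h1 => ?_, ?_⟩
    · exact absurd (hρ e' e he' he hne (Or.inl h1)) h.not_gt
    · exact absurd (hρ e' e he' he hne (Or.inr (Or.inl h1))) h.not_gt
    · by_contra! h1
      exact absurd (hρ e' e he' he hne (Or.inr (Or.inr h1))) h.not_gt
  have hne_b : ∀ e w, mth e = .enq → mth w = .enq → b (g e) ≠ a (g w) := by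
    intro e w he hw
    obtain ⟨o, -, -, ho⟩ := S.exists_b e he
    rw [S.a_eq w hw, ← ho]
    exact S.ne _ _
  have hb_pos : ∀ e, mth e = .enq → 0 < b (g e) := fun e he => (Nat.zero_le _).trans_lt (C.valid e he)
  -- Neither contribution is late: a value w up to e in the order ρ has a(w) < b(e), and lev w ≤ lev
  -- e ≤ b(e).
  have hlt_b : ∀ e, mth e = .enq → al e < 2 * b (g e) := by
    intro e he
    have hb := hb_pos e he
    refine hal_lt e _ (by omega) fun w hw hwe => ?_
    have h1 : a (g w) < b (g e) ∧ lev w ≤ lev e := by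
      rcases hwe.eq_or_lt with h | h
      · obtain rfl := hinj w e hw he h
        exact ⟨C.valid w hw, le_rfl⟩
      · have h2 := hnot w e hw he h
        have h3 := hne_b e w he hw
        exact ⟨by omega, h2.2.2⟩
    have h2 := lev2 e he
    simp only [hA]
    omega
  -- For w before e, d(w) ≤ c(e) ≤ rp f. Here d(w) is not infinite, as rp f < M, so it is the
  -- position of an invocation and differs from the response rp f.
  have hlt_c : ∀ e, mth e = .enq → ∀ f, (mth f).IsFront → g e = g f → de e < 2 * rp f := by
    intro e he f hf hgf
    have := S.ip_lt_rp f
    refine hde_lt e _ (by omega) fun w hw hwe => ?_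
    have h1 := (hnot w e hw he hwe).2.1
    have h2 := S.c_le f hf
    have h3 := S.rp_lt f
    rw [← hgf] at h2
    by_cases hdeq : ∃ o, mth o = .deq ∧ g o = g w
    · obtain ⟨o, ho, hgo⟩ := hdeq
      obtain ⟨o', -, -, h4⟩ := S.exists_d w o hw ho hgo
      have h5 := S.ne f o'
      omega
    · push Not at hdeq
      have := S.d_eq w hw hdeq
      omega
  have hd_lt : ∀ e o, mth e = .enq → mth o = .deq → g e = g o → d (g e) < rp o := by
    intro e o he ho hgo
    obtain ⟨o', ho', hg', h1⟩ := S.exists_d e o he ho hgo.symm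
    rw [← h1]
    rcases hm : mth o'
    · obtain rfl := S.enq_unique o' e hm he hg'
      have h2 := C.valid o' hm
      rw [S.a_eq o' hm] at h2
      have h3 := S.b_le o (by simp [ho])
      rw [← hgo] at h3
      omega
    · obtain rfl := S.deq_unique o' o hm ho (hg'.trans hgo)
      exact S.ip_lt_rp _
    · exact C.peek o' o hm ho (hg'.trans hgo)
    · exact absurd hm ho'
  -- A deq also waits for the last invocation of its own value, so that all peeks of the value fit
  -- before it.
  set T : O → ℕ := fun o => match mth o with
    | .enq => al o
    | .peek => max (al (r o)) (max (de (r o)) (2 * ip o))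
    | .deq => max (al (r o)) (max (de (r o)) (2 * d (g o)))
    | .empty => 2 * q o - 1 with hT
  set kind : O → ℕ := fun o => match mth o with
    | .enq => 1
    | .peek => 2
    | .deq => 2
    | .empty => 0 with hkind
  set sub : O → ℕ := fun o => match mth o with
    | .deq => 1
    | _ => 0 with hsub
  have hT_enq : ∀ o, mth o = .enq → T o = al o := fun o ho => by simp only [hT, ho]
  have hT_peek : ∀ o, mth o = .peek →
      T o = max (al (r o)) (max (de (r o)) (2 * ip o)) := fun o ho => by simp only [hT, ho]
  have hT_deq : ∀ o, mth o = .deq →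
      T o = max (al (r o)) (max (de (r o)) (2 * d (g o))) := fun o ho => by simp only [hT, ho]
  have hT_empty : ∀ o, mth o = .empty → T o = 2 * q o - 1 := fun o ho => by simp only [hT, ho]
  have hT_front : ∀ o, (mth o).IsFront → max (al (r o)) (de (r o)) ≤ T o := by
    rintro o (ho | ho)
    · rw [hT_deq o ho]
      omega
    · rw [hT_peek o ho]
      omega
  have hkind_le : ∀ o, kind o ≤ 2 := fun o => by
    simp only [hkind]
    cases mth o <;> simp
  have hkind_front : ∀ o, (mth o).IsFront → kind o = 2 := by
    rintro o (ho | ho) <;> simp only [hkind, ho]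
  -- Together with `hhigh`, this places every operation inside its doubled interval, which preserves
  -- the real-time order.
  have hlow : ∀ o, 2 * ip o ≤ T o := by
    intro o
    rcases hm : mth o
    · rw [hT_enq o hm, ← S.a_eq o hm]
      exact (le_max_left _ _).trans (hal_le o o hm le_rfl)
    · rw [hT_deq o hm]
      have := S.le_d o (by simp [hm])
      omega
    · rw [hT_peek o hm]
      omega
    · rw [hT_empty o hm]
      have := (hq o hm).1
      omega
  have hhigh : ∀ o, T o < 2 * rp o := by
    intro o
    have hfront : (mth o).IsFront → max (al (r o)) (de (r o)) < 2 * rp o := by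
      intro ho
      obtain ⟨h1, h2⟩ := hrf o ho
      have h3 := hlt_b _ h1
      have h4 := S.b_le_c h1
      have h5 := S.c_le o ho
      rw [← h2] at h5
      have h6 := hlt_c _ h1 o ho h2
      omega
    rcases hm : mth o
    · rw [hT_enq o hm]
      have h1 := hlt_b o hm
      have h2 := S.b_le o (by simp [hm])
      omega
    · rw [hT_deq o hm]
      have h1 := hfront (Or.inl hm)
      obtain ⟨h2, h3⟩ := hrf o (Or.inl hm)
      have h4 := hd_lt _ o h2 hm h3
      rw [h3] at h4
      omega
    · rw [hT_peek o hm]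
      have h1 := hfront (Or.inr hm)
      have h2 := S.ip_lt_rp o
      omega
    · rw [hT_empty o hm]
      have := hq o hm
      omega
  -- At equal times empty precedes enq, which precedes deq and peek; then ρ decides, then peek
  -- precedes deq, and o itself makes t injective. As kind ≤ 2, the factor 3 lets it break ties
  -- only.
  set t : O → ℕ ×ₗ ℕ ×ₗ ℕ ×ₗ O := fun o =>
    toLex (3 * T o + kind o, toLex (ρ (r o), toLex (sub o, o))) with ht
  have lt_of_T : ∀ o o', 3 * T o + kind o < 3 * T o' + kind o' → t o < t o' := fun o o' h =>
    Prod.Lex.toLex_lt_toLex.2 (Or.inl h)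
  have lt_of_ρ : ∀ o o', 3 * T o + kind o ≤ 3 * T o' + kind o' → ρ (r o) < ρ (r o') →
      t o < t o' := by
    intro o o' h h'
    rcases h.lt_or_eq with h | h
    · exact lt_of_T o o' h
    · exact Prod.Lex.toLex_lt_toLex.2 (Or.inr ⟨h, Prod.Lex.toLex_lt_toLex.2 (Or.inl h')⟩)
  have henq : ∀ e e', mth e = .enq → mth e' = .enq → t e < t e' → ρ e < ρ e' := by
    intro e e' he he' hlt
    by_contra! h
    rcases h.lt_or_eq with h | h
    · refine absurd (lt_of_ρ e' e ?_ (by rwa [hre e he, hre e' he'])) hlt.not_gt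
      have := hal_mono e' e h.le
      rw [hT_enq e he, hT_enq e' he']
      simp only [hkind, he, he']
      omega
    · rw [hinj _ _ he' he h] at hlt
      exact lt_irrefl _ hlt
  refine ⟨t, ⟨?_, ?_, ?_, ?_, ?_⟩, ?_⟩
  · intro o o' h
    simp only [ht, EmbeddingLike.apply_eq_iff_eq, Prod.mk.injEq] at h
    exact h.2.2.2
  · intro e f he hf hef
    apply lt_of_T
    have h1 := hT_front f hf
    rw [hreq e f he hf hef] at h1
    rw [hT_enq e he, hkind_front f hf]
    simp only [hkind, he]
    omega
  · intro p o hp ho hpo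
    have hrr : r p = r o := hreq _ p (hrf o (Or.inl ho)).1 (Or.inr hp)
      ((hrf o (Or.inl ho)).2.trans hpo.symm)
    have h1 : T p ≤ T o := by
      rw [hT_peek p hp, hT_deq o ho, hrr, ← hpo]
      have := S.le_d p (by simp [hp])
      omega
    rcases h1.lt_or_eq with h1 | h1
    · refine lt_of_T _ _ ?_
      rw [hkind_front p (Or.inr hp), hkind_front o (Or.inl ho)]
      omega
    · refine Prod.Lex.toLex_lt_toLex.2 (Or.inr ⟨?_, Prod.Lex.toLex_lt_toLex.2 (Or.inr ⟨?_,
        Prod.Lex.toLex_lt_toLex.2 (Or.inl ?_)⟩)⟩)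
      · simp only [h1, hkind_front p (Or.inr hp), hkind_front o (Or.inl ho)]
      · simp only [hrr]
      · simp [hsub, hp, ho]
  · intro e e' f he he' hlt hf hgf
    have hlt := henq e e' he he' hlt
    have hrfe : r f = e' := hreq e' f he' hf hgf.symm
    have h1 := (hnot e e' he he' hlt).2.1
    have h2 := S.c_le f hf
    have h3 := S.rp_lt f
    rw [hgf] at h2
    obtain ⟨k, hk, hgk⟩ : ∃ k, mth k = .deq ∧ g k = g e := by
      by_contra! hno
      have := S.d_eq e he hno
      omega
    have hrk : r k = e := hreq e k he (Or.inl hk) hgk.symm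
    refine ⟨k, hk, hgk, lt_of_ρ k f ?_ (by rwa [hrk, hrfe])⟩
    have h4 := hT_front f hf
    have h5 := hde_le e' e he hlt
    have h6 := hde_mono e e' hlt.le
    have h7 := hal_mono e e' hlt.le
    rw [hT_deq k hk, hkind_front k (Or.inl hk), hkind_front f hf, hrk, hgk]
    rw [hrfe] at h4
    omega
  · intro o e ho he hlt
    have h1 : al e < 2 * q o - 1 := by
      by_contra! h
      refine absurd (lt_of_T o e ?_) hlt.not_gt
      rw [hT_empty o ho, hT_enq e he]
      simp only [hkind, ho, he]
      omega
    obtain ⟨hq1, hq2, hq3⟩ := hq o ho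
    -- If b(w) were not before the cut q, then lev w ≥ q would delay the enq of e to time 2q - 1,
    -- after o.
    have hbe : ∀ w, mth w = .enq → ρ w ≤ ρ e → d (g w) < q o := by
      intro w hw hwe
      refine hq3 w hw ?_
      by_contra! h
      have h2 := lev1 w o hw ho h
      have h3 : 2 * lev w - 1 ≤ al e := (le_max_right _ _).trans (hal_le e w hw hwe)
      omega
    have hde' := hbe e he le_rfl
    have h3 := S.rp_lt o
    obtain ⟨k, hk, hgk⟩ : ∃ k, mth k = .deq ∧ g k = g e := by
      by_contra! hno
      have := S.d_eq e he hno
      omega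
    have hrk : r k = e := hreq e k he (Or.inl hk) hgk.symm
    refine ⟨k, hk, hgk, lt_of_T k o ?_⟩
    have h4 : de e < 2 * q o - 1 := hde_lt e _ (by omega) fun w hw hwe => by
      have := hbe w hw hwe.le
      omega
    have h5 := hkind_le k
    rw [hT_empty o ho, hT_deq k hk, hrk, hgk]
    omega
  · intro o o' h
    apply lt_of_T
    have h1 := hhigh o
    have h2 := hlow o'
    have h3 := hkind_le o
    omega

end Summary


/-! ### Legal behaviours of the queue -/

section Spec

variable {V : Type v}

/-- The enqueued value. -/
def AbsOp.enqVal : AbsOp V → Option V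
  | .enq x => some x
  | _ => none

/-- The dequeued value. -/
def AbsOp.deqVal : AbsOp V → Option V
  | .deq x => some x
  | _ => none

theorem AbsOp.enqVal_eq_some {a : AbsOp V} {y : V} : a.enqVal = some y ↔ a = .enq y := by
  cases a <;> simp [AbsOp.enqVal]

theorem AbsOp.deqVal_eq_some {a : AbsOp V} {y : V} : a.deqVal = some y ↔ a = .deq y := by
  cases a <;> simp [AbsOp.deqVal]

theorem AbsOp.method_eq_enq {a : AbsOp V} : a.method = .enq ↔ ∃ y, a = .enq y := by
  cases a <;> simp [AbsOp.method]

theorem AbsOp.method_eq_deq {a : AbsOp V} : a.method = .deq ↔ ∃ y, a = .deq y := by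
  cases a <;> simp [AbsOp.method]

theorem AbsOp.method_eq_peek {a : AbsOp V} : a.method = .peek ↔ ∃ y, a = .peek y := by
  cases a <;> simp [AbsOp.method]

theorem AbsOp.method_eq_empty {a : AbsOp V} : a.method = .empty ↔ a = .empty := by
  cases a <;> simp [AbsOp.method]

theorem AbsOp.method_isFront {a : AbsOp V} :
    a.method.IsFront ↔ ∃ y, a = .deq y ∨ a = .peek y := by
  simp only [Method.IsFront, AbsOp.method_eq_deq, AbsOp.method_eq_peek, exists_or]

/-- The enqueued values, in order. -/
def enqVals (τ : List (AbsOp V)) : List V := τ.filterMap AbsOp.enqVal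

/-- The dequeued values, in order. -/
def deqVals (τ : List (AbsOp V)) : List V := τ.filterMap AbsOp.deqVal

theorem mem_enqVals {τ : List (AbsOp V)} {y : V} : y ∈ enqVals τ ↔ .enq y ∈ τ := by
  simp [enqVals, AbsOp.enqVal_eq_some]

theorem mem_deqVals {τ : List (AbsOp V)} {y : V} : y ∈ deqVals τ ↔ .deq y ∈ τ := by
  simp [deqVals, AbsOp.deqVal_eq_some]

/-- The operation `a` is possible after the operations `τ`. -/
def Enabled (τ : List (AbsOp V)) : AbsOp V → Prop
  | .enq _ => True
  | .deq y => ∃ R, enqVals τ = deqVals τ ++ y :: R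
  | .peek y => ∃ R, enqVals τ = deqVals τ ++ y :: R
  | .empty => enqVals τ = deqVals τ

theorem Run.snoc {s s' s'' : List V} {τ : List (AbsOp V)} {a : AbsOp V} (h : Run s τ s')
    (h' : Step s' a s'') : Run s (τ ++ [a]) s'' := by
  induction h with
  | nil s => exact .cons h' (.nil _)
  | cons k _ ih => exact .cons k (ih h')

theorem Run.of_snoc {s s'' : List V} {τ : List (AbsOp V)} {a : AbsOp V}
    (h : Run s (τ ++ [a]) s'') : ∃ s', Run s τ s' ∧ Step s' a s'' := by
  induction τ generalizing s with
  | nil =>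
    cases h with
    | cons k k' =>
      cases k'
      exact ⟨s, .nil _, k⟩
  | cons b τ ih =>
    cases h with
    | cons k k' =>
      obtain ⟨s', h1, h2⟩ := ih k'
      exact ⟨s', .cons k h1, h2⟩

/-- Dequeued values followed by the remaining ones, oldest first, are the enqueued values; states
list the newest value first, whence the reversal. -/
theorem Run.enqVals_eq {τ : List (AbsOp V)} {s : List V} (h : Run [] τ s) :
    enqVals τ = deqVals τ ++ s.reverse := by
  induction τ using List.reverseRecOn generalizing s with
  | nil =>
    cases h
    simp [enqVals, deqVals]
  | append_singleton τ a ih =>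
    obtain ⟨s', h1, h2⟩ := h.of_snoc
    have := ih h1
    simp only [enqVals, deqVals] at this
    clear ih
    cases h2 <;> simp_all [enqVals, deqVals, AbsOp.enqVal, AbsOp.deqVal, List.filterMap_cons]

/-- The state is determined by the enqueued and dequeued values, so legality can be checked one
operation at a time without naming states. -/
theorem snoc_mem_queueSpec {τ : List (AbsOp V)} {a : AbsOp V} :
    τ ++ [a] ∈ queueSpec V ↔ τ ∈ queueSpec V ∧ Enabled τ a := by
  constructor
  · rintro ⟨s, h⟩
    obtain ⟨s', h1, h2⟩ := h.of_snoc
    refine ⟨⟨s', h1⟩, ?_⟩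
    have := h1.enqVals_eq
    cases h2 <;> simp_all [Enabled]
  · rintro ⟨⟨s, h⟩, ha⟩
    have := h.enqVals_eq
    cases a with
    | enq y => exact ⟨_, h.snoc (.enq s y)⟩
    | deq y =>
      obtain ⟨R, hR⟩ := ha
      obtain rfl : s = R.reverse ++ [y] := by
        rw [this, List.append_cancel_left_eq, List.reverse_eq_iff] at hR
        simpa using hR
      exact ⟨_, h.snoc (.deq _ y)⟩
    | peek y =>
      obtain ⟨R, hR⟩ := ha
      obtain rfl : s = R.reverse ++ [y] := by
        rw [this, List.append_cancel_left_eq, List.reverse_eq_iff] at hR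
        simpa using hR
      exact ⟨_, h.snoc (.peek _ y)⟩
    | empty =>
      obtain rfl : s = [] := by
        simp only [Enabled] at ha
        rw [this] at ha
        simpa using ha
      exact ⟨_, h.snoc .empty⟩

theorem enabled_of_mem_queueSpec {τ τ' : List (AbsOp V)} {a : AbsOp V}
    (h : τ ++ a :: τ' ∈ queueSpec V) : Enabled τ a := by
  induction τ' using List.reverseRecOn with
  | nil => exact (snoc_mem_queueSpec.1 h).2
  | append_singleton τ' b ih =>
    rw [← List.cons_append, ← List.append_assoc, snoc_mem_queueSpec] at h
    exact ih h.1

end Spec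

/-! ### Linearizations and legal orders -/

theorem FifoOrder.comp_equiv {O O' γ α : Type*} [LinearOrder α] {mth : O → Method} {g : O → γ}
    {t : O → α} (h : FifoOrder mth g t) (x : O' ≃ O) :
    FifoOrder (mth ∘ x) (g ∘ x) (t ∘ x) where
  injective := h.injective.comp x.injective
  enq_lt e f he hf hef := h.enq_lt _ _ he hf hef
  peek_lt p d hp hd hpd := h.peek_lt _ _ hp hd hpd
  fifo e e' f he he' ht hf hfe := by
    obtain ⟨d, h1, h2, h3⟩ := h.fifo _ _ _ he he' ht hf hfe
    exact ⟨x.symm d, by simpa using h1, by simpa using h2, by simpa using h3⟩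
  empty o e ho he ht := by
    obtain ⟨d, h1, h2, h3⟩ := h.empty _ _ ho he ht
    exact ⟨x.symm d, by simpa using h1, by simpa using h2, by simpa using h3⟩

section Linearization

variable {P : Type u} {V : Type v} {H : History P V}

theorem History.Unambiguous.exists_enq (hH : H.Unambiguous) (o : H.ops) {y : V}
    (h : o.1.abs.val = some y) : ∃ e : H.ops, e.1.abs = .enq y := by
  obtain ⟨e, he, -⟩ := (hH y ⟨o, o.2, h⟩).1
  exact ⟨⟨e, he.1⟩, he.2⟩

theorem History.Unambiguous.enq_unique (hH : H.Unambiguous) {e e' : H.ops} {y : V}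
    (h : e.1.abs = .enq y) (h' : e'.1.abs = .enq y) : e = e' :=
  Subtype.ext ((hH y ⟨e, e.2, by simp [h, AbsOp.val]⟩).1.unique ⟨e.2, h⟩ ⟨e'.2, h'⟩)

theorem History.Unambiguous.deq_unique (hH : H.Unambiguous) {e e' : H.ops} {y : V}
    (h : e.1.abs = .deq y) (h' : e'.1.abs = .deq y) : e = e' :=
  Subtype.ext ((hH y ⟨e, e.2, by simp [h, AbsOp.val]⟩).2 _ e.2 _ e'.2 h h')

theorem History.Unambiguous.nodup_enqVals (hH : H.Unambiguous) {L : List H.ops} (hL : L.Nodup) :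
    (enqVals (L.map fun o => o.1.abs)).Nodup := by
  rw [enqVals, List.filterMap_map]
  refine hL.filterMap fun o o' y h h' => ?_
  simp only [Function.comp_apply, Option.mem_def, AbsOp.enqVal_eq_some] at h h'
  exact hH.enq_unique h h'

theorem mem_enqVals_map {L : List H.ops} {y : V} :
    y ∈ enqVals (L.map fun o => o.1.abs) ↔ ∃ o ∈ L, o.1.abs = .enq y := by
  simp only [mem_enqVals, List.mem_map]

theorem mem_deqVals_map {L : List H.ops} {y : V} :
    y ∈ deqVals (L.map fun o => o.1.abs) ↔ ∃ o ∈ L, o.1.abs = .deq y := by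
  simp only [mem_deqVals, List.mem_map]

theorem append_cons_inj_of_nodup {α : Type*} {l₁ l₂ m₁ m₂ : List α} {y : α}
    (hn : (l₁ ++ y :: l₂).Nodup) (h : l₁ ++ y :: l₂ = m₁ ++ y :: m₂) : l₁ = m₁ := by
  have h1 : y ∉ l₁ := fun hy => by simpa using List.disjoint_of_nodup_append hn hy
  have h2 : y ∉ l₂ := (List.nodup_cons.1 hn.of_append_right).1
  exact ((List.append_cons_inj_of_notMem h1 h2).1 h).1

variable {α : Type*} [LinearOrder α] {t : H.ops → α}

theorem mem_left_iff {L₁ L₂ : List H.ops} {o o' : H.ops} (hall : ∀ p, p ∈ L₁ ++ o :: L₂)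
    (hL : (L₁ ++ o :: L₂).Pairwise fun o o' => t o < t o') : o' ∈ L₁ ↔ t o' < t o := by
  rw [List.pairwise_append] at hL
  obtain ⟨-, h2, h3⟩ := hL
  refine ⟨fun h => h3 _ h _ (by simp), fun h => ?_⟩
  have := hall o'
  rw [List.mem_append, List.mem_cons] at this
  rcases this with this | rfl | this
  · exact this
  · exact absurd h (lt_irrefl _)
  · exact absurd h (lt_asymm ((List.pairwise_cons.1 h2).1 _ this))

/-- Linearizations are legal orders. -/
theorem History.Unambiguous.fifoOrder (hH : H.Unambiguous) {L : List H.ops}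
    (hall : ∀ o, o ∈ L) (hL : L.Pairwise fun o o' => t o < t o') (ht : Function.Injective t)
    (hspec : L.map (fun o => o.1.abs) ∈ queueSpec V) :
    FifoOrder (fun o : H.ops => o.1.abs.method) (fun o => o.1.abs.val) t := by
  have split : ∀ o, ∃ L₁ : List H.ops, (∀ o', o' ∈ L₁ ↔ t o' < t o) ∧ L₁.Nodup ∧
      L₁.Pairwise (fun o o' => t o < t o') ∧ Enabled (L₁.map fun o => o.1.abs) o.1.abs := by
    intro o
    obtain ⟨L₁, L₂, rfl⟩ := List.append_of_mem (hall o)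
    refine ⟨L₁, fun o' => mem_left_iff hall hL, ?_, (List.pairwise_append.1 hL).1, ?_⟩
    · exact (List.pairwise_append.1 hL).1.imp fun h h' => (h' ▸ h).false
    · rw [List.map_append, List.map_cons] at hspec
      exact enabled_of_mem_queueSpec hspec
  have front : ∀ (o : H.ops) (y : V), (o.1.abs = .deq y ∨ o.1.abs = .peek y) →
      ∀ L₁ : List H.ops, Enabled (L₁.map fun o => o.1.abs) o.1.abs →
      ∃ R, enqVals (L₁.map fun o => o.1.abs) = deqVals (L₁.map fun o => o.1.abs) ++ y :: R := by
    rintro o y (h | h) L₁ hE <;> rw [h] at hE <;> exact hE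
  have enq_lt : ∀ (e f : H.ops) (y : V), e.1.abs = .enq y →
      (f.1.abs = .deq y ∨ f.1.abs = .peek y) → t e < t f := by
    intro e f y he hf
    obtain ⟨L₁, hmem, hnd, -, hE⟩ := split f
    obtain ⟨R, hR⟩ := front f y hf L₁ hE
    obtain ⟨e', he', h⟩ := mem_enqVals_map.1
      (show y ∈ enqVals (L₁.map fun o => o.1.abs) by rw [hR]; simp)
    rw [hH.enq_unique he h]
    exact (hmem _).1 he'
  refine ⟨ht, ?_, ?_, ?_, ?_⟩
  · intro e f he hf hef
    obtain ⟨y, he⟩ := AbsOp.method_eq_enq.1 he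
    obtain ⟨z, hf⟩ := AbsOp.method_isFront.1 hf
    obtain rfl : y = z := by
      rcases hf with hf | hf <;> simpa [he, hf, AbsOp.val] using hef
    exact enq_lt e f y he hf
  · intro p d hp hd hpd
    obtain ⟨y, hp⟩ := AbsOp.method_eq_peek.1 hp
    obtain ⟨z, hd⟩ := AbsOp.method_eq_deq.1 hd
    obtain rfl : y = z := by simpa [hp, hd, AbsOp.val] using hpd
    by_contra! hlt
    have hne : t d ≠ t p := fun h => by
      rw [ht h, hp] at hd
      cases hd
    obtain ⟨L₁, hmem, hnd, -, hE⟩ := split p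
    obtain ⟨R, hR⟩ := front p y (Or.inr hp) L₁ hE
    have h1 : y ∈ deqVals (L₁.map fun o => o.1.abs) :=
      mem_deqVals_map.2 ⟨d, (hmem d).2 (lt_of_le_of_ne hlt hne), hd⟩
    -- The front value y would occur twice among the enqueued values, once as already dequeued.
    have h2 := hH.nodup_enqVals hnd
    rw [hR] at h2
    exact List.disjoint_of_nodup_append h2 h1 (by simp)
  · intro e e' f he he' hlt hf hfe
    obtain ⟨x, he⟩ := AbsOp.method_eq_enq.1 he
    obtain ⟨y, he'⟩ := AbsOp.method_eq_enq.1 he'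
    obtain ⟨z, hf⟩ := AbsOp.method_isFront.1 hf
    obtain rfl : z = y := by
      rcases hf with hf | hf <;> simpa [he', hf, AbsOp.val] using hfe
    obtain ⟨L₁, hmem, hnd, hpw, hE⟩ := split f
    obtain ⟨R, hR⟩ := front f z hf L₁ hE
    have hef := enq_lt e' f z he' hf
    obtain ⟨M₁, M₂, rfl⟩ := List.append_of_mem ((hmem e').2 hef)
    have h1 : e ∈ M₁ := by
      have := (hmem e).2 (hlt.trans hef)
      rw [List.mem_append, List.mem_cons] at this
      rcases this with this | rfl | this
      · exact this
      · exact absurd hlt (lt_irrefl _)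
      · have h2 := (List.pairwise_append.1 hpw).2.1
        exact absurd hlt (lt_asymm ((List.pairwise_cons.1 h2).1 _ this))
    have h2 := hH.nodup_enqVals hnd
    have h3 : enqVals ((M₁ ++ e' :: M₂).map fun o => o.1.abs) =
        enqVals (M₁.map fun o => o.1.abs) ++ z :: enqVals (M₂.map fun o => o.1.abs) := by
      simp [enqVals, he', AbsOp.enqVal]
    rw [h3] at h2 hR
    -- The enqueued values split at z in two ways. As z occurs once, the values enqueued before z
    -- are exactly those already dequeued.
    have h4 := append_cons_inj_of_nodup h2 hR
    obtain ⟨d, hd, hdx⟩ := mem_deqVals_map.1 (h4 ▸ mem_enqVals_map.2 ⟨e, h1, he⟩)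
    exact ⟨d, AbsOp.method_eq_deq.2 ⟨x, hdx⟩, by simp [he, hdx, AbsOp.val], (hmem d).1 hd⟩
  · intro o e ho he hlt
    obtain ⟨x, he⟩ := AbsOp.method_eq_enq.1 he
    obtain ⟨L₁, hmem, hnd, -, hE⟩ := split o
    rw [AbsOp.method_eq_empty.1 ho] at hE
    have hE : enqVals _ = deqVals _ := hE
    obtain ⟨d, hd, hdx⟩ := mem_deqVals_map.1
      (hE ▸ mem_enqVals_map.2 ⟨e, (hmem e).2 hlt, he⟩)
    exact ⟨d, AbsOp.method_eq_deq.2 ⟨x, hdx⟩, by simp [he, hdx, AbsOp.val], (hmem d).1 hd⟩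

/-- Legal orders induce legal behaviours. -/
theorem FifoOrder.mem_queueSpec (hH : H.Unambiguous)
    (h : FifoOrder (fun o : H.ops => o.1.abs.method) (fun o => o.1.abs.val) t) {L : List H.ops}
    (hall : ∀ o, o ∈ L) (hL : L.Pairwise fun o o' => t o < t o') :
    L.map (fun o => o.1.abs) ∈ queueSpec V := by
  suffices ∀ L₁ L₂, L = L₁ ++ L₂ → L₁.map (fun o => o.1.abs) ∈ queueSpec V from
    this L [] (by simp)
  intro L₁
  induction L₁ using List.reverseRecOn with
  | nil => exact fun _ _ => ⟨[], .nil _⟩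
  | append_singleton L₁ o ih =>
    intro L₂ hLL
    have hLL : L = L₁ ++ o :: L₂ := by simpa using hLL
    have hspec := ih _ hLL
    subst hLL
    have hmem : ∀ {o'}, o' ∈ L₁ ↔ t o' < t o := mem_left_iff hall hL
    have hpw := (List.pairwise_append.1 hL).1
    have hnd : L₁.Nodup := hpw.imp fun h h' => (h' ▸ h).false
    obtain ⟨R, hR⟩ : ∃ R, enqVals (L₁.map fun o => o.1.abs) =
        deqVals (L₁.map fun o => o.1.abs) ++ R := by
      obtain ⟨s, hs⟩ := hspec
      exact ⟨_, hs.enqVals_eq⟩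
    have hnd' := hH.nodup_enqVals hnd
    rw [List.map_append, List.map_singleton, snoc_mem_queueSpec]
    refine ⟨hspec, ?_⟩
    -- The oldest remaining value has not been dequeued, since the enqueued values have no
    -- repetition.
    have hfirst : ∀ z R', R = z :: R' → ∀ d : H.ops, d.1.abs = .deq z → ¬ t d < t o := by
      rintro z R' rfl d hd hlt
      rw [hR] at hnd'
      exact List.disjoint_of_nodup_append hnd' (mem_deqVals_map.2 ⟨d, hmem.2 hlt, hd⟩) (by simp)
    have hdeq : ∀ (e d : H.ops) (z : V), e.1.abs = .enq z → d.1.abs.method = .deq →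
        d.1.abs.val = e.1.abs.val → d.1.abs = .deq z := by
      intro e d z he hd hg
      obtain ⟨y, hd⟩ := AbsOp.method_eq_deq.1 hd
      rw [hd, he] at hg
      simp only [AbsOp.val, Option.some.injEq] at hg
      rw [hd, hg]
    have hfront : ∀ y, (o.1.abs = .deq y ∨ o.1.abs = .peek y) →
        ∃ R, enqVals (L₁.map fun o => o.1.abs) = deqVals (L₁.map fun o => o.1.abs) ++ y :: R := by
      intro y ho
      have hoF : o.1.abs.method.IsFront := AbsOp.method_isFront.2 ⟨y, ho⟩
      have hval : o.1.abs.val = some y := by rcases ho with ho | ho <;> simp [ho, AbsOp.val]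
      obtain ⟨e, he⟩ := hH.exists_enq o hval
      have hem : e.1.abs.method = .enq := AbsOp.method_eq_enq.2 ⟨y, he⟩
      have hev : e.1.abs.val = some y := by simp [he, AbsOp.val]
      have hlt := h.enq_lt e o hem hoF (hev.trans hval.symm)
      have hy : y ∈ enqVals (L₁.map fun o => o.1.abs) := mem_enqVals_map.2 ⟨e, hmem.2 hlt, he⟩
      have hyd : y ∉ deqVals (L₁.map fun o => o.1.abs) := by
        intro hy
        obtain ⟨d, hd, hdy⟩ := mem_deqVals_map.1 hy
        have hdo := hmem.1 hd
        rcases ho with ho | ho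
        · rw [hH.deq_unique hdy ho] at hdo
          exact lt_irrefl _ hdo
        · exact absurd hdo (lt_asymm (h.peek_lt o d (AbsOp.method_eq_peek.2 ⟨y, ho⟩)
            (AbsOp.method_eq_deq.2 ⟨y, hdy⟩) (by simp [ho, hdy, AbsOp.val])))
      rw [hR, List.mem_append, or_iff_right hyd] at hy
      obtain ⟨R₁, R₂, rfl⟩ := List.append_of_mem hy
      cases R₁ with
      | nil => exact ⟨R₂, hR⟩
      -- A value z ahead of y was enqueued before y, so `fifo` would have it dequeued before o.
      | cons z R₁ =>
        exfalso
        obtain ⟨M₁, M₂, rfl⟩ := List.append_of_mem (hmem.2 hlt)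
        have h3 : enqVals ((M₁ ++ e :: M₂).map fun o => o.1.abs) =
            enqVals (M₁.map fun o => o.1.abs) ++ y :: enqVals (M₂.map fun o => o.1.abs) := by
          simp [enqVals, he, AbsOp.enqVal]
        have h4 := append_cons_inj_of_nodup (h3 ▸ hnd') (h3.symm.trans (hR.trans
          (List.append_assoc _ _ _).symm))
        obtain ⟨e', he', hez⟩ := mem_enqVals_map.1
          (show z ∈ enqVals (M₁.map fun o => o.1.abs) by rw [h4]; simp)
        have hlt' : t e' < t e := (List.pairwise_append.1 hpw).2.2 _ he' _ (by simp)
        obtain ⟨d, hd, hdz, hdo⟩ := h.fifo e' e o (AbsOp.method_eq_enq.2 ⟨z, hez⟩) hem hlt' hoF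
          (hval.trans hev.symm)
        exact hfirst z _ rfl d (hdeq e' d z hez hd hdz) hdo
    cases ho : o.1.abs with
    | enq y => trivial
    | deq y => exact hfront y (Or.inl ho)
    | peek y => exact hfront y (Or.inr ho)
    | empty =>
      cases R with
      | nil => simpa [Enabled] using hR
      | cons z R =>
        exfalso
        obtain ⟨e, he, hez⟩ := mem_enqVals_map.1
          (show z ∈ enqVals (L₁.map fun o => o.1.abs) by rw [hR]; simp)
        obtain ⟨d, hd, hdz, hdo⟩ := h.empty o e (AbsOp.method_eq_empty.2 ho)
          (AbsOp.method_eq_enq.2 ⟨z, hez⟩) (hmem.1 he)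
        exact hfirst z _ rfl d (hdeq e d z hez hd hdz) hdo

theorem exists_between_list (m : NNRat) (L : List NNRat) (h : ∀ r ∈ L, m < r) :
    ∃ s, m < s ∧ ∀ r ∈ L, s < r := by
  induction L with
  | nil => exact ⟨m + 1, by simp, by simp⟩
  | cons r L ih =>
    obtain ⟨s, hs, hL⟩ := ih fun r' hr' => h r' (by simp [hr'])
    obtain ⟨s', h1, h2⟩ := exists_between (lt_min hs (h r (by simp)))
    refine ⟨s', h1, fun r' hr' => ?_⟩
    rcases List.mem_cons.1 hr' with rfl | hr'
    · exact h2.trans_le (min_le_right _ _)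
    · exact (h2.trans_le (min_le_left _ _)).trans (hL r' hr')

/-- Timestamps for operations that are listed in a possible order. -/
theorem exists_timestamps {O : Type*} (i r : O → NNRat) (hir : ∀ o, i o < r o) (L : List O)
    (hL : L.Pairwise fun o o' => o ≠ o' ∧ i o < r o') (m : NNRat) (hm : ∀ o ∈ L, m < r o) :
    ∃ l : O → NNRat, (∀ o ∈ L, m < l o ∧ i o < l o ∧ l o < r o) ∧
      L.Pairwise fun o o' => l o < l o' := by
  classical
  induction L generalizing m with
  | nil => exact ⟨fun _ => 0, by simp, by simp⟩
  | cons o L ih =>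
    rw [List.pairwise_cons] at hL
    -- The first operation is placed after m and its own invocation, but before every response still
    -- to come. The rest of the list is then placed after s.
    obtain ⟨s, hs, hsr⟩ := exists_between_list (max m (i o)) ((o :: L).map r) (by
      intro q hq
      obtain ⟨o', ho', rfl⟩ := List.mem_map.1 hq
      refine max_lt (hm o' ho') ?_
      rcases List.mem_cons.1 ho' with rfl | ho'
      · exact hir _
      · exact (hL.1 o' ho').2)
    have hsr : ∀ o' ∈ o :: L, s < r o' := fun o' ho' => hsr _ (List.mem_map_of_mem ho')
    obtain ⟨l, hl, hlp⟩ := ih hL.2 s fun o' ho' => hsr o' (by simp [ho'])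
    have hne : ∀ o' ∈ L, Function.update l o s o' = l o' := fun o' ho' =>
      Function.update_of_ne (hL.1 o' ho').1.symm _ _
    refine ⟨Function.update l o s, fun o' ho' => ?_, List.pairwise_cons.2 ⟨?_, ?_⟩⟩
    · rcases List.mem_cons.1 ho' with rfl | ho'
      · rw [Function.update_self]
        exact ⟨(le_max_left _ _).trans_lt hs, (le_max_right _ _).trans_lt hs, hsr _ (by simp)⟩
      · rw [hne o' ho']
        exact ⟨((le_max_left _ _).trans_lt hs).trans (hl o' ho').1, (hl o' ho').2⟩
    · intro o' ho'
      rw [hne o' ho', Function.update_self]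
      exact (hl o' ho').1
    · refine List.Pairwise.imp_of_mem ?_ hlp
      intro o₁ o₂ h1 h2 hlt
      rwa [hne _ h1, hne _ h2]

/-- The weak inequality is correct since timestamps lie strictly inside the intervals: operations
that merely touch in time are ordered. -/
theorem History.Linearizable.exists_fifoOrder (hH : H.Unambiguous) (h : H.Linearizable) :
    ∃ t : H.ops → NNRat, FifoOrder (fun o : H.ops => o.1.abs.method) (fun o => o.1.abs.val) t ∧
      ∀ o o' : H.ops, o.1.res ≤ o'.1.inv → t o < t o' := by
  obtain ⟨l, hl, τ, ⟨L, hall, hL, rfl⟩, hspec⟩ := h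
  exact ⟨l, hH.fifoOrder hall hL hl.injective hspec, fun o o' h =>
    (hl.lt_res o).trans (h.trans_lt (hl.inv_lt o'))⟩

theorem FifoOrder.linearizable (hH : H.Unambiguous)
    (h : FifoOrder (fun o : H.ops => o.1.abs.method) (fun o => o.1.abs.val) t)
    (ht : ∀ o o' : H.ops, o.1.res ≤ o'.1.inv → t o < t o') : H.Linearizable := by
  classical
  obtain ⟨L, hall, hL⟩ : ∃ L : List H.ops, (∀ o, o ∈ L) ∧ L.Pairwise fun o o' => t o < t o' := by
    let _ : LinearOrder H.ops := LinearOrder.lift' t h.injective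
    exact ⟨Finset.univ.sort (· ≤ ·), fun o => by simp, (Finset.sortedLT_sort _).pairwise⟩
  obtain ⟨l, hl, hlp⟩ := exists_timestamps (fun o : H.ops => o.1.inv) (fun o => o.1.res)
    (fun o => o.1.inv_lt_res) L
    (hL.imp fun {o o'} hlt => ⟨fun h => (h ▸ hlt).false, by
      by_contra! hle
      exact absurd hlt (lt_asymm (ht _ _ hle))⟩)
    0 fun o _ => zero_le.trans_lt o.1.inv_lt_res
  refine ⟨l, ⟨?_, fun o => (hl o (hall o)).2.1, fun o => (hl o (hall o)).2.2⟩, _,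
    ⟨L, hall, hlp, rfl⟩, h.mem_queueSpec hH hall hL⟩
  have hlt : ∀ o o', l o' < l o ↔ t o' < t o := by
    intro o o'
    obtain ⟨L₁, L₂, rfl⟩ := List.append_of_mem (hall o)
    rw [← mem_left_iff hall hL, ← mem_left_iff hall hlp]
  intro o o' heq
  refine h.injective (le_antisymm ?_ ?_)
  · exact not_lt.1 fun h => ((hlt o o').2 h).ne heq.symm
  · exact not_lt.1 fun h => ((hlt o' o).2 h).ne heq

end Linearization

/-! ### The monitoring program -/

/-- Disjunction of tests. -/
def Test.disj (b c : Test) : Test := .neg (.conj (.neg b) (.neg c))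

/-- The test whether the endpoint `e` is before the endpoint `f`; here `k` stands for the
invocation of the operation `k`, and `n + k` for its response. -/
def timeTest (e f : Expr) : Test :=
  .disj
    (.conj (.lt e .numOps) (.disj (.timeLt .inv e .inv f)
      (.conj (.neg (.lt f .numOps)) (.timeLt .inv e .res (.sub f .numOps)))))
    (.conj (.neg (.lt e .numOps)) (.disj
      (.conj (.neg (.lt f .numOps)) (.timeLt .res (.sub e .numOps) .res (.sub f .numOps)))
      (.conj (.lt f .numOps) (.neg (.timeLt .inv f .res (.sub e .numOps))))))

/-- The test whether the value of the operation `e` is smaller than that of `f`, where the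
operations `empty` come first. -/
def valTest (e f : Expr) : Test :=
  .disj (.conj (.hasMethod .empty e) (.neg (.hasMethod .empty f))) (.valLt e f)

/-- The maximum of the values `w i` of the operations `i` that satisfy `p` and are sent to `j`. -/
noncomputable def opMax {n : ℕ} (p : Fin n → Prop) (ix w : ℕ → ℕ) : ℕ → ℕ :=
  scatterMax n (fun k => ∃ i : Fin n, (i : ℕ) = k ∧ p i) ix w

theorem lt_opMax {n : ℕ} {p : Fin n → Prop} {ix w : ℕ → ℕ} {j m : ℕ} :
    m < opMax p ix w j ↔ ∃ i : Fin n, p i ∧ ix i = j ∧ m < w i := by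
  simp only [opMax, lt_scatterMax]
  constructor
  · rintro ⟨k, hk, ⟨i, rfl, hp⟩, h1, h2⟩
    exact ⟨i, hp, h1, h2⟩
  · rintro ⟨i, hp, h1, h2⟩
    exact ⟨i, i.2, ⟨i, rfl, hp⟩, h1, h2⟩

theorem le_opMax {n : ℕ} {p : Fin n → Prop} {ix w : ℕ → ℕ} {i : Fin n} (hp : p i) :
    w i ≤ opMax p ix w (ix i) := by
  by_contra! h
  exact lt_irrefl _ (lt_opMax.2 ⟨i, hp, rfl, h⟩)

theorem exists_opMax {n : ℕ} {p : Fin n → Prop} {ix w : ℕ → ℕ} {j : ℕ} :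
    opMax p ix w j = 0 ∨ ∃ i : Fin n, p i ∧ ix i = j ∧ w i = opMax p ix w j := by
  rcases Nat.eq_zero_or_pos (opMax p ix w j) with h | h
  · exact Or.inl h
  · obtain ⟨i, h1, h2, h3⟩ := lt_opMax.1 (show opMax p ix w j - 1 < opMax p ix w j by omega)
    have := le_opMax (ix := ix) (w := w) h1
    rw [h2] at this
    exact Or.inr ⟨i, h1, h2, by omega⟩

/-! ### Keys of endpoints and of operations -/

section

variable {P : Type u} {V : Type v} {n : ℕ} (x : Fin n → Operation P V)

/-- Absent values come first. -/
def optionKey : Option V → WithBot V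
  | none => ⊥
  | some y => y

theorem optionKey_inj {a b : Option V} : optionKey a = optionKey b ↔ a = b := by
  cases a <;> cases b <;> simp [optionKey]

/-- The time of an endpoint; at equal times, responses come before invocations. -/
noncomputable def timeKey (u : ℕ) : NNRat ×ₗ ℕ :=
  if h : u < n then toLex ((x ⟨u, h⟩).inv, 1)
  else if h : u - n < n then toLex ((x ⟨u - n, h⟩).res, 0) else toLex (0, 0)

/-- The value of an operation; the operations `empty` come first. -/
noncomputable def valKey (o : ℕ) : WithBot V :=
  if h : o < n then optionKey (x ⟨o, h⟩).abs.val else ⊥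

theorem timeKey_inv (i : Fin n) : timeKey x i = toLex ((x i).inv, 1) := by
  simp [timeKey]

theorem timeKey_res (i : Fin n) : timeKey x (n + i) = toLex ((x i).res, 0) := by
  simp [timeKey]

theorem valKey_val (i : Fin n) : valKey x i = optionKey (x i).abs.val := by
  simp [valKey]

theorem AbsOp.method_eq_empty_iff_val {a : AbsOp V} : a.method = .empty ↔ a.val = none := by
  cases a <;> simp [AbsOp.method, AbsOp.val]

end

section

variable {P : Type u} {V : Type v} [LinearOrder V] {n : ℕ} {x : Fin n → Operation P V}

@[simp]
theorem Test.holds_disj {σ : Store} {b c : Test} :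
    (Test.disj b c).Holds x σ ↔ b.Holds x σ ∨ c.Holds x σ := by
  simp only [Test.disj, Test.Holds]
  tauto

theorem Transforms.op {A : ℕ} {ix w : Expr} {G : Test} {p : Fin n → Prop}
    {ix' w' : ℕ → ℕ} {l : List (ℕ → ℕ)} (hA : A = l.length + 1)
    (hG : ∀ (i : Fin n) (σ : Store), σ.Shows l i → (G.Holds x σ ↔ p i))
    (hix : ∀ (i : Fin n) (σ : Store), σ.Shows l i → ix.eval n σ = ix' i)
    (hw : ∀ (i : Fin n) (σ : Store), σ.Shows l i → w.eval n σ = w' i) :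
    Transforms x (scatterLoop A .numOps G ix w) l (l ++ [opMax p ix' w']) :=
  .scatter hA (by omega) (fun _ => rfl)
    (fun k hk σ hσ => by
      obtain ⟨i, rfl⟩ : ∃ i : Fin n, (i : ℕ) = k := ⟨⟨k, hk⟩, rfl⟩
      simp [hG i σ hσ, Fin.val_inj])
    (fun k hk _ σ hσ => hix ⟨k, hk⟩ σ hσ) (fun k hk _ σ hσ => hw ⟨k, hk⟩ σ hσ)

theorem Transforms.op_append {A : ℕ} {ix w : Expr} {G : Test} {p : Fin n → Prop}
    {ix' w' : ℕ → ℕ} {l : List (ℕ → ℕ)} {f : ℕ → ℕ} (hA : A = l.length + 1)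
    (hG : ∀ (i : Fin n) (σ : Store), σ.Shows l i → (G.Holds x σ ↔ p i))
    (hix : ∀ (i : Fin n) (σ : Store), σ.Shows l i → ix.eval n σ = ix' i)
    (hw : ∀ (i : Fin n) (σ : Store), σ.Shows l i → w.eval n σ = w' i) :
    Transforms x (scatterLoop A .numOps G ix w) (l ++ [f]) (l ++ [f ⊔ opMax p ix' w']) :=
  .scatter_append hA (by omega) (fun _ => rfl)
    (fun k hk σ hσ => by
      obtain ⟨i, rfl⟩ : ∃ i : Fin n, (i : ℕ) = k := ⟨⟨k, hk⟩, rfl⟩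
      simp [hG i σ hσ, Fin.val_inj])
    (fun k hk _ σ hσ => hix ⟨k, hk⟩ σ hσ) (fun k hk _ σ hσ => hw ⟨k, hk⟩ σ hσ)

/-! ### Sorting the endpoints and the operations -/

variable (x)

theorem holds_valTest {e f : Expr} {σ : Store} (he : e.eval n σ < n) (hf : f.eval n σ < n) :
    (valTest e f).Holds x σ ↔ valKey x (e.eval n σ) < valKey x (f.eval n σ) := by
  obtain ⟨i, hi⟩ : ∃ i : Fin n, (i : ℕ) = e.eval n σ := ⟨⟨_, he⟩, rfl⟩
  obtain ⟨j, hj⟩ : ∃ j : Fin n, (j : ℕ) = f.eval n σ := ⟨⟨_, hf⟩, rfl⟩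
  simp only [valTest, Test.holds_disj, Test.Holds, ← hi, ← hj, Fin.val_inj, exists_eq_left,
    valKey_val, AbsOp.method_eq_empty_iff_val]
  cases hi' : (x i).abs.val <;> cases hj' : (x j).abs.val <;> simp [optionKey, hi', hj']

/-- At equal times only a response against an invocation counts as earlier; that case is tested as
the negation of a strict comparison. -/
theorem holds_timeTest {e f : Expr} {σ : Store} (he : e.eval n σ < n + n)
    (hf : f.eval n σ < n + n) :
    (timeTest e f).Holds x σ ↔ timeKey x (e.eval n σ) < timeKey x (f.eval n σ) := by
  have endpoint : ∀ u < n + n, (∃ i : Fin n, u = i) ∨ ∃ i : Fin n, u = n + i := by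
    intro u hu
    by_cases h : u < n
    · exact Or.inl ⟨⟨u, h⟩, rfl⟩
    · exact Or.inr ⟨⟨u - n, by omega⟩, by simp; omega⟩
  simp only [timeTest, Test.holds_disj, Test.Holds, Expr.eval]
  rcases endpoint _ he with ⟨i, hi⟩ | ⟨i, hi⟩ <;> rcases endpoint _ hf with ⟨j, hj⟩ | ⟨j, hj⟩ <;>
    simp only [hi, hj, timeKey_inv, timeKey_res, Prod.Lex.toLex_lt_toLex, Operation.time]
  · simp [Fin.val_inj]
  · simp [Fin.val_inj]
    intro a ha
    omega
  · simp [Fin.val_inj, le_iff_lt_or_eq]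
  · simp [Fin.val_inj]

end

/-! ### Positions and group numbers from a sorted listing -/

theorem IsListing.injOn {N : ℕ} {f : ℕ → ℕ} (h : IsListing N f) {m m' : ℕ} (hm : m < N)
    (hm' : m' < N) (heq : f m = f m') : m = m' := by
  have hsurj : Function.Surjective fun k : Fin N => (⟨f k, h.1 k k.2⟩ : Fin N) := fun v => by
    obtain ⟨m, hm, hv⟩ := h.2 v v.2
    exact ⟨⟨m, hm⟩, Fin.ext hv⟩
  have := Finite.injective_iff_surjective.2 hsurj (a₁ := ⟨m, hm⟩) (a₂ := ⟨m', hm'⟩)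
    (Fin.ext heq)
  exact congrArg Fin.val this

/-- The inverse of a listing. -/
noncomputable def position (N : ℕ) (f : ℕ → ℕ) : ℕ → ℕ := scatterMax N (fun _ => True) f id

theorem IsListing.scatter {N : ℕ} {f : ℕ → ℕ} (h : IsListing N f) (w : ℕ → ℕ) {m : ℕ}
    (hm : m < N) : scatterMax N (fun _ => True) f w (f m) = w m := by
  refine le_antisymm (scatterMax_le fun k hk _ he => ?_) (le_scatterMax hm trivial)
  rw [h.injOn hk hm he]

section Positions

variable {α : Type*} [LinearOrder α] {key : ℕ → α} {N : ℕ} {f : ℕ → ℕ}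

theorem IsListing.position_lt (h : IsListing N f) {u : ℕ} (hu : u < N) : position N f u < N := by
  obtain ⟨m, hm, rfl⟩ := h.2 u hu
  rw [position, h.scatter _ hm]
  exact hm

theorem IsListing.position_inj (h : IsListing N f) {u v : ℕ} (hu : u < N) (hv : v < N)
    (heq : position N f u = position N f v) : u = v := by
  obtain ⟨m, hm, rfl⟩ := h.2 u hu
  obtain ⟨m', hm', rfl⟩ := h.2 v hv
  rw [position, h.scatter _ hm, h.scatter _ hm'] at heq
  exact congrArg f heq

theorem IsListing.position_lt_position (h : IsListing N f)
    (hs : ∀ m m', m < m' → m' < N → key (f m) ≤ key (f m')) {u v : ℕ} (hu : u < N) (hv : v < N)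
    (hlt : key u < key v) : position N f u < position N f v := by
  obtain ⟨m, hm, rfl⟩ := h.2 u hu
  obtain ⟨m', hm', rfl⟩ := h.2 v hv
  rw [position, h.scatter _ hm, h.scatter _ hm']
  rcases lt_trichotomy m m' with h' | rfl | h'
  · exact h'
  · exact absurd hlt (lt_irrefl _)
  · exact absurd hlt (hs _ _ h' hm).not_gt

/-- The number of the group of `u`, among the groups with equal keys. -/
noncomputable def groupId (key : ℕ → α) (N : ℕ) (f : ℕ → ℕ) : ℕ → ℕ :=
  scatterMax N (fun _ => True) f fun k =>
    prefixMax N (scatterMax N (fun k => key (f (k - 1)) < key (f k)) id id) (k + 1)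

/-- The number of a group is the place of the last strict increase of the key, which the prefix
maximum carries forward. The place 0 is compared with itself and never counts as an increase. -/
theorem IsListing.groupId_eq_iff (h : IsListing N f)
    (hs : ∀ m m', m < m' → m' < N → key (f m) ≤ key (f m')) {u v : ℕ} (hu : u < N) (hv : v < N) :
    groupId key N f u = groupId key N f v ↔ key u = key v := by
  set B := scatterMax N (fun k => key (f (k - 1)) < key (f k)) id id with hB
  have hBlt : ∀ m j, m < B j ↔ j < N ∧ key (f (j - 1)) < key (f j) ∧ m < j := by
    intro m j
    rw [hB, lt_scatterMax]
    constructor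
    · rintro ⟨k, hk, h1, rfl, h2⟩
      exact ⟨hk, h1, h2⟩
    · rintro ⟨hj, h1, h2⟩
      exact ⟨j, hj, h1, rfl, h2⟩
  have hR : ∀ m k, k < N → (m < prefixMax N B (k + 1) ↔
      ∃ j ≤ k, key (f (j - 1)) < key (f j) ∧ m < j) := by
    intro m k hk
    rw [lt_prefixMax (by omega)]
    constructor
    · rintro ⟨j, hj, h1⟩
      rw [hBlt] at h1
      exact ⟨j, by omega, h1.2⟩
    · rintro ⟨j, hj, h1⟩
      exact ⟨j, by omega, (hBlt _ _).2 ⟨by omega, h1⟩⟩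
  have main : ∀ m m', m ≤ m' → m' < N →
      (prefixMax N B (m + 1) = prefixMax N B (m' + 1) ↔ key (f m) = key (f m')) := by
    intro m m' hmm hm'
    have hle : ∀ i j, i ≤ j → j < N → key (f i) ≤ key (f j) := by
      intro i j hij hj
      rcases hij.eq_or_lt with rfl | hij
      · exact le_rfl
      · exact hs i j hij hj
    constructor
    · intro heq
      by_contra hne
      obtain ⟨j, hj1, hj2, hj3⟩ : ∃ j, m < j ∧ j ≤ m' ∧ key (f (j - 1)) < key (f j) := by
        by_contra! hno
        apply hne
        have : ∀ d, m + d ≤ m' → key (f m) = key (f (m + d)) := by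
          intro d
          induction d with
          | zero => simp
          | succ d ih =>
            intro hd
            rw [ih (by omega)]
            exact le_antisymm (hle _ _ (by omega) (by omega))
              (by simpa using hno (m + (d + 1)) (by omega) hd)
        simpa [Nat.add_sub_cancel' hmm] using this (m' - m) (by omega)
      have h1 : m < prefixMax N B (m' + 1) := (hR m m' hm').2 ⟨j, hj2, hj3, hj1⟩
      rw [← heq, hR m m (by omega)] at h1
      obtain ⟨j', hj', -, h2⟩ := h1
      omega
    · intro heq
      refine eq_of_forall_lt_iff fun c => ?_
      rw [hR c m (by omega), hR c m' hm']
      constructor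
      · rintro ⟨j, hj, h1⟩
        exact ⟨j, by omega, h1⟩
      · rintro ⟨j, hj, h1, h2⟩
        by_cases hjm : j ≤ m
        · exact ⟨j, hjm, h1, h2⟩
        · have h3 := hle m (j - 1) (by omega) (by omega)
          have h4 := hle j m' hj hm'
          exact absurd (h3.trans_lt (h1.trans_le h4)) heq.not_lt
  obtain ⟨m, hm, rfl⟩ := h.2 u hu
  obtain ⟨m', hm', rfl⟩ := h.2 v hv
  rw [groupId, h.scatter _ hm, h.scatter _ hm']
  rcases le_total m m' with hmm | hmm
  · exact main m m' hmm hm'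
  · rw [eq_comm, main m' m hmm hm, eq_comm]

end Positions


/-! ### The analysis of the positions -/

section

variable {P : Type u} {V : Type v} {n : ℕ} (x : Fin n → Operation P V) (pos g : ℕ → ℕ)

/-- The first response of a `deq` or `peek`, subtracted from `2 n`. -/
noncomputable def frontRes : ℕ → ℕ :=
  opMax (fun i => (x i).abs.method.IsFront) g fun o => n + n - pos (n + o)

/-- The first response of an operation, subtracted from `2 n`. -/
noncomputable def firstRes : ℕ → ℕ :=
  opMax (fun i => (x i).abs.method ≠ .empty) g fun o => n + n - pos (n + o)

/-- The response of the `deq`, subtracted from `2 n`. -/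
noncomputable def deqRes : ℕ → ℕ :=
  opMax (fun i => (x i).abs.method = .deq) g fun o => n + n - pos (n + o)

/-- The last invocation of a `peek`. -/
noncomputable def peekInv : ℕ → ℕ :=
  opMax (fun i => (x i).abs.method = .peek) g pos

/-- The last invocation of an operation, or `2 n` if there is no `deq`. -/
noncomputable def lastInv : ℕ → ℕ :=
  opMax (fun i => (x i).abs.method ≠ .empty) g pos ⊔
    opMax (fun i => (x i).abs.method = .enq ∧ deqRes x pos g (g i) < 1) g fun _ => n + n

/-- The last invocation over all values whose front operations start to respond before `q`. -/
noncomputable def frontReach : ℕ → ℕ :=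
  prefixMax (n + n + 1) (opMax (fun i => (x i).abs.method = .enq)
    (fun o => n + n - frontRes x pos g (g o)) fun o => lastInv x pos g (g o))

/-- The last invocation over all values that have to leave the queue before a value whose
operations start to respond before `q`. -/
noncomputable def enqReach : ℕ → ℕ :=
  prefixMax (n + n + 1) (opMax (fun i => (x i).abs.method = .enq)
    (fun o => n + n - firstRes x pos g (g o)) fun o =>
      max (lastInv x pos g (g o)) (frontReach x pos g (lastInv x pos g (g o))))

/-- The last invocation over all values whose operations start to respond before `q`. -/
noncomputable def cover : ℕ → ℕ :=
  prefixMax (n + n + 1) (opMax (fun i => (x i).abs.method = .enq)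
    (fun o => n + n - firstRes x pos g (g o)) fun o => lastInv x pos g (g o))

/-- The last gap before `q` in which the queue may be empty. -/
noncomputable def lastGap : ℕ → ℕ :=
  prefixMax (n + n) (scatterMax (n + n) (fun q => cover x pos g q < q) id id)

/-- A violation that is detected at an operation `enq`. -/
def EnqViolation (i : Fin n) : Prop :=
  (x i).abs.method = .enq ∧ (¬ pos i < n + n - firstRes x pos g (g i) ∨
    n + n - deqRes x pos g (g i) < peekInv x pos g (g i) ∨
    n + n - frontRes x pos g (g i) < frontReach x pos g
      (min (lastInv x pos g (g i)) (n + n - frontRes x pos g (g i))) ∨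
    n + n - frontRes x pos g (g i) < enqReach x pos g (pos i))

/-- A violation that is detected at an operation `empty`. -/
def EmptyViolation (i : Fin n) : Prop :=
  (x i).abs.method = .empty ∧ ¬ pos i < lastGap x pos g (pos (n + i) + 1)

/-- The cell `0` is positive if there is a violation. -/
noncomputable def violations : ℕ → ℕ :=
  opMax (EnqViolation x pos g) (fun _ => 0) (fun _ => 1) ⊔
    opMax (EmptyViolation x pos g) (fun _ => 0) (fun _ => 1)

/-- The numbers `pos` are positions of endpoints, and the numbers `g` stand for values. -/
structure IsIndexing : Prop where
  pos_lt : ∀ u < n + n, pos u < n + n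
  pos_inj : ∀ u < n + n, ∀ v < n + n, pos u = pos v → u = v
  inv_lt_res : ∀ i : Fin n, pos i < pos (n + i)
  exists_enq : ∀ i : Fin n, (x i).abs.method ≠ .empty →
    ∃ e : Fin n, (x e).abs.method = .enq ∧ g e = g i
  enq_unique : ∀ i j : Fin n, (x i).abs.method = .enq → (x j).abs.method = .enq → g i = g j →
    i = j
  deq_unique : ∀ i j : Fin n, (x i).abs.method = .deq → (x j).abs.method = .deq → g i = g j →
    i = j

variable {x pos g}

namespace IsIndexing

theorem res_lt (h : IsIndexing x pos g) (i : Fin n) : pos (n + i) < n + n :=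
  h.pos_lt _ (by omega)

/-- Subtraction from 2n turns maxima into minima, and the default 0 of an empty maximum into 2n,
which serves as infinity. -/
theorem summary (h : IsIndexing x pos g) :
    Summary (n + n) (fun i => (x i).abs.method) (fun i : Fin n => g i) (fun i : Fin n => pos i)
      (fun i : Fin n => pos (n + i)) (opMax (fun i => (x i).abs.method = .enq) g pos)
      (fun v => n + n - firstRes x pos g v) (fun v => n + n - frontRes x pos g v)
      (lastInv x pos g) where
  ip_lt_rp := h.inv_lt_res
  ne o o' heq := by
    have := h.pos_inj _ (by omega) _ (by omega) heq
    omega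
  rp_lt := h.res_lt
  exists_enq := h.exists_enq
  enq_unique := h.enq_unique
  deq_unique := h.deq_unique
  a_eq e he := by
    refine le_antisymm ?_ (le_opMax (ix := g) (w := pos) he)
    rcases exists_opMax (p := fun i => (x i).abs.method = .enq) (ix := g) (w := pos)
      (j := g e) with h0 | ⟨i, hi, hg, h0⟩
    · omega
    · rw [h.enq_unique i e hi he hg] at h0
      omega
  b_le o ho := by
    have := le_opMax (ix := g) (w := fun o => n + n - pos (n + o)) (i := o)
      (p := fun i => (x i).abs.method ≠ .empty) ho
    simp only [firstRes]
    omega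
  exists_b e he := by
    have he' : (x e).abs.method ≠ .empty := by simp [he]
    have h1 := le_opMax (ix := g) (w := fun o => n + n - pos (n + o)) (i := e)
      (p := fun i => (x i).abs.method ≠ .empty) he'
    have h2 := h.res_lt e
    rcases exists_opMax (p := fun i => (x i).abs.method ≠ .empty) (ix := g)
      (w := fun o => n + n - pos (n + o)) (j := g e) with h0 | ⟨i, hi, hg, h0⟩
    · omega
    · refine ⟨i, hi, hg, ?_⟩
      have := h.res_lt i
      simp only [firstRes]
      omega
  c_le o ho := by
    have := le_opMax (ix := g) (w := fun o => n + n - pos (n + o)) (i := o)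
      (p := fun i => (x i).abs.method.IsFront) ho
    simp only [frontRes]
    omega
  exists_c e he := by
    rcases exists_opMax (p := fun i => (x i).abs.method.IsFront) (ix := g)
      (w := fun o => n + n - pos (n + o)) (j := g e) with h0 | ⟨i, hi, hg, h0⟩
    · left
      simp only [frontRes]
      omega
    · refine Or.inr ⟨i, hi, hg, ?_⟩
      have := h.res_lt i
      simp only [frontRes]
      omega
  le_d o ho := (le_opMax (ix := g) (w := pos) (p := fun i => (x i).abs.method ≠ .empty) ho).trans
    (le_max_left _ _)
  d_eq e he hno := by
    have h0 : deqRes x pos g (g e) < 1 := by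
      by_contra! hlt
      obtain ⟨i, hi, hg, -⟩ := lt_opMax.1 (show 0 < deqRes x pos g (g e) from hlt)
      exact hno i hi hg
    refine le_antisymm (max_le ?_ ?_) ((le_opMax (ix := g) (w := fun _ => n + n)
      (p := fun i => (x i).abs.method = .enq ∧ deqRes x pos g (g i) < 1) ⟨he, h0⟩).trans
      (le_max_right _ _))
    · by_contra! hlt
      obtain ⟨i, -, -, hi⟩ := lt_opMax.1 hlt
      have := h.pos_lt i (by omega)
      omega
    · by_contra! hlt
      obtain ⟨i, -, -, hi⟩ := lt_opMax.1 hlt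
      omega
  exists_d e o he ho hg := by
    have h0 : opMax (fun i => (x i).abs.method = .enq ∧ deqRes x pos g (g i) < 1) g
        (fun _ => n + n) (g e) = 0 := by
      by_contra hne
      obtain ⟨i, hi, hgi, -⟩ := lt_opMax.1 (Nat.pos_of_ne_zero hne)
      have h1 := le_opMax (ix := g) (w := fun o => n + n - pos (n + o)) (i := o)
        (p := fun i => (x i).abs.method = .deq) ho
      have h2 := hi.2
      rw [hgi, ← hg, deqRes] at h2
      have := h.res_lt o
      omega
    have h1 : lastInv x pos g (g e) = opMax (fun i => (x i).abs.method ≠ .empty) g pos (g e) := by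
      rw [lastInv, Pi.sup_apply, h0]
      simp
    have he' : (x e).abs.method ≠ .empty := by simp [he]
    rw [h1]
    rcases exists_opMax (p := fun i => (x i).abs.method ≠ .empty) (ix := g) (w := pos)
      (j := g e) with h2 | ⟨i, hi, hgi, h2⟩
    · have h3 := le_opMax (ix := g) (w := pos) (i := e)
        (p := fun i => (x i).abs.method ≠ .empty) he'
      exact ⟨e, he', rfl, by omega⟩
    · exact ⟨i, hi, hgi, h2⟩

theorem lastInv_le (h : IsIndexing x pos g) (v : ℕ) : lastInv x pos g v ≤ n + n := by
  refine max_le ?_ ?_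
  · by_contra! hlt
    obtain ⟨i, -, -, hi⟩ := lt_opMax.1 hlt
    have := h.pos_lt i (by omega)
    omega
  · by_contra! hlt
    obtain ⟨i, -, -, hi⟩ := lt_opMax.1 hlt
    omega

theorem lt_frontReach {q m : ℕ} (hq : q ≤ n + n) : m < frontReach x pos g q ↔
    ∃ e : Fin n, (x e).abs.method = .enq ∧ n + n - frontRes x pos g (g e) < q ∧
      m < lastInv x pos g (g e) := by
  rw [frontReach, lt_prefixMax (by omega)]
  simp only [lt_opMax]
  constructor
  · rintro ⟨j, hj, i, h1, rfl, h2⟩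
    exact ⟨i, h1, hj, h2⟩
  · rintro ⟨i, h1, hj, h2⟩
    exact ⟨_, hj, i, h1, rfl, h2⟩

theorem lt_cover {q m : ℕ} (hq : q ≤ n + n) : m < cover x pos g q ↔
    ∃ e : Fin n, (x e).abs.method = .enq ∧ n + n - firstRes x pos g (g e) < q ∧
      m < lastInv x pos g (g e) := by
  rw [cover, lt_prefixMax (by omega)]
  simp only [lt_opMax]
  constructor
  · rintro ⟨j, hj, i, h1, rfl, h2⟩
    exact ⟨i, h1, hj, h2⟩
  · rintro ⟨i, h1, hj, h2⟩
    exact ⟨_, hj, i, h1, rfl, h2⟩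

/-- The inner lookup of `frontReach` at d(e) absorbs the third value f of the condition `indirect`.
-/
theorem lt_enqReach (h : IsIndexing x pos g) {q m : ℕ} (hq : q ≤ n + n) :
    m < enqReach x pos g q ↔
    ∃ e : Fin n, (x e).abs.method = .enq ∧ n + n - firstRes x pos g (g e) < q ∧
      (m < lastInv x pos g (g e) ∨ ∃ f : Fin n, (x f).abs.method = .enq ∧
        n + n - frontRes x pos g (g f) < lastInv x pos g (g e) ∧ m < lastInv x pos g (g f)) := by
  rw [enqReach, lt_prefixMax (by omega)]
  simp only [lt_opMax, lt_max_iff, lt_frontReach (h.lastInv_le _)]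
  constructor
  · rintro ⟨j, hj, i, h1, rfl, h2⟩
    exact ⟨i, h1, hj, h2⟩
  · rintro ⟨i, h1, hj, h2⟩
    exact ⟨_, hj, i, h1, rfl, h2⟩

/-- A position j is a valid cut if the largest d among the values with b < j is below j; the last
such cut is the best candidate for an empty. -/
theorem lt_lastGap {q m : ℕ} (hq : q ≤ n + n) : m < lastGap x pos g q ↔
    ∃ j < q, m < j ∧ ∀ e : Fin n, (x e).abs.method = .enq →
      n + n - firstRes x pos g (g e) < j → lastInv x pos g (g e) < j := by
  rw [lastGap, lt_prefixMax hq]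
  simp only [lt_scatterMax, id]
  constructor
  · rintro ⟨_, hj, j, hj', h1, rfl, h2⟩
    refine ⟨j, hj, h2, fun e he h3 => ?_⟩
    by_contra! h4
    exact absurd ((lt_cover hj'.le).2 ⟨e, he, h3, (show j - 1 < _ by omega)⟩) (by omega)
  · rintro ⟨j, hj, h1, h2⟩
    refine ⟨j, hj, j, by omega, ?_, rfl, h1⟩
    by_contra! h3
    obtain ⟨e, he, h4, h5⟩ := (lt_cover (x := x) (pos := pos) (g := g) (m := j - 1)
      (show j ≤ n + n by omega)).1 (by omega)
    have := h2 e he h4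
    omega

theorem peek_violation (h : IsIndexing x pos g) {i : Fin n} :
    n + n - deqRes x pos g (g i) < peekInv x pos g (g i) ↔
    ∃ p o : Fin n, (x p).abs.method = .peek ∧ (x o).abs.method = .deq ∧ g p = g i ∧ g o = g i ∧
      pos (n + o) < pos p := by
  rw [peekInv, lt_opMax]
  constructor
  · rintro ⟨p, hp, hg, hlt⟩
    have h1 := h.pos_lt p (by omega)
    obtain ⟨o, ho, hgo, h2⟩ : ∃ i' : Fin n, (x i').abs.method = .deq ∧ g i' = g i ∧
        n + n - pos (n + i') = deqRes x pos g (g i) := by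
      refine (exists_opMax (p := fun i => (x i).abs.method = .deq) (ix := g)
        (w := fun o => n + n - pos (n + o)) (j := g i)).resolve_left fun h0 => ?_
      rw [deqRes, h0] at hlt
      omega
    have := h.res_lt o
    exact ⟨p, o, hp, ho, hg, hgo, by omega⟩
  · rintro ⟨p, o, hp, ho, hg, hgo, hlt⟩
    refine ⟨p, hp, hg, ?_⟩
    have := le_opMax (ix := g) (w := fun o => n + n - pos (n + o)) (i := o)
      (p := fun i => (x i).abs.method = .deq) ho
    rw [hgo] at this
    simp only [deqRes]
    omega

theorem violations_pos : 0 < violations x pos g 0 ↔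
    ∃ i, EnqViolation x pos g i ∨ EmptyViolation x pos g i := by
  simp [violations, lt_opMax, exists_or]

/-- The analysis decides the criterion. -/
theorem criterion_iff (h : IsIndexing x pos g) :
    Criterion (fun i => (x i).abs.method) (fun i : Fin n => g i) (fun i : Fin n => pos i)
      (fun i : Fin n => pos (n + i)) (opMax (fun i => (x i).abs.method = .enq) g pos)
      (fun v => n + n - firstRes x pos g v) (fun v => n + n - frontRes x pos g v)
      (lastInv x pos g) ↔ ¬ 0 < violations x pos g 0 := by
  have S := h.summary
  rw [violations_pos]
  constructor
  · rintro C ⟨i, ⟨hi, hv⟩ | ⟨hi, hv⟩⟩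
    · rcases hv with hv | hv | hv | hv
      · have h1 := C.valid i hi
        rw [S.a_eq i hi] at h1
        exact hv h1
      · obtain ⟨p, o, hp, ho, hgp, hgo, hlt⟩ := h.peek_violation.1 hv
        exact absurd (C.peek p o hp ho (hgp.trans hgo.symm)) hlt.not_gt
      · have h0 := h.lastInv_le (g i)
        obtain ⟨e, he, h1, h2⟩ := (lt_frontReach (by omega)).1 hv
        -- The lookup is capped at c(i), so c(e) < c(i); this keeps a value from being reported
        -- against itself.
        have h3 : e ≠ i := by
          rintro rfl
          omega
        exact C.front e i he hi h3 ⟨by omega, by omega⟩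
      · obtain ⟨e, he, h1, h2⟩ := (h.lt_enqReach (h.pos_lt i (by omega)).le).1 hv
        rw [← S.a_eq i hi] at h1
        rcases h2 with h2 | ⟨f, hf, h2, h3⟩
        · exact C.direct e i he hi h1 h2
        · exact C.indirect e i f he hi hf h1 h2 h3
    · obtain ⟨q, h1, h2, h3⟩ := C.gap i hi
      exact hv ((lt_lastGap (by have := h.res_lt i; omega)).2 ⟨q, by omega, h1, h3⟩)
  · intro hno
    have hE : ∀ i : Fin n, (x i).abs.method = .enq → _ := fun i hi =>
      not_or.1 fun hv => hno ⟨i, Or.inl ⟨hi, hv⟩⟩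
    refine ⟨?_, ?_, ?_, ?_, ?_, ?_⟩
    · intro e he
      rw [S.a_eq e he]
      exact not_not.1 (hE e he).1
    · intro p o hp ho hpo
      by_contra! hlt
      obtain ⟨e, he, hge⟩ := h.exists_enq o (by simp [ho])
      have h1 := (not_or.1 (hE e he).2).1
      rw [h.peek_violation] at h1
      exact h1 ⟨p, o, hp, ho, hpo.trans hge.symm, hge.symm, lt_of_le_of_ne hlt (S.ne _ _)⟩
    · have main : ∀ e e' : Fin n, (x e).abs.method = .enq → (x e').abs.method = .enq →
          n + n - frontRes x pos g (g e) < n + n - frontRes x pos g (g e') →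
          n + n - frontRes x pos g (g e) < lastInv x pos g (g e') →
          ¬ n + n - frontRes x pos g (g e') < lastInv x pos g (g e) := by
        intro e e' he he' h1 h2 h3
        have h4 := (not_or.1 (not_or.1 (hE e' he').2).2).1
        have h5 := h.lastInv_le (g e')
        rw [lt_frontReach (by omega)] at h4
        exact h4 ⟨e, he, by omega, h3⟩
      rintro e e' he he' hne ⟨h1, h2⟩
      rcases lt_trichotomy (n + n - frontRes x pos g (g e)) (n + n - frontRes x pos g (g e'))
        with h3 | h3 | h3
      · exact main e e' he he' h3 h1 h2
      -- The cap loses nothing: equal finite c come from the same operation, hence the same value,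
      -- and an infinite c is not below any d.
      · have h4 := h.lastInv_le (g e')
        rcases S.exists_c e he with h5 | ⟨f, hf, hgf, h5⟩
        · omega
        rcases S.exists_c e' he' with h6 | ⟨f', hf', hgf', h6⟩
        · omega
        have h7 := h.pos_inj _ (by omega) _ (by omega) (h5.trans (h3.trans h6.symm))
        have h8 : f = f' := Fin.ext (by omega)
        rw [h8] at hgf
        exact hne (h.enq_unique e e' he he' (hgf.symm.trans hgf'))
      · exact main e' e he' he h3 h2 h1
    · intro e e' he he' h1 h2
      have h3 := (not_or.1 (not_or.1 (hE e' he').2).2).2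
      rw [S.a_eq e' he'] at h1
      rw [h.lt_enqReach (h.pos_lt e' (by omega)).le] at h3
      exact h3 ⟨e, he, h1, Or.inl h2⟩
    · intro e e' f he he' hf h1 h2 h4
      have h3 := (not_or.1 (not_or.1 (hE e' he').2).2).2
      rw [S.a_eq e' he'] at h1
      rw [h.lt_enqReach (h.pos_lt e' (by omega)).le] at h3
      exact h3 ⟨e, he, h1, Or.inr ⟨f, hf, h2, h4⟩⟩
    · intro o ho
      have h1 : pos o < lastGap x pos g (pos (n + o) + 1) := by
        by_contra h1
        exact hno ⟨o, Or.inr ⟨ho, h1⟩⟩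
      rw [lt_lastGap (by have := h.res_lt o; omega)] at h1
      obtain ⟨q, h2, h3, h4⟩ := h1
      exact ⟨q, h3, by omega, h4⟩

end IsIndexing

end


/-! ### The program -/

namespace Monitor

/-- The counter of a loop. -/
def it : Expr := .reg 1

/-- The number of endpoints. -/
def ends : Expr := .add .numOps .numOps

/-- The true test. -/
def always : Test := .lt (.const 0) (.const 1)

/-- The position of the invocation of the operation `it`. -/
def inv : Expr := .arr 1 it

/-- The position of the response of the operation `it`. -/
def res : Expr := .arr 1 (.add .numOps it)

/-- The group of the operation `it`. -/
def group : Expr := .arr 5 it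

/-- The first response of a `deq` or `peek` with the same value. -/
def front : Expr := .sub ends (.arr 6 group)

/-- The first response of an operation with the same value. -/
def first : Expr := .sub ends (.arr 7 group)

/-- The last invocation of an operation with the same value. -/
def last : Expr := .arr 10 group

/-- The test for the method of the operation `it`. -/
def isMethod (m : Method) : Test := .hasMethod m it

/-- Computes the groups of operations with the same value. -/
def groups : Prog :=
  .seq (scatterLoop 4 .numOps (valTest (.arr 2 (.sub it (.const 1))) (.arr 2 it)) it it)
    (.seq (prefixLoop 5 4 .numOps)
      (scatterLoop 6 .numOps always (.arr 2 it) (.arr 4 (.add it (.const 1)))))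

/-- Computes the extremal positions of the endpoints of operations with the same value. -/
def extrema : Prog :=
  .seq (scatterLoop 7 .numOps (.disj (isMethod .deq) (isMethod .peek)) group (.sub ends res))
    (.seq (scatterLoop 8 .numOps (.neg (isMethod .empty)) group (.sub ends res))
      (.seq (scatterLoop 9 .numOps (isMethod .deq) group (.sub ends res))
        (.seq (scatterLoop 10 .numOps (isMethod .peek) group inv)
          (.seq (scatterLoop 11 .numOps (.neg (isMethod .empty)) group inv)
            (scatterLoop 11 .numOps
              (.conj (isMethod .enq) (.lt (.arr 8 group) (.const 1))) group ends)))))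

/-- Computes the maxima of the positions over several values. -/
def reaches : Prog :=
  .seq (scatterLoop 12 .numOps (isMethod .enq) front last)
    (.seq (prefixLoop 13 12 (.add ends (.const 1)))
      (.seq (scatterLoop 14 .numOps (isMethod .enq) first (.max last (.arr 12 last)))
        (.seq (prefixLoop 15 14 (.add ends (.const 1)))
          (.seq (scatterLoop 16 .numOps (isMethod .enq) first last)
            (.seq (prefixLoop 17 16 (.add ends (.const 1)))
              (.seq (scatterLoop 18 ends (.lt (.arr 16 it) it) it it)
                (prefixLoop 19 18 ends)))))))

/-- Searches for violations. -/
def search : Prog :=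
  .seq (scatterLoop 20 .numOps
      (.conj (isMethod .enq) (.disj (.neg (.lt inv first))
        (.disj (.lt (.sub ends (.arr 8 group)) (.arr 9 group))
          (.disj (.lt front (.arr 12 (.min last front))) (.lt front (.arr 14 inv))))))
      (.const 0) (.const 1))
    (scatterLoop 20 .numOps
      (.conj (isMethod .empty) (.neg (.lt inv (.arr 18 (.add res (.const 1))))))
      (.const 0) (.const 1))

/-- Sorts the endpoints, and computes their positions. -/
def endpoints : Prog :=
  .seq (sortProg 1 ends (timeTest (.reg 10) (.reg 9)))
    (scatterLoop 2 ends always (.arr 0 it) it)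

/-- Decides linearizability. -/
def program : Prog :=
  .seq (.seq endpoints (sortProg 3 .numOps (valTest (.reg 10) (.reg 9))))
    (.seq (.seq groups (.seq extrema (.seq reaches search)))
      (.setReg 0 (.sub (.const 1) (.arr 19 (.const 0)))))

end Monitor

section

variable {P : Type u} {V : Type v} [LinearOrder V] {n : ℕ} (x : Fin n → Operation P V)

open Monitor

/-- The lists record array contents by the index used in `Expr.arr`; the loops name machine arrays,
whose number is larger by one. -/
theorem Monitor.transforms_groups (τ pos ν : ℕ → ℕ) (hν : IsListing n ν) :
    ∃ B R, Transforms x groups [τ, pos, ν] [τ, pos, ν, B, R, groupId (valKey x) n ν] := by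
  refine ⟨_, _, .seq (l₂ := [τ, pos, ν] ++ [_]) (.scatter (K := n) (G' := fun k =>
    valKey x (ν (k - 1)) < valKey x (ν k)) (ix' := id) (w' := id) rfl (by omega) (fun _ => rfl)
    ?_ ?_ ?_) (.seq (l₂ := [τ, pos, ν, _] ++ [_]) (.prefix (K := n) rfl (by simp) (by simp) rfl
    (by omega) fun _ => rfl) (.scatter (l := [τ, pos, ν, _, _]) (K := n) (G' := fun _ => True)
    (ix' := ν) rfl (by omega) (fun _ => rfl) ?_ ?_ ?_))⟩
  · intro k hk σ hσ
    have h1 : (Expr.arr 2 (.sub it (.const 1))).eval n σ = ν (k - 1) := by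
      simp [it, Expr.eval, hσ.1, hσ.2]
    have h2 : (Expr.arr 2 it).eval n σ = ν k := by simp [it, Expr.eval, hσ.1, hσ.2]
    rw [holds_valTest, h1, h2]
    · rw [h1]
      exact hν.1 _ (by omega)
    · rw [h2]
      exact hν.1 _ hk
  · intro k _ _ σ hσ
    simp [it, Expr.eval, hσ.1]
  · intro k _ _ σ hσ
    simp [it, Expr.eval, hσ.1]
  · intro k _ σ hσ
    simp [always, Test.Holds, Expr.eval]
  · intro k _ _ σ hσ
    simp [it, Expr.eval, hσ.1, hσ.2]
  · intro k _ _ σ hσ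
    simp [it, Expr.eval, hσ.1, hσ.2]

theorem Monitor.transforms_extrema (τ pos ν B R g : ℕ → ℕ) :
    Transforms x extrema [τ, pos, ν, B, R, g] [τ, pos, ν, B, R, g, frontRes x pos g,
      firstRes x pos g, deqRes x pos g, peekInv x pos g, lastInv x pos g] := by
  refine .seq (l₂ := [τ, pos, ν, B, R, g] ++ [_]) (.op rfl ?_ ?_ ?_)
    (.seq (l₂ := [τ, pos, ν, B, R, g, _] ++ [_]) (.op rfl ?_ ?_ ?_)
    (.seq (l₂ := [τ, pos, ν, B, R, g, _, _] ++ [_]) (.op rfl ?_ ?_ ?_)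
    (.seq (l₂ := [τ, pos, ν, B, R, g, _, _, _] ++ [_]) (.op rfl ?_ ?_ ?_)
    (.seq (l₂ := [τ, pos, ν, B, R, g, _, _, _, _] ++ [_]) (.op rfl ?_ ?_ ?_)
    (.op_append (l := [τ, pos, ν, B, R, g, _, _, _, _]) rfl ?_ ?_ ?_))))) <;>
  · intro i σ hσ
    simp [isMethod, group, ends, res, inv, it, Expr.eval, Test.Holds, Method.IsFront, deqRes,
      hσ.1, hσ.2, Fin.val_inj]

theorem Monitor.transforms_reaches (τ pos ν B R g a b : ℕ → ℕ) :
    ∃ r₁ r₂ r₃ r₄, Transforms x reaches [τ, pos, ν, B, R, g, frontRes x pos g, firstRes x pos g,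
      a, b, lastInv x pos g] [τ, pos, ν, B, R, g, frontRes x pos g, firstRes x pos g,
      a, b, lastInv x pos g, r₁, frontReach x pos g, r₂, enqReach x pos g, r₃, cover x pos g, r₄,
      lastGap x pos g] := by
  set c := frontRes x pos g with hc
  set f := firstRes x pos g with hf
  set d := lastInv x pos g with hd
  refine ⟨_, _, _, _, .seq (l₂ := [τ, pos, ν, B, R, g, c, f, a, b, d] ++ [_])
    (.op (p := fun i => (x i).abs.method = .enq) rfl ?_ ?_ ?_)
    (.seq (l₂ := [τ, pos, ν, B, R, g, c, f, a, b, d, _] ++ [_])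
      (.prefix rfl (by simp) (by simp) rfl (by omega) fun _ => rfl)
    (.seq (l₂ := [τ, pos, ν, B, R, g, c, f, a, b, d, _, _] ++ [_])
      (.op (p := fun i => (x i).abs.method = .enq) rfl ?_ ?_ ?_)
    (.seq (l₂ := [τ, pos, ν, B, R, g, c, f, a, b, d, _, _, _] ++ [_])
      (.prefix rfl (by simp) (by simp) rfl (by omega) fun _ => rfl)
    (.seq (l₂ := [τ, pos, ν, B, R, g, c, f, a, b, d, _, _, _, _] ++ [_])
      (.op (p := fun i => (x i).abs.method = .enq) rfl ?_ ?_ ?_)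
    (.seq (l₂ := [τ, pos, ν, B, R, g, c, f, a, b, d, _, _, _, _, _] ++ [_])
      (.prefix rfl (by simp) (by simp) rfl (by omega) fun _ => rfl)
    (.seq (l₂ := [τ, pos, ν, B, R, g, c, f, a, b, d, _, _, _, _, _, _] ++ [_])
      (.scatter (K := n + n) rfl (by omega) (fun _ => rfl) ?_ ?_ ?_)
      (.prefix (l := [τ, pos, ν, B, R, g, c, f, a, b, d, _, _, _, _, _, _, _]) rfl (by simp)
        (by simp) rfl (by omega) fun _ => rfl)))))))⟩
  all_goals first
    | intro i σ hσ
      simp [isMethod, group, ends, front, first, last, it, Expr.eval, Expr.eval_max,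
        Test.Holds, hσ.1, hσ.2, Fin.val_inj, ← hc, ← hf, ← hd] <;> rfl
    | intro k hk σ hσ
      simp [it, Expr.eval, Test.Holds, hσ.1, hσ.2] <;> rfl
    | intro k hk _ σ hσ
      simp [it, Expr.eval, hσ.1]

theorem Monitor.transforms_search (τ pos ν B R g r₁ r₂ r₃ r₄ : ℕ → ℕ) :
    Transforms x search [τ, pos, ν, B, R, g, frontRes x pos g, firstRes x pos g,
      deqRes x pos g, peekInv x pos g, lastInv x pos g, r₁, frontReach x pos g, r₂,
      enqReach x pos g, r₃, cover x pos g, r₄, lastGap x pos g]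
      ([τ, pos, ν, B, R, g, frontRes x pos g, firstRes x pos g,
      deqRes x pos g, peekInv x pos g, lastInv x pos g, r₁, frontReach x pos g, r₂,
      enqReach x pos g, r₃, cover x pos g, r₄, lastGap x pos g] ++ [violations x pos g]) := by
  refine .seq (.op rfl ?_ ?_ ?_) (.op_append rfl ?_ ?_ ?_)
  · intro i σ hσ
    simp [isMethod, group, ends, front, first, last, inv, it, Expr.eval, Expr.eval_min,
      Test.Holds, EnqViolation, hσ.1, hσ.2, Fin.val_inj]
  · intro i σ hσ
    rfl
  · intro i σ hσ
    rfl
  · intro i σ hσ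
    simp [isMethod, inv, res, it, Expr.eval, Test.Holds, EmptyViolation, hσ.1, hσ.2, Fin.val_inj]
  · intro i σ hσ
    rfl
  · intro i σ hσ
    rfl

end

/-! ### Correctness and running time -/

section

variable {P : Type u} {V : Type v} [LinearOrder V] {n : ℕ} (x : Fin n → Operation P V)

open Monitor

/-- Only the two sorts use the full budget; the linear phases fit because n + 1 ≤ `budget n`. -/
theorem Monitor.exists_run : ∃ (σ : Store) (τ ν : ℕ → ℕ),
    RunsTo x program Store.init σ (program.weight * budget n) ∧
    IsListing (n + n) τ ∧ (∀ m m', m < m' → m' < n + n → timeKey x (τ m) ≤ timeKey x (τ m')) ∧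
    IsListing n ν ∧ (∀ m m', m < m' → m' < n → valKey x (ν m) ≤ valKey x (ν m')) ∧
    σ.reg 0 = 1 - violations x (position (n + n) τ) (groupId (valKey x) n ν) 0 := by
  obtain ⟨σ₁, τ, e₁, h₁, hτ, hτs⟩ := RunsTo.sort (x := x) (A := 1) (l := []) (N := ends)
    (K := n + n) (key := timeKey x) (σ := Store.init) (cmp := timeTest (.reg 10) (.reg 9)) rfl
    (fun _ => rfl) (by omega) (fun _ => rfl) (fun σ h h' => holds_timeTest x h h')
  obtain ⟨σ₂, e₂, h₂⟩ := Transforms.scatter (x := x) (A := 2) (K := n + n) (l := [τ])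
    (G := always) (N := ends) (ix := .arr 0 it) (w := it) (G' := fun _ => True) (ix' := τ)
    (w' := id) rfl (by omega) (fun _ => rfl)
    (fun k _ σ _ => by simp [always, Test.Holds, Expr.eval])
    (fun k _ _ σ hσ => by simp [it, Expr.eval, hσ.1, hσ.2])
    (fun k _ _ σ hσ => by simp [it, Expr.eval, hσ.1]) σ₁ h₁
  obtain ⟨σ₃, ν, e₃, h₃, hν, hνs⟩ := RunsTo.sort (x := x) (A := 3) (N := .numOps)
    (K := n) (key := valKey x) (σ := σ₂) (cmp := valTest (.reg 10) (.reg 9)) rfl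
    h₂ (by omega) (fun _ => rfl) (fun σ h h' => holds_valTest x h h')
  obtain ⟨B, R, h₄⟩ := transforms_groups x τ (position (n + n) τ) ν hν
  obtain ⟨r₁, r₂, r₃, r₄, h₅⟩ := transforms_reaches x τ (position (n + n) τ) ν B R
    (groupId (valKey x) n ν) (deqRes x (position (n + n) τ) (groupId (valKey x) n ν))
    (peekInv x (position (n + n) τ) (groupId (valKey x) n ν))
  obtain ⟨σ₄, e₄, h₆⟩ := (h₄.seq ((transforms_extrema x _ _ _ _ _ _).seq
    (h₅.seq (transforms_search x _ _ _ _ _ _ _ _ _ _)))) σ₃ h₃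
  have e₅ : RunsTo x (.setReg 0 (.sub (.const 1) (.arr 19 (.const 0)))) σ₄ _ _ :=
    RunsTo.setReg rfl
  have hB : n + 1 ≤ budget n := Nat.le_mul_of_pos_right _ (Nat.succ_pos _)
  refine ⟨_, τ, ν, ((e₁.seq_weight (e₂.mono (Nat.mul_le_mul_left _ hB))).seq_weight e₃).seq_weight
    ((e₄.mono (Nat.mul_le_mul_left _ hB)).seq_weight (RunsTo.scale e₅ (n.succ_pos.trans_le hB))),
    hτ, hτs, hν, hνs, ?_⟩
  have := h₆ 19
  simp only [List.cons_append, List.nil_append, List.getD_cons_succ, List.getD_cons_zero] at this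
  simp [Store.setReg, Expr.eval, this]

end

section

variable {P : Type u} {V : Type v} [LinearOrder V] {H : History P V} {n : ℕ}

/-- Linearizability is equivalent to the absence of violations. -/
theorem History.Unambiguous.linearizable_iff (hH : H.Unambiguous) (e : Fin n ≃ H.ops)
    {τ ν : ℕ → ℕ} (hτ : IsListing (n + n) τ)
    (hτs : ∀ m m', m < m' → m' < n + n →
      timeKey (fun i => (e i : Operation P V)) (τ m) ≤ timeKey (fun i => (e i : Operation P V)) (τ m'))
    (hν : IsListing n ν)
    (hνs : ∀ m m', m < m' → m' < n →
      valKey (fun i => (e i : Operation P V)) (ν m) ≤ valKey (fun i => (e i : Operation P V)) (ν m')) :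
    H.Linearizable ↔ ¬ 0 < violations (fun i => (e i : Operation P V)) (position (n + n) τ)
      (groupId (valKey fun i => (e i : Operation P V)) n ν) 0 := by
  set x : Fin n → Operation P V := fun i => (e i : Operation P V) with hx
  set pos := position (n + n) τ with hpos
  set g := groupId (valKey x) n ν with hg
  have hgv : ∀ i j : Fin n, g i = g j ↔ (x i).abs.val = (x j).abs.val := by
    intro i j
    rw [hg, hν.groupId_eq_iff hνs i.2 j.2, valKey_val, valKey_val, optionKey_inj]
  have hlt : ∀ u < n + n, ∀ v < n + n, timeKey x u < timeKey x v → pos u < pos v :=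
    fun u hu v hv h => hτ.position_lt_position hτs hu hv h
  -- Other ties in the sorting are broken arbitrarily; only the order of a response relative to an
  -- invocation is ever interpreted as time.
  have hpr : ∀ i j : Fin n, pos (n + i) < pos j ↔ (x i).res ≤ (x j).inv := by
    intro i j
    constructor
    · intro h
      by_contra! hlt'
      refine absurd (hlt j (by omega) (n + i) (by omega) ?_) h.not_gt
      rw [timeKey_inv, timeKey_res, Prod.Lex.toLex_lt_toLex]
      exact Or.inl hlt'
    · intro h
      refine hlt _ (by omega) _ (by omega) ?_
      rw [timeKey_inv, timeKey_res, Prod.Lex.toLex_lt_toLex]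
      rcases h.lt_or_eq with h | h
      · exact Or.inl h
      · exact Or.inr ⟨h, zero_lt_one⟩
  have enq_val : ∀ i : Fin n, (x i).abs.method = .enq → ∃ y, (x i).abs = .enq y ∧
      (x i).abs.val = some y := by
    intro i hi
    obtain ⟨y, hy⟩ := AbsOp.method_eq_enq.1 hi
    exact ⟨y, hy, by rw [hy]; rfl⟩
  have deq_val : ∀ i : Fin n, (x i).abs.method = .deq → ∃ y, (x i).abs = .deq y ∧
      (x i).abs.val = some y := by
    intro i hi
    obtain ⟨y, hy⟩ := AbsOp.method_eq_deq.1 hi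
    exact ⟨y, hy, by rw [hy]; rfl⟩
  have I : IsIndexing x pos g := by
    refine ⟨fun u hu => hτ.position_lt hu, fun u hu v hv => hτ.position_inj hu hv, ?_, ?_, ?_, ?_⟩
    · intro i
      refine hlt _ (by omega) _ (by omega) ?_
      rw [timeKey_inv, timeKey_res, Prod.Lex.toLex_lt_toLex]
      exact Or.inl (x i).inv_lt_res
    · intro i hi
      obtain ⟨y, hy⟩ : ∃ y, (x i).abs.val = some y := by
        rw [← Option.ne_none_iff_exists', ne_eq, ← AbsOp.method_eq_empty_iff_val]
        exact hi
      obtain ⟨o, ho⟩ := hH.exists_enq (e i) hy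
      refine ⟨e.symm o, ?_, (hgv _ _).2 ?_⟩
      · simp [hx, ho, AbsOp.method]
      · rw [hy]
        simp [hx, ho, AbsOp.val]
    · intro i j hi hj hij
      obtain ⟨y, hy, hy'⟩ := enq_val i hi
      obtain ⟨z, hz, hz'⟩ := enq_val j hj
      rw [hgv, hy', hz', Option.some.injEq] at hij
      exact e.injective (hH.enq_unique hy (hij ▸ hz))
    · intro i j hi hj hij
      obtain ⟨y, hy, hy'⟩ := deq_val i hi
      obtain ⟨z, hz, hz'⟩ := deq_val j hj
      rw [hgv, hy', hz', Option.some.injEq] at hij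
      exact e.injective (hH.deq_unique hy (hij ▸ hz))
  rw [← I.criterion_iff]
  constructor
  · intro h
    obtain ⟨t, ht, hres⟩ := h.exists_fifoOrder hH
    exact I.summary.criterion (t := t ∘ e)
      ((ht.comp_equiv e).congr fun o o' _ _ => (hgv o o').symm)
      (fun o o' h => hres _ _ ((hpr o o').1 h)) fun o _ => I.lastInv_le _
  · intro C
    obtain ⟨t, ht, hres⟩ := I.summary.exists_fifoOrder C
    have h1 := (ht.congr (g' := fun i => (x i).abs.val) fun o o' _ _ => hgv o o').comp_equiv e.symm
    have h2 : (fun i => (x i).abs.method) ∘ e.symm = fun o : H.ops => o.1.abs.method := by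
      ext o
      simp [hx]
    have h3 : (fun i => (x i).abs.val) ∘ e.symm = fun o : H.ops => o.1.abs.val := by
      ext o
      simp [hx]
    rw [h2, h3] at h1
    exact h1.linearizable hH fun o o' h => hres _ _ ((hpr _ _).2 (by simpa [hx] using h))

end

/-- For n ≥ 2 one has n + 1 ≤ 2n, and clog(2n) + 1 ≤ log₂ n + 3 ≤ 4 log₂ n, which gives the constant
8 / log 2. -/
theorem budget_isBigO :
    (fun n : ℕ => (budget n : ℝ)) =O[atTop] fun n : ℕ => (n : ℝ) * Real.log n := by
  refine IsBigO.of_bound (8 / Real.log 2) ?_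
  filter_upwards [eventually_ge_atTop 2] with n hn
  have hn' : (2 : ℝ) ≤ n := by exact_mod_cast hn
  have hlog2 : 0 < Real.log 2 := Real.log_pos one_lt_two
  have hlog : Real.log 2 ≤ Real.log n := Real.log_le_log two_pos hn'
  have h1 : 1 ≤ Real.logb 2 n := by
    rw [Real.logb, le_div_iff₀ hlog2]
    linarith
  have h2 : (Nat.clog 2 (2 * n) : ℝ) ≤ Real.logb 2 n + 2 := by
    rw [← Real.natCeil_logb_natCast]
    have h3 : Real.logb ((2 : ℕ) : ℝ) ((2 * n : ℕ) : ℝ) = Real.logb 2 n + 1 := by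
      push_cast
      rw [Real.logb_mul two_ne_zero (by positivity), Real.logb_self_eq_one one_lt_two, add_comm]
    rw [h3]
    have := Nat.ceil_lt_add_one (show 0 ≤ Real.logb 2 n + 1 by linarith)
    linarith
  rw [Real.norm_of_nonneg (by positivity), Real.norm_of_nonneg (by positivity)]
  calc (budget n : ℝ) = (n + 1) * (Nat.clog 2 (2 * n) + 1) := by simp [budget]
    _ ≤ (2 * n) * (4 * Real.logb 2 n) := by
        refine mul_le_mul (by linarith) (by linarith) (by positivity) (by positivity)
    _ = 8 / Real.log 2 * (n * Real.log n) := by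
        rw [Real.logb]
        ring

end QueueMonitoring

/-- There is one program that, for every unambiguous queue history, given as an array of its
operations in an arbitrary order, decides linearizability in time `O(n log n)`, where `n` is the
number of operations. -/
theorem mainTheorem2 :
    ∃ (c : QueueMonitoring.Prog) (T : ℕ → ℕ),
      ((fun n : ℕ => (T n : ℝ)) =O[atTop] fun n : ℕ => (n : ℝ) * Real.log n) ∧
      ∀ (P : Type u) (V : Type v) [LinearOrder V] (H : QueueMonitoring.History P V),
        H.Unambiguous →
        ∀ x : Fin H.size ≃ H.ops,
          QueueMonitoring.AnswersWithin c (fun i => (x i : QueueMonitoring.Operation P V))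
            (T H.size) H.Linearizable := by
  refine ⟨QueueMonitoring.Monitor.program,
    fun n => QueueMonitoring.Monitor.program.weight * QueueMonitoring.budget n, ?_, ?_⟩
  · simp only [Nat.cast_mul]
    exact QueueMonitoring.budget_isBigO.const_mul_left _
  · intro P V _ H hH x
    obtain ⟨σ, τ, ν, ⟨t, ht, e⟩, hτ, hτs, hν, hνs, h0⟩ :=
      QueueMonitoring.Monitor.exists_run fun i => (x i : QueueMonitoring.Operation P V)
    have h := hH.linearizable_iff x hτ hτs hν hνs
    exact ⟨σ, t, e, ht, fun hQ => by have := h.1 hQ; omega,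
      fun hQ => by have := not_not.1 (mt h.2 hQ); omega⟩
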